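/- Let $N\ge 2$, let $\Omega\subset\mathbb R^N$ be a bounded domain with $C^\infty$ boundary, and let $D$ be a subdomain with Lipschitz boundary and $\overline D\subset\Omega$. Let $p:\overline\Omega\to[1,\infty]$ satisfy $p=\infty$ on $D$, $p\in C^1(\overline\Omega\setminus D)$ (in particular $p$ is finite there), $$p^+:=\sup_{\overline\Omega\setminus\overline D}p<\infty,\qquad p_-:=\inf_{\overline\Omega}p>N,$$ and let $g\in C(\overline\Omega)$ satisfy $\int_{\partial\Omega}g\,dS=0$. For a measurable exponent $q$ with finite values, $L^{q(\cdot)}(U)$ is the set of measurable $f$ on $U$ with $\int_U|\lambda f|^{q(x)}dx<\infty$ for some $\lambda>0$, and $W^{1,q(\cdot)}(U)$ is the set of $u\in L^{q(\cdot)}(U)$ with weak gradient $\nabla u\in L^{q(\cdot)}(U)$. For integers $k>p^+$ put $p_k=\min\{p,k\}$, $$S_k=\Big\{u\in W^{1,p_k(\cdot)}(\Omega):\int_\Omega u=0\Big\},\qquad I_k(u)=\int_\Omega\frac{|\nabla u|^{p_k(x)}}{p_k(x)}\,dx-\int_{\partial\Omega}g\,u\,dS,$$ and put $$S=\Big\{u\in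 W^{1,p_-}(\Omega):\ u|_{\Omega\setminus\overline D}\in W^{1,p(\cdot)}(\Omega\setminus\overline D),\ \|\nabla u\|_{L^\infty(D)}\le 1,\ \int_\Omega u=0\Big\},$$ $$I_\infty(v)=\int_{\Omega\setminus\overline D}\frac{|\nabla v|^{p(x)}}{p(x)}\,dx-\int_{\partial\Omega}g\,v\,dS,$$ where the values on $\partial\Omega$ are taken in the sense of traces. Theorem 4.1. For every integer $k>p^+$ the functional $I_k$ has a minimizer $u_k$ in $S_k$, unique up to equality almost everywhere in $\Omega$. Each $u_k$ has a representative that is continuous on $\overline\Omega$, and a subsequence of these representatives converges uniformly on $\overline\Omega$ to a function $u_\infty\in S\cap C(\overline\Omega)$ such that (i) $u_\infty$ minimizes $I_\infty$ over $S$, that is, $I_\infty(u_\infty)\le I_\infty(v)$ for all $v\in S$; (ii) $u_\infty$ is infinity harmonic in $D$, that is, it is a viscosity solution in $D$ of $$\Delta_\infty u:=\sum_{i,j=1}^N\frac{\partial u}{\partial x_i}\frac{\partial u}{\partial x_j}\frac{\partial^2u}{\partial x_i\partial x_j}=0:$$ for $\varphi\in C^2(D)$ and $x_0\in D$, $-\Delta_\infty\varphi(x_0)\ge0$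 if $u_\infty-\varphi$ has a local minimum at $x_0$, and $-\Delta_\infty\varphi(x_0)\le0$ if $u_\infty-\varphi$ has a local maximum at $x_0$. -/

import Mathlib

open MeasureTheory Filter Topology Set
open scoped ENNReal ContDiff

noncomputable section

/-- The Euclidean space `ℝᴺ`. -/
abbrev Euc (N : ℕ) : Type := EuclideanSpace ℝ (Fin N)

variable {N : ℕ}

/-! ### Domains and their boundaries -/

/-- Inside some ball around `x₀`, the set `U` is the part below the graph of the function `γ`, which
is defined on the hyperplane orthogonal to the direction `e`. -/
def IsSubgraphNear (U : Set (Euc N)) (x₀ e : Euc N)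
    (γ : (Submodule.span ℝ {e})ᗮ → ℝ) : Prop :=
  ∃ r > 0, ∀ x ∈ Metric.ball x₀ r,
    x ∈ U ↔ inner ℝ e x < γ ((Submodule.span ℝ {e})ᗮ.orthogonalProjectionOnto x)

/-- `∂U` is locally the graph of a `C^∞` function, with `U` on one side of it. -/
def HasSmoothBoundary (U : Set (Euc N)) : Prop :=
  ∀ x₀ ∈ frontier U, ∃ e : Euc N, ‖e‖ = 1 ∧
    ∃ γ : (Submodule.span ℝ {e})ᗮ → ℝ, ContDiff ℝ ∞ γ ∧ IsSubgraphNear U x₀ e γ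

/-- `∂U` is locally the graph of a Lipschitz function, with `U` on one side of it. -/
def HasLipschitzBoundary (U : Set (Euc N)) : Prop :=
  ∀ x₀ ∈ frontier U, ∃ e : Euc N, ‖e‖ = 1 ∧
    ∃ γ : (Submodule.span ℝ {e})ᗮ → ℝ, (∃ K, LipschitzWith K γ) ∧ IsSubgraphNear U x₀ e γ

/-! ### Weak gradients -/

/-- `G` is a weak gradient of `u` in the open set `U`:
`∫_U u ∂_w φ = - ∫_U ⟨G, w⟩ φ` for all test functions `φ ∈ C_c^∞(U)` and all directions `w`. -/
def HasWeakGradient (U : Set (Euc N)) (u : Euc N → ℝ) (G : Euc N → Euc N) : Prop :=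
  LocallyIntegrableOn u U ∧ LocallyIntegrableOn G U ∧
    ∀ φ : Euc N → ℝ, ContDiff ℝ ∞ φ → HasCompactSupport φ → tsupport φ ⊆ U → ∀ w : Euc N,
      ∫ x in U, u x * fderiv ℝ φ x w = - ∫ x in U, inner ℝ (G x) w * φ x

open Classical in
/-- The weak gradient `∇u` of `u` in `U` (it is unique up to a null set, see
`HasWeakGradient.ae_eq`); zero if there is none. -/
def weakGrad (U : Set (Euc N)) (u : Euc N → ℝ) : Euc N → Euc N :=
  if h : ∃ G, HasWeakGradient U u G then h.choose else 0

theorem HasWeakGradient.ae_eq {U : Set (Euc N)} (hU : IsOpen U) {u : Euc N → ℝ}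
    {G H : Euc N → Euc N} (hG : HasWeakGradient U u G) (hH : HasWeakGradient U u H) :
    G =ᵐ[volume.restrict U] H := by
  have key : ∀ᵐ x, x ∈ U → G x - H x = 0 := by
    refine hU.ae_eq_zero_of_integral_contDiff_smul_eq_zero (hG.2.1.sub hH.2.1) ?_
    intro φ hφ hc hs
    have hint : ∀ {F : Euc N → Euc N}, LocallyIntegrableOn F U →
        Integrable (fun x => φ x • F x) := by
      intro F hF
      rw [← integrableOn_iff_integrable_of_support_subset (s := tsupport φ)]
      · exact ((hF.integrableOn_compact_subset hs hc).continuousOn_smul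
          hφ.continuous.continuousOn hc)
      · exact (Function.support_smul_subset_left _ _).trans (subset_tsupport φ)
    have hset : ∀ {F : Euc N → Euc N} (w : Euc N),
        ∫ x in U, inner ℝ (F x) w * φ x = ∫ x, inner ℝ w (φ x • F x) := by
      intro F w
      rw [setIntegral_eq_integral_of_forall_compl_eq_zero]
      · refine integral_congr_ae (Eventually.of_forall fun x => ?_)
        simp [inner_smul_right, real_inner_comm, mul_comm]
      · intro x hx
        simp [image_eq_zero_of_notMem_tsupport fun h => hx (hs h)]
    have h1 := hint hG.2.1
    have h2 := hint hH.2.1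
    have e : ∫ x, φ x • G x = ∫ x, φ x • H x := by
      refine ext_inner_left ℝ fun w => ?_
      rw [← integral_inner h1, ← integral_inner h2, ← hset, ← hset, ← neg_inj,
        ← hG.2.2 φ hφ hc hs w, ← hH.2.2 φ hφ hc hs w]
    simp only [smul_sub]
    rw [integral_sub h1 h2, e, sub_self]
  rw [EventuallyEq, ae_restrict_iff' hU.measurableSet]
  filter_upwards [key] with x hx hxU using sub_eq_zero.1 (hx hxU)

theorem weakGrad_spec {U : Set (Euc N)} {u : Euc N → ℝ} (h : ∃ G, HasWeakGradient U u G) :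
    HasWeakGradient U u (weakGrad U u) := by
  rw [weakGrad, dif_pos h]
  exact h.choose_spec

/-! ### Variable exponent spaces -/

/-- `f ∈ L^{q(·)}(U)`: `f` is measurable and `∫_U |λ f(x)|^{q(x)} dx < ∞` for some `λ > 0`
(finite exponents `q`). -/
def MemVarLp {F : Type*} [NormedAddCommGroup F] (U : Set (Euc N)) (q : Euc N → ℝ)
    (f : Euc N → F) : Prop :=
  AEStronglyMeasurable f (volume.restrict U) ∧
    ∃ c : ℝ, 0 < c ∧ ∫⁻ x in U, ENNReal.ofReal ((c * ‖f x‖) ^ q x) < ⊤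

/-- `u ∈ W^{1,q(·)}(U)`: both `u` and its weak gradient belong to `L^{q(·)}(U)`. -/
def MemVarSobolev (U : Set (Euc N)) (q : Euc N → ℝ) (u : Euc N → ℝ) : Prop :=
  (∃ G, HasWeakGradient U u G) ∧ MemVarLp U q u ∧ MemVarLp U q (weakGrad U u)

/-- The boundary values of a function `u` on `U`:
`(tr u)(x) = lim_{r → 0} ⨍_{B(x,r) ∩ U} u`. It depends only on the almost everywhere class of `u`
in `U`, and equals the boundary values of `u` whenever `u` is continuous up to the boundary. -/
def boundaryTrace (U : Set (Euc N)) (u : Euc N → ℝ) (x : Euc N) : ℝ :=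
  limUnder (𝓝[>] (0 : ℝ)) fun r => ⨍ y in Metric.ball x r ∩ U, u y

/-! ### The exponents and the variational problems -/

/-- `p⁺`, the supremum of `p` over `Ω̄ ∖ D̄`. -/
def pPlus (Ω D : Set (Euc N)) (p : Euc N → ℝ≥0∞) : ℝ≥0∞ :=
  ⨆ x ∈ closure Ω \ closure D, p x

/-- `p₋`, the infimum of `p` over `Ω̄`. -/
def pMinus (Ω : Set (Euc N)) (p : Euc N → ℝ≥0∞) : ℝ≥0∞ :=
  ⨅ x ∈ closure Ω, p x

/-- The truncated exponent `p_k = min {p, k}`. -/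
def pTrunc (p : Euc N → ℝ≥0∞) (k : ℕ) (x : Euc N) : ℝ :=
  (min (p x) (k : ℝ≥0∞)).toReal

/-- `∫_{∂Ω} g v dS`, where `dS` is the `(N-1)`-dimensional Hausdorff measure, normalized to be the
surface measure. -/
def boundaryTerm (Ω : Set (Euc N)) (g v : Euc N → ℝ) : ℝ :=
  ∫ x in frontier Ω, g x * boundaryTrace Ω v x ∂μHE[N - 1]

/-- `S_k`, the functions in `W^{1,p_k(·)}(Ω)` of mean zero. -/
def admissible (Ω : Set (Euc N)) (p : Euc N → ℝ≥0∞) (k : ℕ) : Set (Euc N → ℝ) :=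
  {u | MemVarSobolev Ω (pTrunc p k) u ∧ ∫ x in Ω, u x = 0}

/-- `I_k(v) = ∫_Ω |∇v|^{p_k(x)} / p_k(x) dx - ∫_{∂Ω} g v dS`. -/
def energy (Ω : Set (Euc N)) (p : Euc N → ℝ≥0∞) (g : Euc N → ℝ) (k : ℕ) (v : Euc N → ℝ) : ℝ :=
  (∫ x in Ω, ‖weakGrad Ω v x‖ ^ pTrunc p k x / pTrunc p k x) - boundaryTerm Ω g v

/-- `S`, the mean-zero functions in `W^{1,p₋}(Ω)` whose restriction to `Ω ∖ D̄` is in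
`W^{1,p(·)}(Ω ∖ D̄)` and whose gradient satisfies `‖∇u‖_{L^∞(D)} ≤ 1`. -/
def limitAdmissible (Ω D : Set (Euc N)) (p : Euc N → ℝ≥0∞) : Set (Euc N → ℝ) :=
  {u | MemVarSobolev Ω (fun _ => (pMinus Ω p).toReal) u ∧
    MemVarSobolev (Ω \ closure D) (fun x => (p x).toReal) u ∧
    eLpNorm (weakGrad Ω u) ⊤ (volume.restrict D) ≤ 1 ∧
    ∫ x in Ω, u x = 0}

/-- `I_∞(v) = ∫_{Ω ∖ D̄} |∇v|^{p(x)} / p(x) dx - ∫_{∂Ω} g v dS`. -/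
def limitEnergy (Ω D : Set (Euc N)) (p : Euc N → ℝ≥0∞) (g : Euc N → ℝ) (v : Euc N → ℝ) : ℝ :=
  (∫ x in Ω \ closure D, ‖weakGrad Ω v x‖ ^ (p x).toReal / (p x).toReal) - boundaryTerm Ω g v

/-- `u` minimizes the functional `I` over the set `A`. -/
def IsMinimizer (I : (Euc N → ℝ) → ℝ) (A : Set (Euc N → ℝ)) (u : Euc N → ℝ) : Prop :=
  u ∈ A ∧ ∀ v ∈ A, I u ≤ I v

/-! ### Infinity harmonic functions -/

/-- The partial derivative `∂φ/∂x_i`. -/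
def pderiv (i : Fin N) (φ : Euc N → ℝ) (x : Euc N) : ℝ :=
  fderiv ℝ φ x (EuclideanSpace.single i 1)

/-- `Δ_∞ φ = ∑_{i,j} ∂φ/∂x_i ∂φ/∂x_j ∂²φ/∂x_i∂x_j`. -/
def infLaplacian (φ : Euc N → ℝ) (x : Euc N) : ℝ :=
  ∑ i, ∑ j, pderiv i φ x * pderiv j φ x * pderiv i (pderiv j φ) x

/-- `u` is infinity harmonic in the open set `D`: a continuous viscosity solution of
`Δ_∞ u = 0`, i.e. a supersolution and a subsolution of `-Δ_∞ u = 0`. -/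
def IsInfinityHarmonic (D : Set (Euc N)) (u : Euc N → ℝ) : Prop :=
  ContinuousOn u D ∧
    ∀ φ : Euc N → ℝ, ContDiffOn ℝ 2 φ D → ∀ x₀ ∈ D,
      (IsLocalMin (fun x => u x - φ x) x₀ → - infLaplacian φ x₀ ≥ 0) ∧
      (IsLocalMax (fun x => u x - φ x) x₀ → - infLaplacian φ x₀ ≤ 0)

end

/-!
Since `p₋ > N`, Morrey's inequality makes every admissible function Hölder continuous up to `∂Ω`,
with constants controlled by the `L^{p₋}` norm of its gradient. This is `exists_morrey_embedding`:
near a point, `Ω` contains a fixed ball from which nearby points of `Ω` are visible, so the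
oscillation is bounded by an integral of `|∇u|` over the segments (the "star hull"), and finitely
many such balls, chained by connectedness, give a global bound. Together with `∫ u = 0` this bounds
`u` by its gradient. The boundary integral then only sees the continuous representative
(`boundaryTerm_eq`) and is continuous under uniform convergence, because the surface measure of a
locally Lipschitz boundary is finite.

Minimizers of `I_k`: the functional is coercive (`exists_coercive`), a minimizing sequence has a
uniformly convergent subsequence by Arzelà–Ascoli, and convex integrals of the gradient are lower
semicontinuous along it (`exists_uniform_limit`), because by the parallelogram law suitable convex
combinations of the gradients converge strongly in `L²`. Strict convexity of `|·|^{p_k}` shows that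
two minimizers have the same gradient, hence agree.

The limit `k → ∞`: coercivity is uniform in `k` and `I_k(u_k) ≤ I_k(0) = 0`, so the same compactness
applies to the minimizers. The bound on `∫_D |∇u_k|^k / k` bounds each `∫_D |∇u_k|^m` by a linear
function of `m`, so the limit satisfies `|∇u_∞| ≤ 1` in `D` (`ae_le_one_of_lintegral_pow_le`). A
competitor `v ∈ S` also competes for `I_k`, where it pays at most `|D| / k` in `D`; passing to the
limit gives minimality of `u_∞`.

Infinity harmonicity: let a test function touch `u_∞` from below at `x₀ ∈ D` with `Δ_∞ φ(x₀) > 0`.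
It may be taken to be a polynomial `Q` touching strictly (`exists_smooth_touching`). For large `k`
the field `|∇Q|^{k-2} ∇Q` has positive divergence near `x₀` (`sum_fderiv_gradFlux`). Let
`η = f(Q + c - u_k)`, where `f` is a smooth version of the positive part with `0 ≤ f' ≤ 1`; it is
supported near `x₀`. Comparing `u_k` with `u_k + η`, whose gradient is a convex combination of
`∇u_k` and `∇Q`, yields `∫ |∇Q|^{k-2} ⟨∇Q, ∇η⟩ ≥ 0`. But integration by parts makes this integral
negative.
-/

open scoped Convolution

noncomputable section

variable {N : ℕ}

/-! ### Two facts from integration theory -/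

theorem lintegral_le_rpow_mul_measure {α : Type*} [MeasurableSpace α] (μ : Measure α) {q : ℝ}
    (hq : 1 ≤ q) {f : α → ℝ≥0∞} (hf : AEMeasurable f μ) :
    ∫⁻ x, f x ∂μ ≤ (∫⁻ x, f x ^ q ∂μ) ^ (1 / q) * μ univ ^ (1 - 1 / q) := by
  have := eLpNorm'_le_eLpNorm'_mul_rpow_measure_univ (μ := μ) (f := f) one_pos hq
    hf.aestronglyMeasurable
  simpa [eLpNorm', enorm_eq_self] using this

/-- If `f n → f` almost everywhere and `‖f n‖₁ ≤ ‖f‖₁`, then `f n → f` in `L¹`: apply Fatou's lemma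
to `‖f n‖ + ‖f‖ - ‖f n - f‖ ≥ 0`. -/
theorem tendsto_integral_norm_sub_of_ae {α F : Type*} [MeasurableSpace α] {μ : Measure α}
    [NormedAddCommGroup F] {f : ℕ → α → F} {g : α → F}
    (hf : ∀ n, Integrable (f n) μ) (hg : Integrable g μ)
    (hae : ∀ᵐ x ∂μ, Tendsto (fun n => f n x) atTop (𝓝 (g x)))
    (hle : ∀ n, ∫ x, ‖f n x‖ ∂μ ≤ ∫ x, ‖g x‖ ∂μ) :
    Tendsto (fun n => ∫ x, ‖f n x - g x‖ ∂μ) atTop (𝓝 0) := by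
  set h : ℕ → α → ℝ := fun n x => ‖f n x‖ + ‖g x‖ - ‖f n x - g x‖ with hh
  have hint : ∀ n, Integrable (h n) μ := fun n =>
    ((hf n).norm.add hg.norm).sub ((hf n).sub hg).norm
  have hnn : ∀ n x, 0 ≤ h n x := fun n x => by
    have := norm_sub_le (f n x) (g x)
    simp only [hh]; linarith
  have hfatou := lintegral_liminf_le' (μ := μ) (u := atTop)
    (f := fun n x => ENNReal.ofReal (h n x)) (fun n => (hint n).1.aemeasurable.ennreal_ofReal)
  have hlim : ∀ᵐ x ∂μ, liminf (fun n => ENNReal.ofReal (h n x)) atTop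
      = ENNReal.ofReal (2 * ‖g x‖) := by
    filter_upwards [hae] with x hx
    refine Tendsto.liminf_eq (ENNReal.tendsto_ofReal ?_)
    have h2 := (hx.norm.add (tendsto_const_nhds (x := ‖g x‖))).sub
      (hx.sub (tendsto_const_nhds (x := g x))).norm
    simpa [hh, two_mul] using h2
  rw [lintegral_congr_ae hlim, ← ofReal_integral_eq_lintegral_ofReal (hg.norm.const_mul 2)
    (Eventually.of_forall fun x => by positivity)] at hfatou
  have hval : ∀ n, ∫⁻ x, ENNReal.ofReal (h n x) ∂μ = ENNReal.ofReal (∫ x, h n x ∂μ) := fun n =>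
    (ofReal_integral_eq_lintegral_ofReal (hint n) (Eventually.of_forall (hnn n))).symm
  simp only [hval, integral_const_mul] at hfatou
  rw [Metric.tendsto_atTop]
  intro ε hε
  by_cases hz : ∫ x, ‖g x‖ ∂μ = 0
  · refine ⟨0, fun n _ => ?_⟩
    have h0 : ∀ᵐ x ∂μ, ‖g x‖ = 0 :=
      (integral_eq_zero_iff_of_nonneg (fun x => norm_nonneg _) hg.norm).1 hz
    have : ∫ x, ‖f n x - g x‖ ∂μ = ∫ x, ‖f n x‖ ∂μ := by
      refine integral_congr_ae ?_
      filter_upwards [h0] with x hx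
      rw [norm_eq_zero.1 hx, sub_zero]
    have h3 := hle n
    have h4 : 0 ≤ ∫ x, ‖f n x‖ ∂μ := integral_nonneg fun x => norm_nonneg _
    rw [Real.dist_eq, this, sub_zero, abs_of_nonneg h4]
    linarith
  have hpos : 0 < ∫ x, ‖g x‖ ∂μ :=
    lt_of_le_of_ne (integral_nonneg fun x => norm_nonneg _) (Ne.symm hz)
  have hlt : ENNReal.ofReal (2 * ∫ x, ‖g x‖ ∂μ - ε)
      < liminf (fun n => ENNReal.ofReal (∫ x, h n x ∂μ)) atTop := by
    refine lt_of_lt_of_le ?_ hfatou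
    rw [ENNReal.ofReal_lt_ofReal_iff (by linarith)]
    linarith
  have hev := eventually_lt_of_lt_liminf hlt
  obtain ⟨n₀, hn₀⟩ := eventually_atTop.1 hev
  refine ⟨n₀, fun n hn => ?_⟩
  have h5 : 2 * ∫ x, ‖g x‖ ∂μ - ε < ∫ x, h n x ∂μ :=
    lt_of_not_ge fun h => (hn₀ n hn).not_ge (ENNReal.ofReal_le_ofReal h)
  have h6 : ∫ x, h n x ∂μ = ∫ x, ‖f n x‖ ∂μ + ∫ x, ‖g x‖ ∂μ - ∫ x, ‖f n x - g x‖ ∂μ := by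
    simp only [hh]
    have e1 := integral_sub ((hf n).norm.add hg.norm) ((hf n).sub hg).norm
    have e2 := integral_add (hf n).norm hg.norm
    simp only [Pi.add_apply, Pi.sub_apply] at e1 e2
    rw [e1, e2]
  have h7 : 0 ≤ ∫ x, ‖f n x - g x‖ ∂μ := integral_nonneg fun x => norm_nonneg _
  rw [Real.dist_eq, sub_zero, abs_of_nonneg h7]
  have := hle n
  linarith

/-! ### Mollification -/

/-- Bump functions supported in the balls `B(0, 1 / (n + 1))`. -/
def mollBump (N n : ℕ) : ContDiffBump (0 : Euc N) where
  rIn := 1 / (2 * (n + 1))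
  rOut := 1 / (n + 1)
  rIn_pos := by positivity
  rIn_lt_rOut := by
    apply one_div_lt_one_div_of_lt <;> linarith [n.cast_nonneg (α := ℝ)]

/-- The standard mollification of `f` at scale `1 / (n + 1)`. -/
def mollify {F : Type*} [NormedAddCommGroup F] [NormedSpace ℝ F] (n : ℕ) (f : Euc N → F) :
    Euc N → F :=
  (mollBump N n).normed volume ⋆[ContinuousLinearMap.lsmul ℝ ℝ, volume] f

section Mollify

variable {F : Type*} [NormedAddCommGroup F] [NormedSpace ℝ F]

theorem mollify_apply (n : ℕ) (f : Euc N → F) (x : Euc N) :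
    mollify n f x = ∫ t, (mollBump N n).normed volume t • f (x - t) := rfl

theorem mollify_apply' (n : ℕ) (f : Euc N → F) (x : Euc N) :
    mollify n f x = ∫ t, (mollBump N n).normed volume (x - t) • f t := by
  rw [mollify, convolution_eq_swap]
  rfl

theorem mollify_congr {n : ℕ} {f g : Euc N → F} (h : f =ᵐ[volume] g) :
    mollify n f = mollify n g := by
  ext x
  rw [mollify_apply', mollify_apply']
  refine integral_congr_ae ?_
  filter_upwards [h] with t ht
  rw [ht]

theorem contDiff_mollify (n : ℕ) {f : Euc N → F} (hf : LocallyIntegrable f) :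
    ContDiff ℝ ∞ (mollify n f) :=
  (mollBump N n).hasCompactSupport_normed.contDiff_convolution_left
    (ContinuousLinearMap.lsmul ℝ ℝ) (mollBump N n).contDiff_normed hf

theorem tendsto_mollBump_rOut : Tendsto (fun n => (mollBump N n).rOut) atTop (𝓝 0) :=
  tendsto_one_div_add_atTop_nhds_zero_nat

theorem ae_tendsto_mollify [CompleteSpace F] {f : Euc N → F} (hf : LocallyIntegrable f) :
    ∀ᵐ x, Tendsto (fun n => mollify n f x) atTop (𝓝 (f x)) := by
  refine ContDiffBump.ae_convolution_tendsto_right_of_locallyIntegrable (K := 2)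
    tendsto_mollBump_rOut (Eventually.of_forall fun n => ?_) hf
  simp only [mollBump]
  apply le_of_eq
  field_simp

/-- Mollification does not increase `L^q` norms (Jensen's inequality and Tonelli's theorem). -/
theorem lintegral_mollify_rpow_le (n : ℕ) {q : ℝ} (hq : 1 ≤ q) {f : Euc N → F}
    (hf : AEStronglyMeasurable f) :
    ∫⁻ x, ‖mollify n f x‖ₑ ^ q ≤ ∫⁻ x, ‖f x‖ₑ ^ q := by
  wlog hsm : StronglyMeasurable f generalizing f
  · have := this hf.stronglyMeasurable_mk.aestronglyMeasurable hf.stronglyMeasurable_mk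
    rw [mollify_congr hf.ae_eq_mk]
    refine this.trans_eq (lintegral_congr_ae ?_)
    filter_upwards [hf.ae_eq_mk] with x hx
    rw [hx]
  set ρ := (mollBump N n).normed volume with hρ
  have hρm : Measurable fun t => ‖ρ t‖ₑ := (mollBump N n).continuous_normed.measurable.enorm
  set ν : Measure (Euc N) := volume.withDensity fun t => ‖ρ t‖ₑ with hν
  have hν1 : ν univ = 1 := by
    rw [hν, withDensity_apply _ MeasurableSet.univ, Measure.restrict_univ]
    have h1 : ∀ t, ‖ρ t‖ₑ = ENNReal.ofReal (ρ t) := fun t =>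
      Real.enorm_of_nonneg ((mollBump N n).nonneg_normed t)
    simp_rw [h1]
    rw [← ofReal_integral_eq_lintegral_ofReal (mollBump N n).integrable_normed
      (Eventually.of_forall (mollBump N n).nonneg_normed), (mollBump N n).integral_normed,
      ENNReal.ofReal_one]
  have : IsProbabilityMeasure ν := ⟨hν1⟩
  have hm2 : Measurable fun z : Euc N × Euc N => ‖f (z.1 - z.2)‖ₑ :=
    hsm.enorm.comp (measurable_fst.sub measurable_snd)
  have hpt : ∀ x, ‖mollify n f x‖ₑ ^ q ≤ ∫⁻ t, ‖f (x - t)‖ₑ ^ q ∂ν := by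
    intro x
    have hmx : Measurable fun t => ‖f (x - t)‖ₑ := hm2.comp (measurable_const.prodMk measurable_id)
    have h1 : ‖mollify n f x‖ₑ ≤ ∫⁻ t, ‖f (x - t)‖ₑ ∂ν := by
      rw [mollify_apply]
      refine (enorm_integral_le_lintegral_enorm _).trans_eq ?_
      rw [hν, lintegral_withDensity_eq_lintegral_mul _ hρm hmx]
      simp [enorm_smul, hρ]
    have h2 := lintegral_le_rpow_mul_measure ν hq hmx.aemeasurable
    rw [hν1, ENNReal.one_rpow, mul_one] at h2
    calc ‖mollify n f x‖ₑ ^ q ≤ ((∫⁻ t, ‖f (x - t)‖ₑ ^ q ∂ν) ^ (1 / q)) ^ q :=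
          ENNReal.rpow_le_rpow (h1.trans h2) (by linarith)
      _ = _ := by
          rw [← ENNReal.rpow_mul, one_div, inv_mul_cancel₀ (by linarith), ENNReal.rpow_one]
  calc ∫⁻ x, ‖mollify n f x‖ₑ ^ q ≤ ∫⁻ x, (∫⁻ t, ‖f (x - t)‖ₑ ^ q ∂ν) := lintegral_mono hpt
    _ = ∫⁻ t, (∫⁻ x, ‖f (x - t)‖ₑ ^ q) ∂ν := lintegral_lintegral_swap (hm2.pow_const q).aemeasurable
    _ = ∫⁻ _, (∫⁻ x, ‖f x‖ₑ ^ q) ∂ν := by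
        refine lintegral_congr fun t => ?_
        exact lintegral_sub_right_eq_self (fun x => ‖f x‖ₑ ^ q) t
    _ = ∫⁻ x, ‖f x‖ₑ ^ q := by simp

theorem lintegral_mollify_le (n : ℕ) {f : Euc N → F} (hf : AEStronglyMeasurable f) :
    ∫⁻ x, ‖mollify n f x‖ₑ ≤ ∫⁻ x, ‖f x‖ₑ := by
  simpa using lintegral_mollify_rpow_le n le_rfl hf

theorem integrable_mollify (n : ℕ) {f : Euc N → F} (hf : Integrable f) :
    Integrable (mollify n f) :=
  ⟨(contDiff_mollify n hf.locallyIntegrable).continuous.aestronglyMeasurable,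
    (lintegral_mollify_le n hf.1).trans_lt hf.2⟩

theorem tendsto_integral_norm_mollify_sub [CompleteSpace F] {f : Euc N → F} (hf : Integrable f) :
    Tendsto (fun n => ∫ x, ‖mollify n f x - f x‖) atTop (𝓝 0) := by
  refine tendsto_integral_norm_sub_of_ae (fun n => integrable_mollify n hf) hf
    (ae_tendsto_mollify hf.locallyIntegrable) fun n => ?_
  rw [integral_norm_eq_lintegral_enorm (integrable_mollify n hf).1,
    integral_norm_eq_lintegral_enorm hf.1]
  exact ENNReal.toReal_mono hf.2.ne (lintegral_mollify_le n hf.1)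

end Mollify

/-- Away from the boundary of `U`, the gradient of the mollification is the mollification of the
weak gradient. -/
theorem HasWeakGradient.fderiv_mollify {U : Set (Euc N)} (hU : MeasurableSet U) {u : Euc N → ℝ}
    {G : Euc N → Euc N} (h : HasWeakGradient U u G) (hu : IntegrableOn u U)
    (hG : IntegrableOn G U) {n : ℕ} {x : Euc N}
    (hx : Metric.closedBall x (1 / (n + 1)) ⊆ U) (w : Euc N) :
    fderiv ℝ (mollify n (U.indicator u)) x w = inner ℝ (mollify n (U.indicator G) x) w := by
  set ρ := (mollBump N n).normed volume with hρ
  have hui : Integrable (U.indicator u) := hu.integrable_indicator hU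
  have hGi : Integrable (U.indicator G) := hG.integrable_indicator hU
  have hρc : ContDiff ℝ ∞ ρ := (mollBump N n).contDiff_normed
  have hρs : HasCompactSupport ρ := (mollBump N n).hasCompactSupport_normed
  have hder := hρs.hasFDerivAt_convolution_left (ContinuousLinearMap.lsmul ℝ ℝ) (μ := volume)
    (hρc.of_le (by simp)) hui.locallyIntegrable x
  have h1 : fderiv ℝ (mollify n (U.indicator u)) x w
      = ∫ t, fderiv ℝ ρ (x - t) w * U.indicator u t := by
    rw [mollify, hder.fderiv, convolution_eq_swap]
    rw [ContinuousLinearMap.integral_apply]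
    · rfl
    · have hc : Continuous (fderiv ℝ ρ) := hρc.continuous_fderiv (by simp)
      have hs : HasCompactSupport (fderiv ℝ ρ) := hρs.fderiv ℝ
      have := (hs.convolutionExists_left
        (ContinuousLinearMap.precompL (Euc N) (ContinuousLinearMap.lsmul ℝ ℝ (E := ℝ))) hc
        hui.locallyIntegrable x).integrable_swap
      exact this
  set φ : Euc N → ℝ := fun t => ρ (x - t) with hφ
  have hφc : ContDiff ℝ ∞ φ := hρc.comp (contDiff_const.sub contDiff_id)
  have hφt : tsupport φ ⊆ Metric.closedBall x (1 / (n + 1)) := by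
    refine closure_minimal ?_ Metric.isClosed_closedBall
    intro t ht
    have : x - t ∈ Function.support ρ := ht
    rw [(mollBump N n).support_normed_eq] at this
    rw [Metric.mem_closedBall, dist_comm, dist_eq_norm]
    rw [mem_ball_zero_iff] at this
    exact this.le
  have hφs : HasCompactSupport φ :=
    (isCompact_closedBall x _).of_isClosed_subset (isClosed_tsupport _) hφt
  have hdφ : ∀ t, fderiv ℝ φ t w = - fderiv ℝ ρ (x - t) w := by
    intro t
    have h2 : HasFDerivAt ρ (fderiv ℝ ρ (x - t)) (x - t) :=
      (hρc.differentiable (by simp) _).hasFDerivAt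
    have h3 : HasFDerivAt (fun t : Euc N => x - t) (-ContinuousLinearMap.id ℝ (Euc N)) t :=
      (hasFDerivAt_id t).const_sub x
    have h4 : HasFDerivAt φ _ t := h2.comp t h3
    rw [h4.fderiv]
    simp
  have hw := h.2.2 φ hφc hφs (hφt.trans hx) w
  rw [h1]
  have h4 : ∫ t, fderiv ℝ ρ (x - t) w * U.indicator u t
      = - ∫ t in U, u t * fderiv ℝ φ t w := by
    rw [← integral_indicator hU, ← integral_neg]
    refine integral_congr_ae (Eventually.of_forall fun t => ?_)
    by_cases ht : t ∈ U
    · simp [ht, hdφ, mul_comm]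
    · simp [ht]
  rw [h4, hw, neg_neg, mollify_apply', real_inner_comm, ← integral_inner,
    ← integral_indicator hU]
  · refine integral_congr_ae (Eventually.of_forall fun t => ?_)
    by_cases ht : t ∈ U
    · simp [ht, hφ, hρ, inner_smul_right, real_inner_comm, mul_comm]
    · simp [ht]
  · exact ((mollBump N n).hasCompactSupport_normed.convolutionExists_left
      (ContinuousLinearMap.lsmul ℝ ℝ) (mollBump N n).continuous_normed
      hGi.locallyIntegrable x).integrable_swap

/-! ### Morrey's inequality on star-shaped hulls of balls -/

theorem lintegral_comp_add_smul_sub (h : Euc N → ℝ≥0∞) (hh : Measurable h) (x : Euc N) {t : ℝ}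
    (ht : 0 < t) :
    ∫⁻ y, h (x + t • (y - x)) = ENNReal.ofReal (t ^ (-(N : ℝ))) * ∫⁻ y, h y := by
  have h1 : ∫⁻ y, h (x + t • (y - x)) = ∫⁻ y, h (x + t • y) :=
    lintegral_sub_right_eq_self (fun y => h (x + t • y)) x
  have h2 : ∫⁻ y, h (x + t • y) = ∫⁻ y, h (x + y) ∂(Measure.map (fun y => t • y) volume) := by
    rw [lintegral_map (f := fun y => h (x + y)) (hh.comp (measurable_const_add x))
      (measurable_const_smul t)]
  rw [h1, h2, Measure.map_addHaar_smul _ ht.ne', lintegral_smul_measure,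
    lintegral_add_left_eq_self (fun y => h y) x, smul_eq_mul]
  congr 2
  rw [finrank_euclideanSpace, Fintype.card_fin, abs_of_pos (by positivity),
    Real.rpow_neg ht.le, Real.rpow_natCast]

theorem lintegral_rpow_neg_Ioc {a : ℝ} (ha : a < 1) :
    ∫⁻ t in Ioc (0 : ℝ) 1, ENNReal.ofReal (t ^ (-a)) = ENNReal.ofReal (1 / (1 - a)) := by
  have h1 : IntervalIntegrable (fun t : ℝ => t ^ (-a)) volume 0 1 :=
    intervalIntegral.intervalIntegrable_rpow' (by linarith)
  rw [← ofReal_integral_eq_lintegral_ofReal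
    ((intervalIntegrable_iff_integrableOn_Ioc_of_le zero_le_one).1 h1)]
  · rw [← intervalIntegral.integral_of_le zero_le_one, integral_rpow (Or.inl (by linarith))]
    congr 1
    rw [Real.one_rpow, Real.zero_rpow (by linarith)]
    ring
  · refine (ae_restrict_iff' measurableSet_Ioc).2 (Eventually.of_forall fun t ht => ?_)
    exact Real.rpow_nonneg ht.1.le _

theorem enorm_sub_le_lintegral_fderiv {v : Euc N → ℝ} (hv : ContDiff ℝ 1 v) (x y : Euc N) :
    ‖v y - v x‖ₑ ≤ ∫⁻ t in Ioc (0 : ℝ) 1, ‖fderiv ℝ v (x + t • (y - x))‖ₑ * ‖y - x‖ₑ := by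
  have hd : ∀ t : ℝ, HasDerivAt (fun t : ℝ => v (x + t • (y - x)))
      (fderiv ℝ v (x + t • (y - x)) (y - x)) t := by
    intro t
    have h1 : HasDerivAt (fun t : ℝ => x + t • (y - x)) (y - x) t := by
      simpa using ((hasDerivAt_id t).smul_const (y - x)).const_add x
    exact ((hv.differentiable (by simp) _).hasFDerivAt).comp_hasDerivAt t h1
  have hc : Continuous fun t : ℝ => fderiv ℝ v (x + t • (y - x)) (y - x) :=
    ((hv.continuous_fderiv (by simp)).comp (by fun_prop)).clm_apply continuous_const
  have h2 := intervalIntegral.integral_eq_sub_of_hasDerivAt (a := 0) (b := 1)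
    (fun t _ => hd t) (hc.intervalIntegrable _ _)
  have h3 : v y - v x = ∫ t in Ioc (0 : ℝ) 1, fderiv ℝ v (x + t • (y - x)) (y - x) := by
    rw [← intervalIntegral.integral_of_le zero_le_one, h2]
    simp
  rw [h3]
  refine (enorm_integral_le_lintegral_enorm _).trans (lintegral_mono fun t => ?_)
  exact ContinuousLinearMap.le_opENorm _ _

/-- The oscillation of a `C¹` function `v` between a point `x` and the ball `B(z, r)`, if `h` bounds
the gradient along all segments from `x` to the ball. For fixed `t ∈ (0, 1]` the substitution
`y ↦ x + t (y - x)` and Hölder's inequality bound the integral over the ball by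
`t ^ (-N / q) ‖h‖_q`, which is integrable in `t` as `q > N`. -/
theorem lintegral_enorm_sub_le_of_segments (hN : 1 ≤ N) {q : ℝ} (hq : N < q) {v : Euc N → ℝ}
    (hv : ContDiff ℝ 1 v) {h : Euc N → ℝ≥0∞} (hh : Measurable h) {x z : Euc N} {r R : ℝ}
    (hR : ∀ y ∈ Metric.ball z r, ‖y - x‖ ≤ R)
    (hb : ∀ y ∈ Metric.ball z r, ∀ t ∈ Icc (0 : ℝ) 1,
      ‖fderiv ℝ v (x + t • (y - x))‖ₑ ≤ h (x + t • (y - x))) :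
    ∫⁻ y in Metric.ball z r, ‖v y - v x‖ₑ ≤
      ENNReal.ofReal R * ENNReal.ofReal (1 / (1 - N / q)) * (∫⁻ y, h y ^ q) ^ (1 / q) *
        volume (Metric.ball z r) ^ (1 - 1 / q) := by
  have hN' : (1 : ℝ) ≤ N := by exact_mod_cast hN
  have hq0 : 0 < q := by linarith
  have hNq : (N : ℝ) / q < 1 := (div_lt_one hq0).2 hq
  set B := Metric.ball z r
  set V := volume B
  set H := ∫⁻ y, h y ^ q
  have hmeas : Measurable fun w : Euc N × ℝ => h (x + w.2 • (w.1 - x)) :=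
    hh.comp (by fun_prop)
  have hinner : ∀ t ∈ Ioc (0 : ℝ) 1, ∫⁻ y in B, h (x + t • (y - x)) ≤
      ENNReal.ofReal (t ^ (-(N / q))) * (H ^ (1 / q) * V ^ (1 - 1 / q)) := by
    intro t ht
    have hmt : Measurable fun y => h (x + t • (y - x)) := hh.comp (by fun_prop)
    refine (lintegral_le_rpow_mul_measure (volume.restrict B) (q := q) (by linarith)
      hmt.aemeasurable).trans ?_
    rw [Measure.restrict_apply_univ, ← mul_assoc]
    gcongr
    calc (∫⁻ y in B, h (x + t • (y - x)) ^ q) ^ (1 / q)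
        ≤ (∫⁻ y, h (x + t • (y - x)) ^ q) ^ (1 / q) := by
          gcongr
          exact Measure.restrict_le_self
      _ = (ENNReal.ofReal (t ^ (-(N : ℝ))) * H) ^ (1 / q) := by
          rw [lintegral_comp_add_smul_sub (fun y => h y ^ q) (hh.pow_const q) x ht.1]
      _ = ENNReal.ofReal (t ^ (-(N / q))) * H ^ (1 / q) := by
          rw [ENNReal.mul_rpow_of_nonneg _ _ (by positivity),
            ENNReal.ofReal_rpow_of_nonneg (Real.rpow_nonneg ht.1.le _) (by positivity),
            ← Real.rpow_mul ht.1.le]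
          congr 3
          ring
  calc ∫⁻ y in B, ‖v y - v x‖ₑ
      ≤ ∫⁻ y in B, (∫⁻ t in Ioc (0 : ℝ) 1, h (x + t • (y - x)) * ENNReal.ofReal R) := by
        refine setLIntegral_mono' Metric.isOpen_ball.measurableSet fun y hy => ?_
        refine (enorm_sub_le_lintegral_fderiv hv x y).trans ?_
        refine setLIntegral_mono' measurableSet_Ioc fun t ht => ?_
        gcongr
        · exact hb y hy t ⟨ht.1.le, ht.2⟩
        · rw [← ofReal_norm]
          exact ENNReal.ofReal_le_ofReal (hR y hy)
    _ = ∫⁻ t in Ioc (0 : ℝ) 1, (∫⁻ y in B, h (x + t • (y - x)) * ENNReal.ofReal R) :=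
        lintegral_lintegral_swap (hmeas.mul_const _).aemeasurable
    _ ≤ ∫⁻ t in Ioc (0 : ℝ) 1, ENNReal.ofReal (t ^ (-(N / q))) *
          ((H ^ (1 / q) * V ^ (1 - 1 / q)) * ENNReal.ofReal R) := by
        refine setLIntegral_mono' measurableSet_Ioc fun t ht => ?_
        have hmt : Measurable fun y => h (x + t • (y - x)) := hh.comp (by fun_prop)
        rw [lintegral_mul_const _ hmt, ← mul_assoc]
        gcongr
        exact hinner t ht
    _ = _ := by
        rw [lintegral_mul_const _ (by fun_prop), lintegral_rpow_neg_Ioc hNq]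
        ring

/-- The constant in Morrey's inequality for balls at distance comparable to `M` times their
radius. -/
def morreyConst (N : ℕ) (q M : ℝ) : ℝ :=
  2 * (M + 1) * (1 / (1 - N / q)) * (volume (Metric.ball (0 : Euc N) 1)).toReal ^ (-(1 / q))

theorem morreyConst_nonneg {q M : ℝ} (hq : N < q) (hM : 0 ≤ M) : 0 ≤ morreyConst N q M := by
  have hq0 : 0 < q := lt_of_le_of_lt N.cast_nonneg hq
  have : (N : ℝ) / q < 1 := (div_lt_one hq0).2 hq
  have : 0 < 1 - (N : ℝ) / q := by linarith
  unfold morreyConst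
  positivity

theorem enorm_sub_le_of_segments (hN : 1 ≤ N) {q : ℝ} (hq : N < q) {v : Euc N → ℝ}
    (hv : ContDiff ℝ 1 v) {h : Euc N → ℝ≥0∞} (hh : Measurable h) {x x' z : Euc N} {r M : ℝ}
    (hr : 0 < r) (hM : 0 ≤ M) (hx : dist z x ≤ M * r) (hx' : dist z x' ≤ M * r)
    (hb : ∀ y ∈ Metric.ball z r, ∀ t ∈ Icc (0 : ℝ) 1,
      ‖fderiv ℝ v (x + t • (y - x))‖ₑ ≤ h (x + t • (y - x)))
    (hb' : ∀ y ∈ Metric.ball z r, ∀ t ∈ Icc (0 : ℝ) 1,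
      ‖fderiv ℝ v (x' + t • (y - x'))‖ₑ ≤ h (x' + t • (y - x'))) :
    ‖v x - v x'‖ₑ ≤ ENNReal.ofReal (morreyConst N q M * r ^ (1 - N / q)) *
      (∫⁻ y, h y ^ q) ^ (1 / q) := by
  have hN' : (1 : ℝ) ≤ N := by exact_mod_cast hN
  have hq0 : 0 < q := by linarith
  have hNq : (N : ℝ) / q < 1 := (div_lt_one hq0).2 hq
  set κ := (volume (Metric.ball (0 : Euc N) 1)).toReal with hκ
  have hκpos : 0 < κ := ENNReal.toReal_pos (Metric.measure_ball_pos volume _ one_pos).ne'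
    measure_ball_lt_top.ne
  have hV : volume (Metric.ball z r) = ENNReal.ofReal (r ^ (N : ℝ) * κ) := by
    rw [Measure.addHaar_ball_of_pos _ _ hr, ENNReal.ofReal_mul (by positivity), hκ,
      ENNReal.ofReal_toReal measure_ball_lt_top.ne, finrank_euclideanSpace, Fintype.card_fin,
      Real.rpow_natCast]
  set V := volume (Metric.ball z r) with hVdef
  have hR : ∀ {p : Euc N}, dist z p ≤ M * r → ∀ y ∈ Metric.ball z r, ‖y - p‖ ≤ (M + 1) * r := by
    intro p hp y hy
    rw [← dist_eq_norm]
    have := dist_triangle y z p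
    rw [Metric.mem_ball] at hy
    nlinarith
  have h1 := lintegral_enorm_sub_le_of_segments hN hq hv hh (hR hx) hb
  have h2 := lintegral_enorm_sub_le_of_segments hN hq hv hh (hR hx') hb'
  set A := ENNReal.ofReal ((M + 1) * r) * ENNReal.ofReal (1 / (1 - N / q)) *
    (∫⁻ y, h y ^ q) ^ (1 / q) with hA
  have h3 : ‖v x - v x'‖ₑ * V ≤ (2 * A * V ^ (-(1 / q))) * V := by
    calc ‖v x - v x'‖ₑ * V = ∫⁻ _ in Metric.ball z r, ‖v x - v x'‖ₑ := by
          rw [setLIntegral_const]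
      _ ≤ ∫⁻ y in Metric.ball z r, (‖v y - v x‖ₑ + ‖v y - v x'‖ₑ) := by
          refine lintegral_mono fun y => ?_
          have : v x - v x' = (v y - v x') - (v y - v x) := by ring
          rw [this, add_comm]
          exact enorm_sub_le
      _ = (∫⁻ y in Metric.ball z r, ‖v y - v x‖ₑ) + ∫⁻ y in Metric.ball z r, ‖v y - v x'‖ₑ :=
          lintegral_add_left (hv.continuous.measurable.sub_const _).enorm _
      _ ≤ A * V ^ (1 - 1 / q) + A * V ^ (1 - 1 / q) := add_le_add h1 h2
      _ = (2 * A * V ^ (-(1 / q))) * V := by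
          have : V ^ (1 - 1 / q) = V ^ (-(1 / q)) * V := by
            conv_rhs => rw [← ENNReal.rpow_one V, ← ENNReal.rpow_mul, one_mul]
            rw [← ENNReal.rpow_add _ _ (Metric.measure_ball_pos volume _ hr).ne'
              measure_ball_lt_top.ne]
            congr 1
            ring
          rw [this]
          ring
  have h4 : ‖v x - v x'‖ₑ ≤ 2 * A * V ^ (-(1 / q)) :=
    (ENNReal.mul_le_mul_iff_left (Metric.measure_ball_pos volume _ hr).ne'
      measure_ball_lt_top.ne).1 h3
  refine h4.trans_eq ?_
  rw [hV, ENNReal.ofReal_rpow_of_pos (by positivity), hA,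
    Real.mul_rpow (by positivity) hκpos.le, ← Real.rpow_mul hr.le]
  have h5 : morreyConst N q M * r ^ (1 - N / q) = 2 * ((M + 1) * r) * (1 / (1 - N / q)) *
      (r ^ (N * -(1 / q)) * κ ^ (-(1 / q))) := by
    have : r ^ (1 - (N : ℝ) / q) = r * r ^ (N * -(1 / q)) := by
      rw [sub_eq_add_neg, Real.rpow_add hr, Real.rpow_one]
      congr 2
      ring
    rw [morreyConst, this]
    ring
  have hpos : (0 : ℝ) ≤ 1 / (1 - N / q) := one_div_nonneg.2 (by linarith)
  rw [h5, ENNReal.ofReal_mul (p := 2 * ((M + 1) * r) * (1 / (1 - N / q))) (by positivity),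
    ENNReal.ofReal_mul (p := 2 * ((M + 1) * r)) (by positivity),
    ENNReal.ofReal_mul (p := 2) (by positivity), ENNReal.ofReal_ofNat]
  ring

/-- The union of the segments from `x` to the closed ball `B(z, r)` lies in `U`. -/
def StarHullSubset (U : Set (Euc N)) (x z : Euc N) (r : ℝ) : Prop :=
  ∀ y ∈ Metric.closedBall z r, ∀ t ∈ Icc (0 : ℝ) 1, x + t • (y - x) ∈ U

theorem StarHullSubset.eventually_closedBall_subset {U : Set (Euc N)} (hU : IsOpen U)
    {x z : Euc N} {r : ℝ} (h : StarHullSubset U x z r) :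
    ∀ᶠ n : ℕ in atTop, ∀ y ∈ Metric.ball z r, ∀ t ∈ Icc (0 : ℝ) 1,
      Metric.closedBall (x + t • (y - x)) (1 / (n + 1)) ⊆ U := by
  set f : Euc N × ℝ → Euc N := fun w => x + w.2 • (w.1 - x) with hf
  set S := f '' (Metric.closedBall z r ×ˢ Icc (0 : ℝ) 1) with hS
  have hfc : Continuous f := by fun_prop
  have hK : IsCompact S := ((isCompact_closedBall z r).prod isCompact_Icc).image hfc
  have hSU : S ⊆ U := by
    rintro p hp
    obtain ⟨w, hw, rfl⟩ := hp
    exact h w.1 hw.1 w.2 hw.2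
  obtain ⟨δ, hδ, hsub⟩ := hK.exists_cthickening_subset_open hU hSU
  have hlim : ∀ᶠ n : ℕ in atTop, 1 / ((n : ℝ) + 1) < δ :=
    tendsto_one_div_add_atTop_nhds_zero_nat.eventually (gt_mem_nhds hδ)
  filter_upwards [hlim] with n hn y hy t ht
  have hmem : x + t • (y - x) ∈ S :=
    mem_image_of_mem f (mk_mem_prod (Metric.ball_subset_closedBall hy) ht)
  exact ((Metric.closedBall_subset_closedBall hn.le).trans
    (Metric.closedBall_subset_cthickening hmem δ)).trans hsub

/-- Morrey's inequality for the mollifications of a Sobolev function, at two points from which a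
common ball is visible inside `U`. -/
theorem HasWeakGradient.eventually_enorm_mollify_sub_le (hN : 1 ≤ N) {q : ℝ} (hq : N < q)
    {U : Set (Euc N)} (hU : IsOpen U) {u : Euc N → ℝ} {G : Euc N → Euc N}
    (h : HasWeakGradient U u G) (hu : IntegrableOn u U) (hG : IntegrableOn G U)
    {x x' z : Euc N} {r M : ℝ}
    (hr : 0 < r) (hM : 0 ≤ M) (hx : dist z x ≤ M * r) (hx' : dist z x' ≤ M * r)
    (hs : StarHullSubset U x z r) (hs' : StarHullSubset U x' z r) :
    ∀ᶠ n : ℕ in atTop, ‖mollify n (U.indicator u) x - mollify n (U.indicator u) x'‖ₑ ≤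
      ENNReal.ofReal (morreyConst N q M * r ^ (1 - N / q)) *
        (∫⁻ y in U, ‖G y‖ₑ ^ q) ^ (1 / q) := by
  have hN' : (1 : ℝ) ≤ N := by exact_mod_cast hN
  have hGi : Integrable (U.indicator G) := hG.integrable_indicator hU.measurableSet
  have hui : Integrable (U.indicator u) := hu.integrable_indicator hU.measurableSet
  filter_upwards [hs.eventually_closedBall_subset hU, hs'.eventually_closedBall_subset hU]
    with n hn hn'
  have hgrad : ∀ {p : Euc N}, Metric.closedBall p (1 / (n + 1)) ⊆ U →
      ‖fderiv ℝ (mollify n (U.indicator u)) p‖ₑ ≤ ‖mollify n (U.indicator G) p‖ₑ := by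
    intro p hp
    rw [← ofReal_norm, ← ofReal_norm]
    refine ENNReal.ofReal_le_ofReal ?_
    refine ContinuousLinearMap.opNorm_le_bound _ (norm_nonneg _) fun w => ?_
    rw [h.fderiv_mollify hU.measurableSet hu hG hp]
    exact norm_inner_le_norm _ _
  refine (enorm_sub_le_of_segments hN hq
    ((contDiff_mollify n hui.locallyIntegrable).of_le (by simp))
    (contDiff_mollify n hGi.locallyIntegrable).continuous.measurable.enorm hr hM hx hx'
    (fun y hy t ht => hgrad (hn y hy t ht)) (fun y hy t ht => hgrad (hn' y hy t ht))).trans ?_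
  have hq0 : 0 < q := by linarith
  gcongr _ * ?_ ^ _
  refine (lintegral_mollify_rpow_le n (q := q) (by linarith) hGi.1).trans_eq ?_
  rw [← lintegral_indicator hU.measurableSet]
  refine lintegral_congr fun y => ?_
  by_cases hy : y ∈ U
  · simp [hy]
  · simp [hy, hq0]

/-! ### Geometry of domains that are locally subgraphs -/

/-- The orthogonal projection onto the hyperplane orthogonal to `e`. -/
abbrev hyperProj (e : Euc N) : Euc N →L[ℝ] (Submodule.span ℝ {e})ᗮ :=
  (Submodule.span ℝ {e})ᗮ.orthogonalProjectionOnto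

/-- `U` is locally the subgraph of a continuous function that is Lipschitz near the boundary point
in question: the common feature of smooth and of Lipschitz boundaries. -/
def HasLocallyLipschitzBoundary (U : Set (Euc N)) : Prop :=
  ∀ x₀ ∈ frontier U, ∃ e : Euc N, ‖e‖ = 1 ∧ ∃ γ : (Submodule.span ℝ {e})ᗮ → ℝ,
    Continuous γ ∧ (∃ K, ∃ s ∈ 𝓝 (hyperProj e x₀), LipschitzOnWith K γ s) ∧
      IsSubgraphNear U x₀ e γ

theorem HasSmoothBoundary.hasLocallyLipschitzBoundary {U : Set (Euc N)}
    (h : HasSmoothBoundary U) : HasLocallyLipschitzBoundary U := by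
  intro x₀ hx₀
  obtain ⟨e, he, γ, hγ, hU⟩ := h x₀ hx₀
  exact ⟨e, he, γ, hγ.continuous, (hγ.of_le (by simp)).contDiffAt.exists_lipschitzOnWith, hU⟩

theorem HasLipschitzBoundary.hasLocallyLipschitzBoundary {U : Set (Euc N)}
    (h : HasLipschitzBoundary U) : HasLocallyLipschitzBoundary U := by
  intro x₀ hx₀
  obtain ⟨e, he, γ, ⟨K, hK⟩, hU⟩ := h x₀ hx₀
  exact ⟨e, he, γ, hK.continuous, ⟨K, univ, univ_mem, hK.lipschitzOnWith⟩, hU⟩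

theorem hyperProj_self (e : Euc N) : hyperProj e e = 0 :=
  Submodule.orthogonalProjectionOnto_orthogonalComplement_singleton_eq_zero e

theorem hyperProj_add_inner_smul {e : Euc N} (he : ‖e‖ = 1) (x : Euc N) :
    (hyperProj e x : Euc N) + inner ℝ e x • e = x := by
  have := Submodule.starProjection_add_starProjection_orthogonal (K := Submodule.span ℝ {e}) x
  rw [Submodule.starProjection_unit_singleton ℝ he, add_comm] at this
  exact this

/-- Near a boundary point the boundary lies on the graph. -/
theorem IsSubgraphNear.exists_frontier_subset {U : Set (Euc N)} (hU : IsOpen U) {x₀ e : Euc N}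
    {γ : (Submodule.span ℝ {e})ᗮ → ℝ} (hγ : Continuous γ) (h : IsSubgraphNear U x₀ e γ) :
    ∃ r > 0, ∀ x ∈ frontier U ∩ Metric.ball x₀ r, inner ℝ e x = γ (hyperProj e x) := by
  obtain ⟨r, hr, hsub⟩ := h
  refine ⟨r, hr, fun x hx => ?_⟩
  have hxU : x ∉ U := fun h => by
    have := hx.1.2
    rw [hU.interior_eq] at this
    exact this h
  have h1 : γ (hyperProj e x) ≤ inner ℝ e x := by
    by_contra hlt
    exact hxU ((hsub x hx.2).2 (not_le.1 hlt))
  refine le_antisymm ?_ h1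
  by_contra hlt
  have hopen : IsOpen {y : Euc N | γ (hyperProj e y) < inner ℝ e y} :=
    isOpen_lt (hγ.comp (hyperProj e).continuous) (by fun_prop)
  obtain ⟨y, ⟨hy1, hy2⟩, hyU⟩ := mem_closure_iff.1 hx.1.1 _
    (hopen.inter Metric.isOpen_ball) ⟨not_le.1 hlt, hx.2⟩
  exact lt_irrefl _ (hy1.trans ((hsub y hy2).1 hyU))

/-- A graph is a null set, since its vertical translates are pairwise disjoint. -/
theorem volume_graph_eq_zero {e : Euc N} (he : ‖e‖ = 1) {γ : (Submodule.span ℝ {e})ᗮ → ℝ}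
    (hγ : Continuous γ) : volume {x : Euc N | inner ℝ e x = γ (hyperProj e x)} = 0 := by
  refine Measure.addHaar_eq_zero_of_disjoint_translates volume
    (fun n : ℕ => ((1 : ℝ) / (n + 1)) • e) ?_ ?_ ?_
  · refine isBounded_iff_forall_norm_le.2 ⟨1, ?_⟩
    rintro _ ⟨n, rfl⟩
    rw [norm_smul, he, mul_one, Real.norm_of_nonneg (by positivity)]
    exact (div_le_one (by positivity)).2 (by linarith [n.cast_nonneg (α := ℝ)])
  · intro m n hmn
    refine Set.disjoint_left.2 fun x hx hx' => hmn ?_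
    simp only [singleton_add, image_add_left, mem_preimage, mem_ofPred_eq, inner_add_right, map_add,
      map_neg, map_smul, hyperProj_self, smul_zero, neg_zero, zero_add, inner_neg_right,
      inner_smul_right, real_inner_self_eq_norm_sq, he] at hx hx'
    have h1 : (1 : ℝ) / (m + 1) = 1 / (n + 1) := by linarith
    rw [one_div, one_div, inv_inj] at h1
    exact_mod_cast add_right_cancel h1
  · exact (isClosed_eq (by fun_prop) (hγ.comp (hyperProj e).continuous)).measurableSet

theorem HasLocallyLipschitzBoundary.volume_frontier {U : Set (Euc N)} (hU : IsOpen U)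
    (h : HasLocallyLipschitzBoundary U) : volume (frontier U) = 0 := by
  refine measure_null_of_locally_null _ fun x₀ hx₀ => ?_
  obtain ⟨e, he, γ, hγ, -, hsub⟩ := h x₀ hx₀
  obtain ⟨r, hr, hfr⟩ := hsub.exists_frontier_subset hU hγ
  refine ⟨frontier U ∩ Metric.ball x₀ r,
    inter_mem_nhdsWithin _ (Metric.ball_mem_nhds x₀ hr), ?_⟩
  exact measure_mono_null hfr (volume_graph_eq_zero he hγ)

theorem finrank_hyperplane {e : Euc N} (he : ‖e‖ = 1) :
    Module.finrank ℝ (Submodule.span ℝ {e})ᗮ = N - 1 := by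
  have h1 := Submodule.finrank_add_finrank_orthogonal (𝕜 := ℝ) (Submodule.span ℝ {e})
  rw [finrank_span_singleton (by rintro rfl; simp at he), finrank_euclideanSpace,
    Fintype.card_fin] at h1
  omega

/-- The boundary of a bounded domain has finite surface measure: locally it is the image of a
bounded piece of a hyperplane under a Lipschitz map. -/
theorem HasLocallyLipschitzBoundary.surface_frontier_lt_top {U : Set (Euc N)} (hU : IsOpen U)
    (hb : Bornology.IsBounded U) (h : HasLocallyLipschitzBoundary U) :
    (μHE[N - 1] : Measure (Euc N)) (frontier U) < ⊤ := by
  have hcomp : IsCompact (frontier U) :=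
    (Metric.isCompact_of_isClosed_isBounded isClosed_closure hb.closure).of_isClosed_subset
      isClosed_frontier frontier_subset_closure
  refine hcomp.measure_lt_top_of_nhdsWithin fun x₀ hx₀ => ?_
  obtain ⟨e, he, γ, hγ, ⟨K, s, hs, hK⟩, hsub⟩ := h x₀ hx₀
  obtain ⟨r, hr, hfr⟩ := hsub.exists_frontier_subset hU hγ
  set t : Set (Submodule.span ℝ {e})ᗮ := s ∩ Metric.closedBall (hyperProj e x₀) 1 with ht
  have htm : t ∈ 𝓝 (hyperProj e x₀) := inter_mem hs (Metric.closedBall_mem_nhds _ one_pos)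
  have hpre : (hyperProj e) ⁻¹' t ∈ 𝓝 x₀ := (hyperProj e).continuous.continuousAt htm
  refine ⟨frontier U ∩ (Metric.ball x₀ r ∩ hyperProj e ⁻¹' t),
    inter_mem_nhdsWithin _ (inter_mem (Metric.ball_mem_nhds x₀ hr) hpre), ?_⟩
  set f : (Submodule.span ℝ {e})ᗮ → Euc N := fun y => (y : Euc N) + γ y • e with hf
  have hlip : LipschitzOnWith (1 + K) f t := by
    refine LipschitzOnWith.of_dist_le_mul fun y hy z hz => ?_
    have h1 : dist (γ y) (γ z) ≤ K * dist y z := hK.dist_le_mul y hy.1 z hz.1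
    calc dist (f y) (f z) ≤ dist (y : Euc N) z + dist (γ y • e) (γ z • e) := dist_add_add_le _ _ _ _
      _ ≤ dist y z + K * dist y z := by
          gcongr
          · exact le_rfl
          · rw [dist_eq_norm, ← sub_smul, norm_smul, he, mul_one]
            exact h1
      _ = _ := by push_cast; ring
  have hsubset : frontier U ∩ (Metric.ball x₀ r ∩ hyperProj e ⁻¹' t) ⊆ f '' t := by
    rintro x ⟨hx1, hx2, hx3⟩
    refine ⟨hyperProj e x, hx3, ?_⟩
    rw [hf]
    simp only
    rw [← hfr x ⟨hx1, hx2⟩]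
    exact hyperProj_add_inner_smul he x
  refine (measure_mono hsubset).trans_lt ?_
  have hW : (μH[((N - 1 : ℕ) : ℝ)] : Measure (Submodule.span ℝ {e})ᗮ) t < ⊤ := by
    rw [← finrank_hyperplane he]
    exact (measure_mono inter_subset_right).trans_lt (isCompact_closedBall _ _).measure_lt_top
  rw [Measure.euclideanHausdorffMeasure_def, Measure.smul_apply]
  refine ENNReal.mul_lt_top ENNReal.coe_lt_top ?_
  refine (hlip.hausdorffMeasure_image_le (Nat.cast_nonneg _)).trans_lt ?_
  exact ENNReal.mul_lt_top (ENNReal.rpow_lt_top_of_nonneg (Nat.cast_nonneg _) (by simp)) hW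

/-- Any two points `x`, `x'` of `s ∩ U` with `dist x x' ≤ r ≤ r₀` see a common ball `B(z, r)`, at
distance at most `M r`, inside `U`. -/
def HasVisibleBalls (U s : Set (Euc N)) (M r₀ : ℝ) : Prop :=
  ∀ x ∈ U ∩ s, ∀ x' ∈ U, ∀ r, 0 < r → r ≤ r₀ → dist x x' ≤ r →
    ∃ z, dist z x ≤ M * r ∧ dist z x' ≤ M * r ∧ StarHullSubset U x z r ∧ StarHullSubset U x' z r

theorem HasVisibleBalls.mono {U s t : Set (Euc N)} {M M' r₀ r₁ : ℝ} (h : HasVisibleBalls U t M r₀)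
    (hst : s ⊆ t) (hM : M ≤ M') (hr : r₁ ≤ r₀) : HasVisibleBalls U s M' r₁ := by
  intro x hx x' hx' r h0 h1 hd
  obtain ⟨z, h2, h3, h4, h5⟩ := h x ⟨hx.1, hst hx.2⟩ x' hx' r h0 (h1.trans hr) hd
  exact ⟨z, h2.trans (by gcongr), h3.trans (by gcongr), h4, h5⟩

/-- A point of the subgraph sees all points that lie sufficiently far below it. -/
theorem add_smul_mem_of_subgraph {U : Set (Euc N)} {x₀ e : Euc N} (he : ‖e‖ = 1)
    {γ : (Submodule.span ℝ {e})ᗮ → ℝ} {K : NNReal} {ρ : ℝ}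
    (hsub : ∀ x ∈ Metric.ball x₀ ρ, x ∈ U ↔ inner ℝ e x < γ (hyperProj e x))
    (hγ : ∀ x ∈ Metric.ball x₀ ρ, ∀ y ∈ Metric.ball x₀ ρ,
      dist (γ (hyperProj e x)) (γ (hyperProj e y)) ≤ K * dist x y)
    {x : Euc N} (hxU : x ∈ U) (hx : x ∈ Metric.ball x₀ (ρ / 2)) {r : ℝ} (hr : 0 < r)
    (hrρ : (2 * K + 4) * r ≤ ρ / 2) {d : Euc N} (hd : ‖d‖ ≤ 2 * r) {t : ℝ} (ht : t ∈ Icc (0 : ℝ) 1) :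
    x + t • (d - ((2 * K + 2) * r) • e) ∈ U := by
  set y := x + t • (d - ((2 * (K : ℝ) + 2) * r) • e) with hy
  have hK := K.coe_nonneg
  have hρ : 0 < ρ := by
    have : 0 < (2 * (K : ℝ) + 4) * r := by positivity
    linarith
  have hnorm : ‖d - ((2 * (K : ℝ) + 2) * r) • e‖ ≤ (2 * K + 4) * r := by
    refine (norm_sub_le _ _).trans ?_
    rw [norm_smul, he, mul_one, Real.norm_of_nonneg (by positivity)]
    linarith
  have hyb : y ∈ Metric.ball x₀ ρ := by
    rw [Metric.mem_ball] at hx ⊢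
    have h1 : dist y x ≤ (2 * K + 4) * r := by
      rw [hy, dist_eq_norm, add_sub_cancel_left, norm_smul, Real.norm_of_nonneg ht.1]
      calc t * _ ≤ 1 * _ := by gcongr; exact ht.2
        _ ≤ _ := by rw [one_mul]; exact hnorm
    have := dist_triangle y x x₀
    linarith
  have hxb : x ∈ Metric.ball x₀ ρ := Metric.ball_subset_ball (by linarith) hx
  rcases eq_or_lt_of_le ht.1 with h0 | hpos
  · rw [hy, ← h0, zero_smul, add_zero]
    exact hxU
  rw [hsub y hyb]
  have h2 := (hsub x hxb).1 hxU
  -- The points `y` and `x + t d` have the same projection.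
  set y' := x + t • d with hy'
  have hpr : hyperProj e y = hyperProj e y' := by
    rw [hy, hy']
    simp [hyperProj_self]
  have hy'b : y' ∈ Metric.ball x₀ ρ := by
    rw [Metric.mem_ball] at hx ⊢
    have h1 : dist y' x ≤ 2 * r := by
      rw [hy', dist_eq_norm, add_sub_cancel_left, norm_smul, Real.norm_of_nonneg ht.1]
      calc t * _ ≤ 1 * _ := by gcongr; exact ht.2
        _ ≤ _ := by rw [one_mul]; exact hd
    have := dist_triangle y' x x₀
    nlinarith
  have h3 := hγ x hxb y' hy'b
  have h4 : dist x y' ≤ t * (2 * r) := by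
    rw [hy', dist_comm, dist_eq_norm, add_sub_cancel_left, norm_smul, Real.norm_of_nonneg ht.1]
    gcongr
  have h5 : inner ℝ e y ≤ inner ℝ e x + t * (2 * r) - t * ((2 * K + 2) * r) := by
    have h6 : inner ℝ e d ≤ 2 * r := by
      refine (real_inner_le_norm _ _).trans ?_
      rwa [he, one_mul]
    rw [hy, inner_add_right, inner_smul_right, inner_sub_right, inner_smul_right,
      real_inner_self_eq_norm_sq, he]
    nlinarith
  rw [hpr]
  have h7 := (abs_le.1 ((Real.dist_eq _ _).symm.le.trans h3)).2
  have h8 : (K : ℝ) * dist x y' ≤ K * (t * (2 * r)) := by gcongr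
  nlinarith

theorem HasLocallyLipschitzBoundary.exists_hasVisibleBalls {U : Set (Euc N)} (hU : IsOpen U)
    (hb : Bornology.IsBounded U) (h : HasLocallyLipschitzBoundary U) :
    ∃ M, 0 ≤ M ∧ ∃ r₀, 0 < r₀ ∧ HasVisibleBalls U U M r₀ := by
  have hcomp : IsCompact (closure U) :=
    Metric.isCompact_of_isClosed_isBounded isClosed_closure hb.closure
  suffices hs : ∃ M, 0 ≤ M ∧ ∃ r₀, 0 < r₀ ∧ HasVisibleBalls U (closure U) M r₀ by
    obtain ⟨M, hM, r₀, hr₀, hv⟩ := hs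
    exact ⟨M, hM, r₀, hr₀, hv.mono subset_closure le_rfl le_rfl⟩
  refine hcomp.induction_on (p := fun s => ∃ M, 0 ≤ M ∧ ∃ r₀, 0 < r₀ ∧ HasVisibleBalls U s M r₀)
    ?_ ?_ ?_ ?_
  · exact ⟨0, le_rfl, 1, one_pos, fun x hx => (hx.2).elim⟩
  · rintro s t hst ⟨M, hM, r₀, hr₀, hv⟩
    exact ⟨M, hM, r₀, hr₀, hv.mono hst le_rfl le_rfl⟩
  · rintro s t ⟨M, hM, r₀, hr₀, hv⟩ ⟨M', hM', r₀', hr₀', hv'⟩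
    refine ⟨max M M', le_max_of_le_left hM, min r₀ r₀', lt_min hr₀ hr₀', ?_⟩
    rintro x ⟨hxU, hx | hx⟩
    · exact hv.mono subset_rfl (le_max_left _ _) (min_le_left _ _) x ⟨hxU, hx⟩
    · exact hv'.mono subset_rfl (le_max_right _ _) (min_le_right _ _) x ⟨hxU, hx⟩
  intro x₀ hx₀
  by_cases hx₀U : x₀ ∈ U
  · obtain ⟨ρ, hρ, hball⟩ := Metric.isOpen_iff.1 hU x₀ hx₀U
    refine ⟨Metric.ball x₀ (ρ / 4),
      mem_nhdsWithin_of_mem_nhds (Metric.ball_mem_nhds _ (by positivity)), 1, zero_le_one, ρ / 4,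
      by positivity, ?_⟩
    rintro x ⟨hxU, hx⟩ x' hx' r hr hrρ hd
    have hconv : ∀ p ∈ Metric.ball x₀ ρ, StarHullSubset U p x r := by
      intro p hp y hy t ht
      refine hball ((convex_ball x₀ ρ).add_smul_sub_mem hp ?_ ht)
      rw [Metric.mem_ball] at hx ⊢
      rw [Metric.mem_closedBall] at hy
      have := dist_triangle y x x₀
      linarith
    refine ⟨x, by simpa using hr.le, by simpa using hd, hconv x ?_, hconv x' ?_⟩
    · exact Metric.ball_subset_ball (by linarith) hx
    · rw [Metric.mem_ball] at hx ⊢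
      have := dist_triangle x' x x₀
      rw [dist_comm x' x] at this
      linarith
  · have hfr : x₀ ∈ frontier U := ⟨hx₀, fun hi => hx₀U (interior_subset hi)⟩
    obtain ⟨e, he, γ, hγ, ⟨K, s, hs, hK⟩, ρ₁, hρ₁, hsub⟩ := h x₀ hfr
    obtain ⟨ρ₂, hρ₂, hpre⟩ := Metric.mem_nhds_iff.1
      ((hyperProj e).continuous.continuousAt (x := x₀) hs)
    set ρ := min ρ₁ ρ₂ with hρdef
    have hρ : 0 < ρ := lt_min hρ₁ hρ₂
    have hKnn := K.coe_nonneg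
    have hsub' : ∀ x ∈ Metric.ball x₀ ρ, x ∈ U ↔ inner ℝ e x < γ (hyperProj e x) := fun x hx =>
      hsub x (Metric.ball_subset_ball (min_le_left _ _) hx)
    have hγ' : ∀ x ∈ Metric.ball x₀ ρ, ∀ y ∈ Metric.ball x₀ ρ,
        dist (γ (hyperProj e x)) (γ (hyperProj e y)) ≤ K * dist x y := by
      intro x hx y hy
      refine (hK.dist_le_mul _ (hpre (Metric.ball_subset_ball (min_le_right _ _) hx)) _
        (hpre (Metric.ball_subset_ball (min_le_right _ _) hy))).trans ?_
      gcongr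
      rw [dist_eq_norm, dist_eq_norm, ← map_sub]
      exact Submodule.norm_orthogonalProjectionOnto_apply_le _ _
    refine ⟨Metric.ball x₀ (ρ / 4),
      mem_nhdsWithin_of_mem_nhds (Metric.ball_mem_nhds _ (by positivity)), 2 * K + 3, by positivity,
      ρ / 4 / (K + 2), by positivity, ?_⟩
    rintro x ⟨hxU, hx⟩ x' hx' r hr hrρ hd
    have hr1 : r * (K + 2) ≤ ρ / 4 := (le_div_iff₀ (by positivity)).1 hrρ
    have hr2 : (2 * (K : ℝ) + 4) * r ≤ ρ / 2 := by nlinarith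
    have hdist : dist (x - ((2 * (K : ℝ) + 2) * r) • e) x = (2 * K + 2) * r := by
      rw [dist_eq_norm, sub_sub_cancel_left, norm_neg, norm_smul, he, mul_one,
        Real.norm_of_nonneg (by positivity)]
    have key : ∀ p ∈ U, dist x p ≤ r →
        StarHullSubset U p (x - ((2 * (K : ℝ) + 2) * r) • e) r := by
      intro p hp hxp y hy t ht
      have hpb : p ∈ Metric.ball x₀ (ρ / 2) := by
        rw [Metric.mem_ball] at hx ⊢
        have := dist_triangle p x x₀
        rw [dist_comm p x] at this
        nlinarith
      have hd' : ‖y - p + ((2 * (K : ℝ) + 2) * r) • e‖ ≤ 2 * r := by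
        have : y - p + ((2 * (K : ℝ) + 2) * r) • e
            = (y - (x - ((2 * (K : ℝ) + 2) * r) • e)) + (x - p) := by abel
        rw [this]
        refine (norm_add_le _ _).trans ?_
        rw [← dist_eq_norm, ← dist_eq_norm]
        rw [Metric.mem_closedBall] at hy
        linarith
      have := add_smul_mem_of_subgraph he hsub' hγ' hp hpb hr hr2 hd' ht
      rwa [add_sub_cancel_right] at this
    refine ⟨x - ((2 * (K : ℝ) + 2) * r) • e, ?_, ?_, key x hxU (by simpa using hr.le), key x' hx' hd⟩
    · rw [hdist]; nlinarith
    · have := dist_triangle (x - ((2 * (K : ℝ) + 2) * r) • e) x x'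
      rw [hdist] at this
      linarith

/-! ### Morrey's embedding -/

/-- On a compact connected set, a bound for the oscillation at small scale gives a bound for the
total oscillation, by connecting any two points through a bounded number of small steps. -/
theorem exists_osc_le_of_local {K : Set (Euc N)} (hK : IsCompact K) (hc : IsPreconnected K)
    {r₀ : ℝ} (hr₀ : 0 < r₀) :
    ∃ C : ℝ, 0 ≤ C ∧ ∀ (w : Euc N → ℝ) (A : ℝ), 0 ≤ A →
      (∀ x ∈ K, ∀ y ∈ K, dist x y < r₀ → |w x - w y| ≤ A) →
      ∀ x ∈ K, ∀ y ∈ K, |w x - w y| ≤ C * A := by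
  set Good : (Euc N → ℝ) → ℝ → Prop := fun w A => 0 ≤ A ∧
    ∀ x ∈ K, ∀ y ∈ K, dist x y < r₀ → |w x - w y| ≤ A with hGood
  have hpair : ∀ x ∈ K, ∀ y ∈ K, ∃ C : ℝ, ∀ w A, Good w A → |w x - w y| ≤ C * A := by
    intro x hx y hy
    refine hc.induction₂ (fun x y => ∃ C : ℝ, ∀ w A, Good w A → |w x - w y| ≤ C * A)
      ?_ ?_ ?_ hx hy
    · intro x hx
      filter_upwards [self_mem_nhdsWithin, mem_nhdsWithin_of_mem_nhds (Metric.ball_mem_nhds x hr₀)]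
        with y hy hyx
      refine ⟨1, fun w A hw => ?_⟩
      rw [one_mul]
      exact hw.2 x hx y hy (by rwa [dist_comm])
    · rintro x y z - - - ⟨C, hC⟩ ⟨C', hC'⟩
      refine ⟨C + C', fun w A hw => ?_⟩
      have := abs_sub_le (w x) (w y) (w z)
      have h1 := hC w A hw
      have h2 := hC' w A hw
      linarith
    · rintro x y - - ⟨C, hC⟩
      refine ⟨C, fun w A hw => ?_⟩
      rw [abs_sub_comm]
      exact hC w A hw
  rcases K.eq_empty_or_nonempty with rfl | ⟨x₁, hx₁⟩
  · exact ⟨0, le_rfl, fun w A _ _ x hx => hx.elim⟩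
  have hunif : ∃ C : ℝ, 0 ≤ C ∧ ∀ w A, Good w A → ∀ x ∈ K, x ∈ K → |w x - w x₁| ≤ C * A := by
    refine hK.induction_on
      (p := fun s => ∃ C : ℝ, 0 ≤ C ∧ ∀ w A, Good w A → ∀ x ∈ s, x ∈ K → |w x - w x₁| ≤ C * A)
      ?_ ?_ ?_ ?_
    · exact ⟨0, le_rfl, fun w A _ x hx => hx.elim⟩
    · rintro s t hst ⟨C, h0, hC⟩
      exact ⟨C, h0, fun w A hw x hx => hC w A hw x (hst hx)⟩
    · rintro s t ⟨C, h0, hC⟩ ⟨C', h0', hC'⟩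
      refine ⟨max C C', le_max_of_le_left h0, ?_⟩
      rintro w A hw x (hx | hx) hxK
      · exact (hC w A hw x hx hxK).trans (mul_le_mul_of_nonneg_right (le_max_left _ _) hw.1)
      · exact (hC' w A hw x hx hxK).trans (mul_le_mul_of_nonneg_right (le_max_right _ _) hw.1)
    · intro x hx
      obtain ⟨C, hC⟩ := hpair x hx x₁ hx₁
      refine ⟨Metric.ball x r₀, mem_nhdsWithin_of_mem_nhds (Metric.ball_mem_nhds x hr₀),
        |C| + 1, by positivity, fun w A hw y hy hyK => ?_⟩
      have h1 := hw.2 y hyK x hx hy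
      have h2 := hC w A hw
      have h3 := abs_sub_le (w y) (w x) (w x₁)
      have h4 := mul_le_mul_of_nonneg_right (le_abs_self C) hw.1
      linarith
  obtain ⟨C, h0, hC⟩ := hunif
  refine ⟨2 * C, by positivity, fun w A hA hw x hx y hy => ?_⟩
  have h1 := hC w A ⟨hA, hw⟩ x hx hx
  have h2 := hC w A ⟨hA, hw⟩ y hy hy
  have h3 := abs_sub_le (w x) (w x₁) (w y)
  rw [abs_sub_comm (w x₁)] at h3
  linarith

/-- The `L^q` norm of `G` on `U`, as a real number. -/
def lqNorm (U : Set (Euc N)) (q : ℝ) (G : Euc N → Euc N) : ℝ :=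
  ((∫⁻ y in U, ‖G y‖ₑ ^ q) ^ (1 / q)).toReal

theorem lqNorm_nonneg (U : Set (Euc N)) (q : ℝ) (G : Euc N → Euc N) : 0 ≤ lqNorm U q G :=
  ENNReal.toReal_nonneg

theorem integrableOn_of_lintegral_rpow_lt_top {F : Type*} [NormedAddCommGroup F]
    {U : Set (Euc N)} (hb : Bornology.IsBounded U) {q : ℝ} (hq : 1 ≤ q) {G : Euc N → F}
    (hm : AEStronglyMeasurable G (volume.restrict U)) (hG : ∫⁻ y in U, ‖G y‖ₑ ^ q < ⊤) :
    IntegrableOn G U := by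
  refine ⟨hm, (lintegral_le_rpow_mul_measure _ hq hm.enorm).trans_lt ?_⟩
  have h1 : 1 / q ≤ 1 := (div_le_one (by linarith)).2 hq
  refine ENNReal.mul_lt_top (ENNReal.rpow_lt_top_of_nonneg (by positivity) hG.ne)
    (ENNReal.rpow_lt_top_of_nonneg (by linarith) ?_)
  rw [Measure.restrict_apply_univ]
  exact hb.measure_lt_top.ne

/-- Points of `closure U` are limits of points from any subset of full measure in `U`. -/
theorem closure_subset_closure_of_ae {U T : Set (Euc N)} (hU : IsOpen U)
    (hT : ∀ᵐ x, x ∈ U → x ∈ T) : closure U ⊆ closure T := by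
  intro x hx
  rw [mem_closure_iff] at hx ⊢
  intro o ho hxo
  obtain ⟨y, hyo, hyU⟩ := hx o ho hxo
  by_contra hne
  have hpos : 0 < volume (o ∩ U) := (ho.inter hU).measure_pos volume ⟨y, hyo, hyU⟩
  refine hpos.ne' (measure_mono_null ?_ hT)
  rintro z ⟨hzo, hzU⟩ hz
  exact hne ⟨z, hzo, hz hzU⟩

/-- A function that is Hölder continuous at small scale on a set `T` extends continuously to the
closure, with the same Hölder estimate. -/
theorem exists_continuousOn_extension {T : Set (Euc N)} {u : Euc N → ℝ} {r₀ α A : ℝ}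
    (hr₀ : 0 < r₀) (hα : 0 < α)
    (hu : ∀ x ∈ T, ∀ y ∈ T, dist x y < r₀ → |u x - u y| ≤ A * dist x y ^ α) :
    ∃ w : Euc N → ℝ, ContinuousOn w (closure T) ∧ (∀ x ∈ T, w x = u x) ∧
      ∀ x ∈ closure T, ∀ y ∈ closure T, dist x y < r₀ → |w x - w y| ≤ A * dist x y ^ α := by
  have hsmall : ∀ ε > 0, ∃ δ > 0, ∀ d : ℝ, 0 ≤ d → d < δ → A * d ^ α < ε := by
    intro ε hε
    have hcont : Tendsto (fun d : ℝ => A * d ^ α) (𝓝 0) (𝓝 (A * 0 ^ α)) :=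
      ((Real.continuousAt_rpow_const 0 α (Or.inr hα.le)).tendsto).const_mul A
    rw [Real.zero_rpow hα.ne', mul_zero] at hcont
    obtain ⟨δ, hδ, h⟩ := Metric.tendsto_nhds_nhds.1 hcont ε hε
    refine ⟨δ, hδ, fun d hd hdδ => (le_abs_self _).trans_lt ?_⟩
    have := h (x := d) (by rwa [Real.dist_eq, sub_zero, abs_of_nonneg hd])
    rwa [Real.dist_eq, sub_zero] at this
  have hlim : ∀ x ∈ closure T, ∃ y, Tendsto u (𝓝[T] x) (𝓝 y) := by
    intro x hx
    have : (𝓝[T] x).NeBot := mem_closure_iff_nhdsWithin_neBot.1 hx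
    rw [← cauchy_map_iff_exists_tendsto, Metric.cauchy_iff]
    refine ⟨this.map u, fun ε hε => ?_⟩
    obtain ⟨δ, hδ, h⟩ := hsmall ε hε
    set ρ := min δ r₀ / 2 with hρ
    have hρpos : 0 < ρ := by have := lt_min hδ hr₀; positivity
    refine ⟨u '' (T ∩ Metric.ball x ρ), image_mem_map (inter_mem_nhdsWithin _
      (Metric.ball_mem_nhds x hρpos)), ?_⟩
    rintro _ ⟨y, ⟨hyT, hy⟩, rfl⟩ _ ⟨z, ⟨hzT, hz⟩, rfl⟩
    have hd : dist y z < min δ r₀ := by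
      rw [Metric.mem_ball] at hy hz
      have := dist_triangle_right y z x
      linarith
    exact (hu y hyT z hzT (hd.trans_le (min_le_right _ _))).trans_lt
      (h _ dist_nonneg (hd.trans_le (min_le_left _ _)))
  have hw : ∀ x ∈ closure T, Tendsto u (𝓝[T] x) (𝓝 (extendFrom T u x)) := fun x hx =>
    tendsto_extendFrom (hlim x hx)
  refine ⟨extendFrom T u, continuousOn_extendFrom subset_rfl hlim, ?_, ?_⟩
  · intro x hx
    refine extendFrom_eq (subset_closure hx) ?_
    have hxc := hw x (subset_closure hx)
    obtain ⟨y, hy⟩ := hlim x (subset_closure hx)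
    have hpure : pure x ≤ 𝓝[T] x := pure_le_nhdsWithin hx
    have h2 : Tendsto u (pure x) (𝓝 y) := hy.mono_left hpure
    have h3 : u x = y := tendsto_nhds_unique (tendsto_pure_nhds u x) h2
    rw [h3]
    exact hy
  · intro x hx y hy hd
    have h1 : (𝓝[T] x).NeBot := mem_closure_iff_nhdsWithin_neBot.1 hx
    have h2 : (𝓝[T] y).NeBot := mem_closure_iff_nhdsWithin_neBot.1 hy
    have hfst : Tendsto Prod.fst (𝓝[T] x ×ˢ 𝓝[T] y) (𝓝 x) :=
      tendsto_fst.mono_right nhdsWithin_le_nhds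
    have hsnd : Tendsto Prod.snd (𝓝[T] x ×ˢ 𝓝[T] y) (𝓝 y) :=
      tendsto_snd.mono_right nhdsWithin_le_nhds
    have hdist : Tendsto (fun z : Euc N × Euc N => dist z.1 z.2) (𝓝[T] x ×ˢ 𝓝[T] y)
        (𝓝 (dist x y)) := hfst.dist hsnd
    refine le_of_tendsto_of_tendsto (b := 𝓝[T] x ×ˢ 𝓝[T] y)
      (f := fun z => |u z.1 - u z.2|) (g := fun z => A * dist z.1 z.2 ^ α) ?_ ?_ ?_
    · exact (((hw x hx).comp tendsto_fst).sub ((hw y hy).comp tendsto_snd)).abs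
    · exact ((hdist.rpow_const (Or.inr hα.le)).const_mul A)
    · filter_upwards [hdist.eventually (gt_mem_nhds hd),
        prod_mem_prod self_mem_nhdsWithin self_mem_nhdsWithin] with z hz hzT
      exact hu _ hzT.1 _ hzT.2 hz

/-- Morrey's embedding: for `q > N` a Sobolev function on a bounded domain with Lipschitz boundary
has a representative that is Hölder continuous up to the boundary, and its oscillation is controlled
by the `L^q` norm of the gradient. -/
theorem exists_morrey_embedding (hN : 1 ≤ N) {q : ℝ} (hq : N < q) {U : Set (Euc N)}
    (hU : IsOpen U) (hconn : IsConnected U) (hb : Bornology.IsBounded U)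
    (hlip : HasLocallyLipschitzBoundary U) :
    ∃ C r₀ α : ℝ, 0 ≤ C ∧ 0 < r₀ ∧ 0 < α ∧ ∀ (u : Euc N → ℝ) (G : Euc N → Euc N),
      HasWeakGradient U u G → IntegrableOn u U → ∫⁻ y in U, ‖G y‖ₑ ^ q < ⊤ →
      ∃ w : Euc N → ℝ, ContinuousOn w (closure U) ∧ w =ᵐ[volume.restrict U] u ∧
        (∀ x ∈ closure U, ∀ y ∈ closure U, dist x y < r₀ →
          |w x - w y| ≤ C * lqNorm U q G * dist x y ^ α) ∧
        ∀ x ∈ closure U, ∀ y ∈ closure U, |w x - w y| ≤ C * lqNorm U q G := by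
  obtain ⟨M, hM, r₀, hr₀, hvis⟩ := hlip.exists_hasVisibleBalls hU hb
  have hcomp : IsCompact (closure U) :=
    Metric.isCompact_of_isClosed_isBounded isClosed_closure hb.closure
  obtain ⟨C₁, hC₁, hosc⟩ := exists_osc_le_of_local hcomp hconn.isPreconnected.closure hr₀
  have hN' : (1 : ℝ) ≤ N := by exact_mod_cast hN
  have hq0 : 0 < q := by linarith
  set α := 1 - N / q with hα
  have hαpos : 0 < α := by
    have : (N : ℝ) / q < 1 := (div_lt_one hq0).2 hq
    linarith
  set K := morreyConst N q M with hK
  have hK0 : 0 ≤ K := morreyConst_nonneg hq hM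
  refine ⟨max K (C₁ * (K * r₀ ^ α)), r₀, α, le_max_of_le_left hK0, hr₀, hαpos, ?_⟩
  intro u G h hu hE
  have hG : IntegrableOn G U := integrableOn_of_lintegral_rpow_lt_top hb (q := q) (by linarith)
    (h.2.1.aestronglyMeasurable) hE
  have hui : Integrable (U.indicator u) := hu.integrable_indicator hU.measurableSet
  have hEr : (∫⁻ y in U, ‖G y‖ₑ ^ q) ^ (1 / q) ≠ ⊤ :=
    ENNReal.rpow_ne_top_of_nonneg (by positivity) hE.ne
  set T : Set (Euc N) := {x | x ∈ U ∧
    Tendsto (fun n => mollify n (U.indicator u) x) atTop (𝓝 (U.indicator u x))} with hT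
  have hTae : ∀ᵐ x, x ∈ U → x ∈ T := by
    filter_upwards [ae_tendsto_mollify hui.locallyIntegrable] with x hx hxU
    exact ⟨hxU, hx⟩
  have hest : ∀ x ∈ T, ∀ y ∈ T, dist x y < r₀ → |u x - u y| ≤ K * lqNorm U q G * dist x y ^ α := by
    intro x hx y hy hd
    rcases eq_or_ne x y with rfl | hne
    · simp [Real.zero_rpow hαpos.ne']
    have hdpos : 0 < dist x y := dist_pos.2 hne
    obtain ⟨z, h1, h2, h3, h4⟩ := hvis x ⟨hx.1, hx.1⟩ y hy.1 (dist x y) hdpos hd.le le_rfl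
    have hev := h.eventually_enorm_mollify_sub_le hN hq hU hu hG hdpos hM h1 h2 h3 h4
    have hlim : Tendsto (fun n => ‖mollify n (U.indicator u) x - mollify n (U.indicator u) y‖ₑ)
        atTop (𝓝 ‖U.indicator u x - U.indicator u y‖ₑ) := (hx.2.sub hy.2).enorm
    have hle := le_of_tendsto hlim hev
    rw [indicator_of_mem hx.1, indicator_of_mem hy.1] at hle
    have h5 := ENNReal.toReal_mono (ENNReal.mul_ne_top ENNReal.ofReal_ne_top hEr) hle
    rw [toReal_enorm, ENNReal.toReal_mul, ENNReal.toReal_ofReal (by positivity)] at h5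
    rw [lqNorm, mul_right_comm]
    exact h5
  have hcl : closure U ⊆ closure T := closure_subset_closure_of_ae hU hTae
  obtain ⟨w, hwc, hwT, hwest⟩ := exists_continuousOn_extension hr₀ hαpos hest
  have hE0 := lqNorm_nonneg U q G
  refine ⟨w, hwc.mono hcl, ?_, ?_, ?_⟩
  · rw [EventuallyEq, ae_restrict_iff' hU.measurableSet]
    filter_upwards [hTae] with x hx hxU using hwT x (hx hxU)
  · intro x hx y hy hd
    refine (hwest x (hcl hx) y (hcl hy) hd).trans ?_
    have := le_max_left K (C₁ * (K * r₀ ^ α))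
    gcongr
  · intro x hx y hy
    have h6 := hosc w (K * lqNorm U q G * r₀ ^ α) (by positivity) (fun x hx y hy hd =>
      (hwest x (hcl hx) y (hcl hy) hd).trans (by gcongr)) x hx y hy
    refine h6.trans ?_
    rw [show C₁ * (K * lqNorm U q G * r₀ ^ α) = C₁ * (K * r₀ ^ α) * lqNorm U q G by ring]
    gcongr
    exact le_max_right _ _

/-! ### Calculus of weak gradients -/

theorem MeasureTheory.LocallyIntegrableOn.integrable_smul_of_tsupport_subset {F : Type*}
    [NormedAddCommGroup F] [NormedSpace ℝ F] {U : Set (Euc N)} {f : Euc N → F}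
    (hf : LocallyIntegrableOn f U) {ψ : Euc N → ℝ} (hψ : Continuous ψ) (hc : HasCompactSupport ψ)
    (hs : tsupport ψ ⊆ U) : Integrable fun x => ψ x • f x := by
  rw [← integrableOn_iff_integrable_of_support_subset (s := tsupport ψ)]
  · exact (hf.integrableOn_compact_subset hs hc).continuousOn_smul hψ.continuousOn hc
  · exact (Function.support_smul_subset_left _ _).trans (subset_tsupport ψ)

/-- The directional derivatives of test functions are admissible weights. -/
theorem testFun_fderiv {φ : Euc N → ℝ} (hφ : ContDiff ℝ ∞ φ) (hc : HasCompactSupport φ)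
    (w : Euc N) : Continuous (fun x => fderiv ℝ φ x w) ∧
      HasCompactSupport (fun x => fderiv ℝ φ x w) ∧
      tsupport (fun x => fderiv ℝ φ x w) ⊆ tsupport φ :=
  ⟨(hφ.continuous_fderiv (by simp)).clm_apply continuous_const, hc.fderiv_apply ℝ w,
    tsupport_fderiv_apply_subset ℝ w⟩

namespace HasWeakGradient

variable {U V : Set (Euc N)} {u v : Euc N → ℝ} {G H : Euc N → Euc N}

theorem integrable_left (h : HasWeakGradient U u G) {φ : Euc N → ℝ} (hφ : ContDiff ℝ ∞ φ)
    (hc : HasCompactSupport φ) (hs : tsupport φ ⊆ U) (w : Euc N) :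
    IntegrableOn (fun x => u x * fderiv ℝ φ x w) U := by
  obtain ⟨h1, h2, h3⟩ := testFun_fderiv hφ hc w
  refine (h.1.integrable_smul_of_tsupport_subset h1 h2 (h3.trans hs)).integrableOn.congr ?_
  exact Eventually.of_forall fun x => by simp [mul_comm]

theorem integrable_right (h : HasWeakGradient U u G) {φ : Euc N → ℝ} (hφ : ContDiff ℝ ∞ φ)
    (hc : HasCompactSupport φ) (hs : tsupport φ ⊆ U) (w : Euc N) :
    IntegrableOn (fun x => inner ℝ (G x) w * φ x) U := by
  have := (h.2.1.integrable_smul_of_tsupport_subset hφ.continuous hc hs).inner_const (𝕜 := ℝ) w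
  refine this.integrableOn.congr ?_
  exact Eventually.of_forall fun x => by simp [inner_smul_left, mul_comm]

theorem congr (h : HasWeakGradient U u G) (hu : u =ᵐ[volume.restrict U] v)
    (hG : G =ᵐ[volume.restrict U] H) : HasWeakGradient U v H := by
  have hloc : ∀ {F : Type} [NormedAddCommGroup F] {f g : Euc N → F}, LocallyIntegrableOn f U →
      f =ᵐ[volume.restrict U] g → LocallyIntegrableOn g U := by
    intro F _ f g hf hfg x hx
    obtain ⟨s, hs, hi⟩ := hf x hx
    refine ⟨s ∩ U, inter_mem hs self_mem_nhdsWithin, ?_⟩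
    exact (hi.mono_set inter_subset_left).congr_fun_ae
      (ae_restrict_of_ae_restrict_of_subset inter_subset_right hfg)
  refine ⟨hloc h.1 hu, hloc h.2.1 hG, fun φ hφ hc hs w => ?_⟩
  have h1 := h.2.2 φ hφ hc hs w
  have e1 : ∫ x in U, v x * fderiv ℝ φ x w = ∫ x in U, u x * fderiv ℝ φ x w :=
    integral_congr_ae (hu.mono fun x hx => by simp only [hx])
  have e2 : ∫ x in U, inner ℝ (H x) w * φ x = ∫ x in U, inner ℝ (G x) w * φ x :=
    integral_congr_ae (hG.mono fun x hx => by simp only [hx])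
  rw [e1, e2, h1]

theorem add (h : HasWeakGradient U u G) (h' : HasWeakGradient U v H) :
    HasWeakGradient U (fun x => u x + v x) (fun x => G x + H x) := by
  refine ⟨h.1.add h'.1, h.2.1.add h'.2.1, fun φ hφ hc hs w => ?_⟩
  simp only [add_mul, inner_add_left]
  rw [integral_add (h.integrable_left hφ hc hs w) (h'.integrable_left hφ hc hs w),
    integral_add (h.integrable_right hφ hc hs w) (h'.integrable_right hφ hc hs w),
    h.2.2 φ hφ hc hs w, h'.2.2 φ hφ hc hs w]
  ring

theorem const_smul (h : HasWeakGradient U u G) (c : ℝ) :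
    HasWeakGradient U (fun x => c * u x) (fun x => c • G x) := by
  refine ⟨h.1.smul c, h.2.1.smul c, fun φ hφ hc hs w => ?_⟩
  simp only [mul_assoc, inner_smul_left]
  rw [integral_const_mul, h.2.2 φ hφ hc hs w]
  simp [integral_const_mul]

theorem sub (h : HasWeakGradient U u G) (h' : HasWeakGradient U v H) :
    HasWeakGradient U (fun x => u x - v x) (fun x => G x - H x) := by
  simpa [sub_eq_add_neg] using h.add (h'.const_smul (-1))

theorem mono (h : HasWeakGradient U u G) (hVU : V ⊆ U) :
    HasWeakGradient V u G := by
  refine ⟨h.1.mono_set hVU, h.2.1.mono_set hVU, fun φ hφ hc hs w => ?_⟩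
  have h1 := h.2.2 φ hφ hc (hs.trans hVU) w
  obtain ⟨-, -, h3⟩ := testFun_fderiv hφ hc w
  have e1 : ∀ W : Set (Euc N), V ⊆ W →
      ∫ x in W, u x * fderiv ℝ φ x w = ∫ x, u x * fderiv ℝ φ x w := by
    intro W hW
    refine setIntegral_eq_integral_of_forall_compl_eq_zero fun x hx => ?_
    have : fderiv ℝ φ x w = 0 :=
      image_eq_zero_of_notMem_tsupport (f := fun x => fderiv ℝ φ x w)
        fun hx' => hx (hW (hs (h3 hx')))
    rw [this, mul_zero]
  have e2 : ∀ W : Set (Euc N), V ⊆ W →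
      ∫ x in W, inner ℝ (G x) w * φ x = ∫ x, inner ℝ (G x) w * φ x := by
    intro W hW
    refine setIntegral_eq_integral_of_forall_compl_eq_zero fun x hx => ?_
    rw [image_eq_zero_of_notMem_tsupport fun hx' => hx (hW (hs hx')), mul_zero]
  rw [e1 V subset_rfl, e2 V subset_rfl, ← e1 U hVU, ← e2 U hVU]
  exact h1

/-- Being a weak gradient is a local property. -/
theorem of_forall_isCompact (hU : IsOpen U)
    (h : ∀ K ⊆ U, IsCompact K → ∃ V, IsOpen V ∧ K ⊆ V ∧ V ⊆ U ∧ HasWeakGradient V u G) :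
    HasWeakGradient U u G := by
  have hloc : ∀ {F : Type} [NormedAddCommGroup F] {f : Euc N → F},
      (∀ V, HasWeakGradient V u G → LocallyIntegrableOn f V) → LocallyIntegrableOn f U := by
    intro F _ f hf x hx
    obtain ⟨V, hV, hxV, -, hw⟩ := h {x} (singleton_subset_iff.2 hx) isCompact_singleton
    have := hf V hw x (hxV rfl)
    rw [hV.nhdsWithin_eq (hxV rfl)] at this
    rwa [hU.nhdsWithin_eq hx]
  refine ⟨hloc fun V hV => hV.1, hloc fun V hV => hV.2.1, fun φ hφ hc hs w => ?_⟩
  obtain ⟨V, hV, hKV, hVU, hw⟩ := h _ hs hc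
  obtain ⟨-, -, h3⟩ := testFun_fderiv hφ hc w
  have e1 : ∀ W : Set (Euc N), V ⊆ W →
      ∫ x in W, u x * fderiv ℝ φ x w = ∫ x, u x * fderiv ℝ φ x w := by
    intro W hW
    refine setIntegral_eq_integral_of_forall_compl_eq_zero fun x hx => ?_
    have : fderiv ℝ φ x w = 0 :=
      image_eq_zero_of_notMem_tsupport (f := fun x => fderiv ℝ φ x w)
        fun hx' => hx (hW (hKV (h3 hx')))
    rw [this, mul_zero]
  have e2 : ∀ W : Set (Euc N), V ⊆ W →
      ∫ x in W, inner ℝ (G x) w * φ x = ∫ x, inner ℝ (G x) w * φ x := by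
    intro W hW
    refine setIntegral_eq_integral_of_forall_compl_eq_zero fun x hx => ?_
    rw [image_eq_zero_of_notMem_tsupport fun hx' => hx (hW (hKV hx')), mul_zero]
  rw [e1 U hVU, e2 U hVU, ← e1 V subset_rfl, ← e2 V subset_rfl]
  exact hw.2.2 φ hφ hc hKV w

/-- Classical derivatives are weak derivatives. -/
theorem of_contDiff (hu : ContDiff ℝ 1 u) : HasWeakGradient U u (gradient u) := by
  have hgc : Continuous (gradient u) :=
    (InnerProductSpace.toDual ℝ (Euc N)).symm.continuous.comp (hu.continuous_fderiv (by simp))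
  refine ⟨hu.continuous.locallyIntegrable.locallyIntegrableOn _,
    hgc.locallyIntegrable.locallyIntegrableOn _, fun φ hφ hc hs w => ?_⟩
  obtain ⟨h1, h2, h3⟩ := testFun_fderiv hφ hc w
  have hgr : ∀ x, inner ℝ (gradient u x) w = fderiv ℝ u x w := fun x => by
    simp [gradient]
  rw [setIntegral_eq_integral_of_forall_compl_eq_zero,
    setIntegral_eq_integral_of_forall_compl_eq_zero]
  · simp only [hgr]
    have hfc : Continuous fun x => fderiv ℝ u x w :=
      (hu.continuous_fderiv (by simp)).clm_apply continuous_const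
    refine integral_mul_fderiv_eq_neg_fderiv_mul_of_integrable ?_ ?_ ?_ ?_ ?_
    · exact (hfc.mul hφ.continuous).integrable_of_hasCompactSupport hc.mul_left
    · exact (hu.continuous.mul h1).integrable_of_hasCompactSupport h2.mul_left
    · exact (hu.continuous.mul hφ.continuous).integrable_of_hasCompactSupport hc.mul_left
    · exact fun x _ => hu.differentiable (by simp) x
    · exact fun x _ => hφ.differentiable (by simp) x
  · intro x hx
    rw [image_eq_zero_of_notMem_tsupport fun hx' => hx (hs hx'), mul_zero]
  · intro x hx
    have : fderiv ℝ φ x w = 0 :=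
      image_eq_zero_of_notMem_tsupport (f := fun x => fderiv ℝ φ x w)
        fun hx' => hx (hs (h3 hx'))
    rw [this, mul_zero]

theorem of_const (c : ℝ) : HasWeakGradient U (fun _ => c) (fun _ => 0) := by
  have := of_contDiff (U := U) (u := fun _ => c) contDiff_const
  have h0 : gradient (fun _ : Euc N => c) = fun _ => 0 := by
    ext1 x
    simp [gradient]
  rwa [h0] at this

theorem add_const (h : HasWeakGradient U u G) (c : ℝ) :
    HasWeakGradient U (fun x => u x + c) G := by
  simpa using h.add (of_const c)

/-- Weak gradients pass to limits in `L¹`. -/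
theorem of_tendsto {un : ℕ → Euc N → ℝ} {Gn : ℕ → Euc N → Euc N}
    (h : ∀ n, HasWeakGradient U (un n) (Gn n)) (hun : ∀ n, IntegrableOn (un n) U)
    (hGn : ∀ n, IntegrableOn (Gn n) U) (hu : IntegrableOn u U) (hG : IntegrableOn G U)
    (htu : Tendsto (fun n => ∫ x in U, ‖un n x - u x‖) atTop (𝓝 0))
    (htG : Tendsto (fun n => ∫ x in U, ‖Gn n x - G x‖) atTop (𝓝 0)) :
    HasWeakGradient U u G := by
  refine ⟨hu.locallyIntegrableOn, hG.locallyIntegrableOn, fun φ hφ hc hs w => ?_⟩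
  obtain ⟨h1, h2, h3⟩ := testFun_fderiv hφ hc w
  obtain ⟨C, hC⟩ := h2.exists_bound_of_continuous h1
  obtain ⟨C', hC'⟩ := hc.exists_bound_of_continuous hφ.continuous
  have t1 : Tendsto (fun n => ∫ x in U, un n x * fderiv ℝ φ x w) atTop
      (𝓝 (∫ x in U, u x * fderiv ℝ φ x w)) := by
    rw [tendsto_iff_norm_sub_tendsto_zero]
    have hb : Tendsto (fun n => (∫ x in U, ‖un n x - u x‖) * C) atTop (𝓝 0) := by
      simpa using htu.mul_const C
    refine squeeze_zero (fun n => norm_nonneg _) (fun n => ?_) hb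
    have i1 : IntegrableOn (fun x => un n x * fderiv ℝ φ x w) U :=
      (hun n).mul_bdd (c := C) h1.aestronglyMeasurable (Eventually.of_forall hC)
    have i2 : IntegrableOn (fun x => u x * fderiv ℝ φ x w) U :=
      hu.mul_bdd (c := C) h1.aestronglyMeasurable (Eventually.of_forall hC)
    rw [← integral_sub i1 i2, ← integral_mul_const]
    refine norm_integral_le_of_norm_le (((hun n).sub hu).norm.mul_const C)
      (Eventually.of_forall fun x => ?_)
    rw [← sub_mul, norm_mul]
    gcongr
    exact hC x
  have t2 : Tendsto (fun n => ∫ x in U, inner ℝ (Gn n x) w * φ x) atTop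
      (𝓝 (∫ x in U, inner ℝ (G x) w * φ x)) := by
    rw [tendsto_iff_norm_sub_tendsto_zero]
    have hb : Tendsto (fun n => (∫ x in U, ‖Gn n x - G x‖) * (‖w‖ * C')) atTop (𝓝 0) := by
      simpa using htG.mul_const (‖w‖ * C')
    refine squeeze_zero (fun n => norm_nonneg _) (fun n => ?_) hb
    have i1 : IntegrableOn (fun x => inner ℝ (Gn n x) w * φ x) U :=
      ((hGn n).inner_const w).mul_bdd (c := C') hφ.continuous.aestronglyMeasurable
        (Eventually.of_forall hC')
    have i2 : IntegrableOn (fun x => inner ℝ (G x) w * φ x) U :=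
      (hG.inner_const w).mul_bdd (c := C') hφ.continuous.aestronglyMeasurable
        (Eventually.of_forall hC')
    rw [← integral_sub i1 i2, ← integral_mul_const]
    refine norm_integral_le_of_norm_le (((hGn n).sub hG).norm.mul_const (‖w‖ * C'))
      (Eventually.of_forall fun x => ?_)
    rw [← sub_mul, ← inner_sub_left, norm_mul, ← mul_assoc]
    gcongr
    · exact norm_inner_le_norm _ _
    · exact hC' x
  refine tendsto_nhds_unique t1 ?_
  simp only [(h _).2.2 φ hφ hc hs w]
  exact t2.neg

end HasWeakGradient

theorem weakGrad_ae_eq {U : Set (Euc N)} (hU : IsOpen U) {u : Euc N → ℝ} {G : Euc N → Euc N}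
    (h : HasWeakGradient U u G) : weakGrad U u =ᵐ[volume.restrict U] G :=
  (weakGrad_spec ⟨G, h⟩).ae_eq hU h

/-! ### Boundary values -/

theorem integrableOn_of_continuousOn_closure {U : Set (Euc N)} (hb : Bornology.IsBounded U)
    {w : Euc N → ℝ} (hw : ContinuousOn w (closure U)) : IntegrableOn w U :=
  (hw.integrableOn_compact (Metric.isCompact_of_isClosed_isBounded isClosed_closure
    hb.closure)).mono_set subset_closure

theorem boundaryTrace_eq {U : Set (Euc N)} (hU : IsOpen U) (hb : Bornology.IsBounded U)
    {u w : Euc N → ℝ} (hw : ContinuousOn w (closure U)) (huw : w =ᵐ[volume.restrict U] u)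
    {x : Euc N} (hx : x ∈ closure U) : boundaryTrace U u x = w x := by
  refine Tendsto.limUnder_eq ?_
  rw [Metric.tendsto_nhds]
  intro ε hε
  obtain ⟨δ, hδ, hwδ⟩ := Metric.continuousWithinAt_iff.1 (hw x hx) (ε / 2) (by positivity)
  filter_upwards [Ioo_mem_nhdsGT hδ] with r hr
  have hopen : IsOpen (Metric.ball x r ∩ U) := Metric.isOpen_ball.inter hU
  have hne : (Metric.ball x r ∩ U).Nonempty :=
    mem_closure_iff.1 hx _ Metric.isOpen_ball (Metric.mem_ball_self hr.1)
  have hcongr : u =ᵐ[volume.restrict (Metric.ball x r ∩ U)] w :=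
    ae_restrict_of_ae_restrict_of_subset inter_subset_right huw.symm
  have hmem := (convex_closedBall (w x) (ε / 2)).set_average_mem (μ := volume)
    (t := Metric.ball x r ∩ U) (f := u) Metric.isClosed_closedBall
    (hopen.measure_pos volume hne).ne'
    ((measure_mono inter_subset_left).trans_lt measure_ball_lt_top).ne ?_ ?_
  · rw [Metric.mem_closedBall] at hmem
    linarith
  · filter_upwards [hcongr, ae_restrict_mem hopen.measurableSet] with y hy hyU
    rw [hy]
    have := hwδ (subset_closure hyU.2) (lt_trans hyU.1 hr.2)
    exact this.le
  · exact ((integrableOn_of_continuousOn_closure hb hw).mono_set inter_subset_right).congr_fun_ae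
      hcongr.symm

/-- The boundary term for functions with boundary values `w`. -/
def boundaryInt (U : Set (Euc N)) (g w : Euc N → ℝ) : ℝ :=
  ∫ x in frontier U, g x * w x ∂μHE[N - 1]

theorem boundaryTerm_eq {U : Set (Euc N)} (hU : IsOpen U) (hb : Bornology.IsBounded U)
    {g u w : Euc N → ℝ} (hw : ContinuousOn w (closure U)) (huw : w =ᵐ[volume.restrict U] u) :
    boundaryTerm U g u = boundaryInt U g w := by
  refine setIntegral_congr_fun isClosed_frontier.measurableSet fun x hx => ?_
  rw [boundaryTrace_eq hU hb hw huw (frontier_subset_closure hx)]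

section

variable {U : Set (Euc N)} {g : Euc N → ℝ}

theorem integrableOn_frontier (hb : Bornology.IsBounded U)
    (hfin : (μHE[N - 1] : Measure (Euc N)) (frontier U) < ⊤) {f : Euc N → ℝ}
    (hf : ContinuousOn f (closure U)) : IntegrableOn f (frontier U) μHE[N - 1] := by
  have hcomp : IsCompact (frontier U) :=
    (Metric.isCompact_of_isClosed_isBounded isClosed_closure hb.closure).of_isClosed_subset
      isClosed_frontier frontier_subset_closure
  have hf' := hf.mono frontier_subset_closure
  obtain ⟨C, hC⟩ := hcomp.exists_bound_of_continuousOn hf'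
  have : IsFiniteMeasure ((μHE[N - 1] : Measure (Euc N)).restrict (frontier U)) :=
    ⟨by rwa [Measure.restrict_apply_univ]⟩
  exact Integrable.of_bound (hf'.aestronglyMeasurable isClosed_frontier.measurableSet) C
    ((ae_restrict_iff' isClosed_frontier.measurableSet).2 (Eventually.of_forall hC))

/-- The boundary term is Lipschitz with respect to uniform convergence. -/
theorem exists_boundaryInt_lipschitz (hb : Bornology.IsBounded U)
    (hfin : (μHE[N - 1] : Measure (Euc N)) (frontier U) < ⊤) (hg : ContinuousOn g (closure U)) :
    ∃ C : ℝ, 0 ≤ C ∧ ∀ v w : Euc N → ℝ, ContinuousOn v (closure U) → ContinuousOn w (closure U) →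
      ∀ δ : ℝ, (∀ x ∈ closure U, |v x - w x| ≤ δ) → |boundaryInt U g v - boundaryInt U g w| ≤ C * δ := by
  have hcomp : IsCompact (closure U) :=
    Metric.isCompact_of_isClosed_isBounded isClosed_closure hb.closure
  obtain ⟨B, hB⟩ := hcomp.exists_bound_of_continuousOn hg
  refine ⟨|B| * ((μHE[N - 1] : Measure (Euc N)).real (frontier U)), by positivity,
    fun v w hv hw δ hδ => ?_⟩
  have hsub := integral_sub (integrableOn_frontier hb hfin (hg.mul hv))
    (integrableOn_frontier hb hfin (hg.mul hw))
  simp only [Pi.mul_apply] at hsub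
  rw [boundaryInt, boundaryInt, ← hsub, mul_right_comm, ← Real.norm_eq_abs]
  refine norm_setIntegral_le_of_norm_le_const hfin fun x hx => ?_
  have hx' := frontier_subset_closure hx
  rw [← mul_sub, norm_mul]
  exact mul_le_mul ((hB x hx').trans (le_abs_self B)) (hδ x hx') (norm_nonneg _) (abs_nonneg _)

theorem boundaryInt_add (hb : Bornology.IsBounded U)
    (hfin : (μHE[N - 1] : Measure (Euc N)) (frontier U) < ⊤) (hg : ContinuousOn g (closure U))
    {v w : Euc N → ℝ} (hv : ContinuousOn v (closure U)) (hw : ContinuousOn w (closure U)) :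
    boundaryInt U g (fun x => v x + w x) = boundaryInt U g v + boundaryInt U g w := by
  have hadd := integral_add
    (integrableOn_frontier hb hfin (hg.mul hv)) (integrableOn_frontier hb hfin (hg.mul hw))
  simp only [Pi.mul_apply] at hadd
  rw [boundaryInt, boundaryInt, boundaryInt, ← hadd]
  simp only [mul_add]

theorem boundaryInt_const_mul (c : ℝ) (w : Euc N → ℝ) :
    boundaryInt U g (fun x => c * w x) = c * boundaryInt U g w := by
  rw [boundaryInt, boundaryInt, ← integral_const_mul]
  congr 1
  ext x
  ring

theorem boundaryInt_const (hmean : ∫ x in frontier U, g x ∂μHE[N - 1] = 0) (c : ℝ) :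
    boundaryInt U g (fun _ => c) = 0 := by
  rw [boundaryInt, integral_mul_const, hmean, zero_mul]

theorem boundaryInt_congr {v w : Euc N → ℝ} (h : ∀ x ∈ frontier U, v x = w x) :
    boundaryInt U g v = boundaryInt U g w :=
  setIntegral_congr_fun isClosed_frontier.measurableSet fun x hx => by simp only [h x hx]

end

/-! ### Compactness and lower semicontinuity -/

/-- In a Hilbert space one can select a convergent sequence from a decreasing sequence of bounded
convex sets: almost minimal elements form a Cauchy sequence, by the parallelogram law. -/
theorem exists_tendsto_mem_of_antitone_convex {H : Type*} [NormedAddCommGroup H]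
    [InnerProductSpace ℝ H] [CompleteSpace H] {K : ℕ → Set H} (hanti : Antitone K)
    (hconv : ∀ n, Convex ℝ (K n)) (hne : ∀ n, (K n).Nonempty) {R : ℝ}
    (hR : ∀ n, ∀ x ∈ K n, ‖x‖ ≤ R) :
    ∃ y : ℕ → H, (∀ n, y n ∈ K n) ∧ ∃ x, Tendsto y atTop (𝓝 x) := by
  set d : ℕ → ℝ := fun n => sInf (norm '' K n) with hd
  have hbdd : ∀ n, BddBelow (norm '' K n) := fun n =>
    ⟨0, by rintro _ ⟨x, -, rfl⟩; exact norm_nonneg x⟩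
  have hdle : ∀ n, ∀ x ∈ K n, d n ≤ ‖x‖ := fun n x hx => csInf_le (hbdd n) (mem_image_of_mem _ hx)
  have hd0 : ∀ n, 0 ≤ d n := fun n => by
    refine le_csInf ((hne n).image _) ?_
    rintro _ ⟨x, -, rfl⟩
    exact norm_nonneg x
  have hmono : Monotone d := fun m n hmn =>
    csInf_le_csInf (hbdd m) ((hne n).image _) (image_mono (hanti hmn))
  have hdR : BddAbove (range d) := by
    refine ⟨R, ?_⟩
    rintro _ ⟨n, rfl⟩
    obtain ⟨x, hx⟩ := hne n
    exact (hdle n x hx).trans (hR n x hx)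
  have hlim : Tendsto d atTop (𝓝 (⨆ n, d n)) := tendsto_atTop_ciSup hmono hdR
  set L := ⨆ n, d n
  have hy : ∀ n, ∃ y ∈ K n, ‖y‖ < d n + 1 / (n + 1) := by
    intro n
    obtain ⟨_, ⟨y, hyK, rfl⟩, hy⟩ := exists_lt_of_csInf_lt ((hne n).image norm)
      (show sInf (norm '' K n) < d n + 1 / (n + 1) from
        lt_add_of_pos_right _ (by positivity))
    exact ⟨y, hyK, hy⟩
  choose y hyK hyn using hy
  refine ⟨y, hyK, cauchySeq_tendsto_of_complete ?_⟩
  have ha : Tendsto (fun n : ℕ => (d n + 1 / (n + 1)) ^ 2) atTop (𝓝 (L ^ 2)) := by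
    simpa using (hlim.add tendsto_one_div_add_atTop_nhds_zero_nat).pow 2
  have hb : Tendsto (fun n : ℕ => d n ^ 2) atTop (𝓝 (L ^ 2)) := hlim.pow 2
  rw [Metric.cauchySeq_iff']
  intro ε hε
  set δ := ε ^ 2 / 9 with hδ
  have hδpos : 0 < δ := by positivity
  have hev := (ha.eventually (gt_mem_nhds (show L ^ 2 < L ^ 2 + δ by linarith))).and
    (hb.eventually (lt_mem_nhds (show L ^ 2 - δ < L ^ 2 by linarith)))
  obtain ⟨m, hm⟩ := eventually_atTop.1 hev
  refine ⟨m, fun n hn => ?_⟩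
  have hpar := parallelogram_law_with_norm ℝ (y n) (y m)
  have hmid : (1 / 2 : ℝ) • y n + (1 / 2 : ℝ) • y m ∈ K m :=
    hconv m (hanti hn (hyK n)) (hyK m) (by norm_num) (by norm_num) (by norm_num)
  have h1 : d m ≤ 1 / 2 * ‖y n + y m‖ := by
    have := hdle m _ hmid
    rwa [← smul_add, norm_smul, Real.norm_of_nonneg (by norm_num)] at this
  have h2 : ‖y n‖ ^ 2 ≤ (d n + 1 / (n + 1)) ^ 2 := by gcongr; exact (hyn n).le
  have h3 : ‖y m‖ ^ 2 ≤ (d m + 1 / (m + 1)) ^ 2 := by gcongr; exact (hyn m).le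
  have h4 : d m ^ 2 ≤ (1 / 2 * ‖y n + y m‖) ^ 2 := pow_le_pow_left₀ (hd0 m) h1 2
  have h5 := (hm n hn).1
  have h6 := hm m le_rfl
  rw [dist_eq_norm]
  refine lt_of_pow_lt_pow_left₀ 2 hε.le ?_
  have h7 : ‖y n - y m‖ ^ 2 ≤ 8 * δ := by nlinarith
  calc ‖y n - y m‖ ^ 2 ≤ 8 * δ := h7
    _ < 9 * δ := by linarith
    _ = ε ^ 2 := by rw [hδ]; ring

theorem norm_smul_add_smul_rpow_le {F : Type*} [NormedAddCommGroup F] [NormedSpace ℝ F] {r : ℝ}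
    (hr : 1 ≤ r) {a b : ℝ} (ha : 0 ≤ a) (hb : 0 ≤ b) (hab : a + b = 1) (x y : F) :
    ‖a • x + b • y‖ ^ r ≤ a * ‖x‖ ^ r + b * ‖y‖ ^ r := by
  have h1 : ‖a • x + b • y‖ ≤ a * ‖x‖ + b * ‖y‖ := by
    refine (norm_add_le _ _).trans_eq ?_
    rw [norm_smul, norm_smul, Real.norm_of_nonneg ha, Real.norm_of_nonneg hb]
  calc ‖a • x + b • y‖ ^ r ≤ (a * ‖x‖ + b * ‖y‖) ^ r := by gcongr
    _ ≤ a * ‖x‖ ^ r + b * ‖y‖ ^ r := by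
      have := (convexOn_rpow hr).2 (mem_Ici.2 (norm_nonneg x)) (mem_Ici.2 (norm_nonneg y)) ha hb hab
      simpa using this

/-- The integrals `∫_U a ‖G‖^r`, with a weight `a` and a variable exponent `r`. -/
def modular (U : Set (Euc N)) (a r : Euc N → ℝ) (G : Euc N → Euc N) : ℝ≥0∞ :=
  ∫⁻ x in U, ENNReal.ofReal (a x * ‖G x‖ ^ r x)

theorem modular_congr {U : Set (Euc N)} (a r : Euc N → ℝ) {G H : Euc N → Euc N}
    (h : G =ᵐ[volume.restrict U] H) : modular U a r G = modular U a r H :=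
  lintegral_congr_ae (h.mono fun x hx => by simp only [hx])

theorem modular_convex {U : Set (Euc N)} (hU : MeasurableSet U) {a r : Euc N → ℝ}
    (ha : AEMeasurable a (volume.restrict U))
    (hr : AEMeasurable r (volume.restrict U))
    (ha0 : ∀ x ∈ U, 0 ≤ a x) (hr1 : ∀ x ∈ U, 1 ≤ r x) {G H : Euc N → Euc N}
    (hG : AEStronglyMeasurable G (volume.restrict U)) {s t : ℝ} (hs : 0 ≤ s) (ht : 0 ≤ t)
    (hst : s + t = 1) :
    modular U a r (fun x => s • G x + t • H x) ≤
      ENNReal.ofReal s * modular U a r G + ENNReal.ofReal t * modular U a r H := by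
  have hm : AEMeasurable (fun x => ENNReal.ofReal s * ENNReal.ofReal (a x * ‖G x‖ ^ r x))
      (volume.restrict U) := by
    refine AEMeasurable.const_mul (AEMeasurable.ennreal_ofReal ?_) _
    exact ha.mul (hG.norm.aemeasurable.pow hr)
  unfold modular
  rw [← lintegral_const_mul' _ _ ENNReal.ofReal_ne_top,
    ← lintegral_const_mul' _ _ ENNReal.ofReal_ne_top, ← lintegral_add_left' hm]
  refine setLIntegral_mono' hU fun x hx => ?_
  have h0 := ha0 x hx
  rw [← ENNReal.ofReal_mul hs, ← ENNReal.ofReal_mul ht, ← ENNReal.ofReal_add (by positivity)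
    (by positivity)]
  refine ENNReal.ofReal_le_ofReal ?_
  have := mul_le_mul_of_nonneg_left (norm_smul_add_smul_rpow_le (hr1 x hx) hs ht hst (G x) (H x)) h0
  linarith

/-- Lower semicontinuity: if `u n → u` uniformly and the weak gradients are bounded in `L²`, then
`u` has a weak gradient, and bounds for convex integral functionals of the gradients pass to the
limit. Convex combinations of the gradients converge strongly in `L²`, so Fatou's lemma applies. -/
theorem exists_weakGradient_of_tendsto {U : Set (Euc N)} (hU : IsOpen U)
    (hb : Bornology.IsBounded U) {un : ℕ → Euc N → ℝ} {Gn : ℕ → Euc N → Euc N} {u : Euc N → ℝ}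
    (h : ∀ n, HasWeakGradient U (un n) (Gn n)) (hu : IntegrableOn u U)
    (hL2 : ∃ R : NNReal, ∀ n, eLpNorm (Gn n) 2 (volume.restrict U) ≤ R)
    (hunif : ∀ δ > 0, ∀ᶠ n in atTop, ∀ᵐ x ∂volume.restrict U, |un n x - u x| ≤ δ)
    {a r : Euc N → ℝ} (ha : AEMeasurable a (volume.restrict U))
    (hr : AEMeasurable r (volume.restrict U)) (ha0 : ∀ x ∈ U, 0 ≤ a x)
    (hr1 : ∀ x ∈ U, 1 ≤ r x) {c : ℝ≥0∞} (hc : ∀ n, modular U a r (Gn n) ≤ c) :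
    ∃ G, HasWeakGradient U u G ∧ modular U a r G ≤ c := by
  obtain ⟨R, hR⟩ := hL2
  set μ := volume.restrict U with hμ
  have : IsFiniteMeasure μ := ⟨by
    rw [hμ, Measure.restrict_apply_univ]; exact hb.measure_lt_top⟩
  set K : ℕ → Set (Lp (Euc N) 2 μ) := fun n => {f | ‖f‖ ≤ R ∧ modular U a r f ≤ c ∧
    ∃ v, HasWeakGradient U v f ∧ ∀ᵐ x ∂μ, |v x - u x| ≤ 1 / (n + 1)} with hK
  have hanti : Antitone K := by
    rintro m n hmn f ⟨h1, h2, v, h3, h4⟩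
    refine ⟨h1, h2, v, h3, h4.mono fun x hx => hx.trans ?_⟩
    exact one_div_le_one_div_of_le (by positivity) (by gcongr)
  have hconv : ∀ n, Convex ℝ (K n) := by
    rintro n f ⟨h1, h2, v, h3, h4⟩ f' ⟨h1', h2', v', h3', h4'⟩ s t hs ht hst
    have hcoe : ⇑(s • f + t • f') =ᵐ[μ] fun x => s • f x + t • f' x := by
      filter_upwards [Lp.coeFn_add (s • f) (t • f'), Lp.coeFn_smul s f, Lp.coeFn_smul t f']
        with x e1 e2 e3
      rw [e1, Pi.add_apply, e2, e3, Pi.smul_apply, Pi.smul_apply]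
    refine ⟨?_, ?_, fun x => s * v x + t * v' x, ?_, ?_⟩
    · refine (norm_add_le _ _).trans ?_
      rw [norm_smul, norm_smul, Real.norm_of_nonneg hs, Real.norm_of_nonneg ht]
      calc s * ‖f‖ + t * ‖f'‖ ≤ s * R + t * R := by gcongr
        _ = R := by rw [← add_mul, hst, one_mul]
    · rw [modular_congr a r hcoe]
      refine (modular_convex hU.measurableSet ha hr ha0 hr1 (Lp.aestronglyMeasurable f)
        hs ht hst).trans ?_
      calc _ ≤ ENNReal.ofReal s * c + ENNReal.ofReal t * c := by gcongr
        _ = c := by rw [← add_mul, ← ENNReal.ofReal_add hs ht, hst, ENNReal.ofReal_one, one_mul]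
    · exact ((h3.const_smul s).add (h3'.const_smul t)).congr (ae_eq_refl _) hcoe.symm
    · filter_upwards [h4, h4'] with x hx hx'
      have e : s * v x + t * v' x - u x = s * (v x - u x) + t * (v' x - u x) := by
        linear_combination u x * hst
      rw [e]
      refine (abs_add_le _ _).trans ?_
      rw [abs_mul, abs_mul, abs_of_nonneg hs, abs_of_nonneg ht]
      calc _ ≤ s * (1 / ((n : ℝ) + 1)) + t * (1 / ((n : ℝ) + 1)) := by gcongr
        _ = _ := by rw [← add_mul, hst, one_mul]
  have hmem : ∀ n, MemLp (Gn n) 2 μ := fun n =>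
    ⟨(h n).2.1.aestronglyMeasurable, (hR n).trans_lt ENNReal.coe_lt_top⟩
  have hne : ∀ n, (K n).Nonempty := by
    intro n
    obtain ⟨m, hm⟩ := (hunif (1 / (n + 1)) (by positivity)).exists
    refine ⟨(hmem m).toLp, ?_, ?_, un m, ?_, hm⟩
    · rw [Lp.norm_toLp]
      exact ENNReal.toReal_le_coe_of_le_coe (hR m)
    · rw [modular_congr a r (hmem m).coeFn_toLp]
      exact hc m
    · exact (h m).congr (ae_eq_refl _) (hmem m).coeFn_toLp.symm
  obtain ⟨y, hyK, G, hyG⟩ := exists_tendsto_mem_of_antitone_convex hanti hconv hne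
    (fun n f hf => hf.1)
  choose v hv hvu using fun n => (hyK n).2.2
  have hint : ∀ f : Lp (Euc N) 2 μ, IntegrableOn f U := fun f =>
    (Lp.memLp f).integrable (by norm_num)
  have hvint : ∀ n, IntegrableOn (v n) U := by
    intro n
    have hbd : Integrable (fun x => v n x - u x) μ := by
      refine Integrable.of_bound ((hv n).1.aestronglyMeasurable.sub hu.1) (1 / (n + 1)) (hvu n)
    exact (hbd.add hu).congr (Eventually.of_forall fun x => sub_add_cancel _ _)
  refine ⟨G, HasWeakGradient.of_tendsto hv hvint (fun n => hint _) hu (hint G) ?_ ?_, ?_⟩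
  · refine squeeze_zero (g := fun n : ℕ => (1 / ((n : ℝ) + 1)) * μ.real univ)
      (fun n => integral_nonneg fun x => norm_nonneg _) (fun n => ?_) ?_
    · calc ∫ x in U, ‖v n x - u x‖ ≤ ∫ _ in U, (1 / ((n : ℝ) + 1)) := by
            refine integral_mono_ae ((hvint n).sub hu).norm (integrable_const _) ?_
            exact hvu n
        _ = _ := by rw [integral_const, smul_eq_mul, mul_comm]
    · simpa using tendsto_one_div_add_atTop_nhds_zero_nat.mul_const (μ.real univ)
  · have h1 : Tendsto (fun n => ‖y n - G‖) atTop (𝓝 0) := tendsto_iff_norm_sub_tendsto_zero.1 hyG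
    have h2 : Tendsto (fun n => ‖y n - G‖ * (μ univ ^ (1 / 2 : ℝ)).toReal) atTop (𝓝 0) := by
      simpa using h1.mul_const (μ univ ^ (1 / 2 : ℝ)).toReal
    refine squeeze_zero (fun n => integral_nonneg fun x => norm_nonneg _) (fun n => ?_) h2
    have e1 : ∫ x in U, ‖y n x - G x‖ = ∫ x in U, ‖(y n - G) x‖ := by
      refine integral_congr_ae ?_
      filter_upwards [Lp.coeFn_sub (y n) G] with x hx
      rw [hx, Pi.sub_apply]
    rw [e1, integral_norm_eq_lintegral_enorm (Lp.aestronglyMeasurable _), Lp.norm_def,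
      ← ENNReal.toReal_mul, ← eLpNorm_one_eq_lintegral_enorm]
    refine ENNReal.toReal_mono ?_ ?_
    · exact ENNReal.mul_ne_top (Lp.eLpNorm_ne_top _)
        (ENNReal.rpow_ne_top_of_nonneg (by norm_num) (measure_ne_top _ _))
    · have := eLpNorm_le_eLpNorm_mul_rpow_measure_univ (μ := μ) (p := 1) (q := 2)
        (by norm_num) (Lp.aestronglyMeasurable (y n - G))
      refine this.trans_eq ?_
      norm_num
  · obtain ⟨ns, -, hns⟩ := (tendstoInMeasure_of_tendsto_Lp hyG).exists_seq_tendsto_ae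
    have hmeas : ∀ f : Lp (Euc N) 2 μ,
        AEMeasurable (fun x => ENNReal.ofReal (a x * ‖f x‖ ^ r x)) μ := fun f =>
      (ha.mul ((Lp.aestronglyMeasurable f).norm.aemeasurable.pow
        hr)).ennreal_ofReal
    calc modular U a r G = ∫⁻ x, liminf (fun i => ENNReal.ofReal (a x * ‖y (ns i) x‖ ^ r x)) atTop ∂μ := by
          refine lintegral_congr_ae ?_
          filter_upwards [hns, ae_restrict_mem hU.measurableSet] with x hx hxU
          refine (Tendsto.liminf_eq (ENNReal.tendsto_ofReal (Tendsto.const_mul _ ?_))).symm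
          exact hx.norm.rpow_const (Or.inr (by linarith [hr1 x hxU]))
      _ ≤ liminf (fun i => ∫⁻ x, ENNReal.ofReal (a x * ‖y (ns i) x‖ ^ r x) ∂μ) atTop :=
          lintegral_liminf_le' fun i => hmeas _
      _ ≤ c := by
          refine liminf_le_of_frequently_le' (Frequently.of_forall fun i => ?_)
          exact (hyK (ns i)).2.1

/-- The Arzelà–Ascoli theorem on the closure of a bounded set. -/
theorem exists_tendstoUniformlyOn_subseq {U : Set (Euc N)} (hb : Bornology.IsBounded U)
    {w : ℕ → Euc N → ℝ} {A α r₀ B : ℝ} (hr₀ : 0 < r₀) (hα : 0 < α)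
    (hw : ∀ n, ContinuousOn (w n) (closure U))
    (hholder : ∀ n, ∀ x ∈ closure U, ∀ y ∈ closure U, dist x y < r₀ →
      |w n x - w n y| ≤ A * dist x y ^ α)
    (hbdd : ∀ n, ∀ x ∈ closure U, |w n x| ≤ B) :
    ∃ (σ : ℕ → ℕ) (w' : Euc N → ℝ), StrictMono σ ∧ ContinuousOn w' (closure U) ∧
      TendstoUniformlyOn (fun n => w (σ n)) w' atTop (closure U) := by
  have hcomp : IsCompact (closure U) :=
    Metric.isCompact_of_isClosed_isBounded isClosed_closure hb.closure
  have : CompactSpace (closure U) := isCompact_iff_compactSpace.1 hcomp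
  set f : ℕ → BoundedContinuousFunction (closure U) ℝ := fun n =>
    BoundedContinuousFunction.mkOfCompact ⟨(closure U).domRestrict (w n), (hw n).domRestrict⟩ with hf
  have hequi : Equicontinuous ((↑) : range f → closure U → ℝ) := by
    intro x
    rw [Metric.equicontinuousAt_iff]
    intro ε hε
    have hcont : Tendsto (fun d : ℝ => A * d ^ α) (𝓝 0) (𝓝 (A * 0 ^ α)) :=
      ((Real.continuousAt_rpow_const 0 α (Or.inr hα.le)).tendsto).const_mul A
    rw [Real.zero_rpow hα.ne', mul_zero] at hcont
    obtain ⟨δ, hδ, h⟩ := Metric.tendsto_nhds_nhds.1 hcont ε hε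
    refine ⟨min δ r₀, lt_min hδ hr₀, ?_⟩
    rintro y hy ⟨_, n, rfl⟩
    have hd : dist (x : Euc N) y < min δ r₀ := by rwa [dist_comm] at hy
    have h1 := hholder n x x.2 y y.2 (hd.trans_le (min_le_right _ _))
    have h2 := h (x := dist (x : Euc N) y) (by
      rw [Real.dist_eq, sub_zero, abs_of_nonneg dist_nonneg]
      exact hd.trans_le (min_le_left _ _))
    rw [Real.dist_eq, sub_zero] at h2
    exact (h1.trans (le_abs_self _)).trans_lt h2
  have hK := BoundedContinuousFunction.arzela_ascoli (Icc (-B) B) isCompact_Icc (range f)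
    (by rintro _ x ⟨n, rfl⟩; exact abs_le.1 (hbdd n x x.2)) hequi
  obtain ⟨F, -, σ, hσ, hlim⟩ := hK.tendsto_subseq fun n => subset_closure (mem_range_self n)
  rw [BoundedContinuousFunction.tendsto_iff_tendstoUniformly] at hlim
  classical
  set w' : Euc N → ℝ := fun x => if hx : x ∈ closure U then F ⟨x, hx⟩ else 0 with hw'
  have hres : (closure U).domRestrict w' = F := by
    ext x
    exact dif_pos x.2
  refine ⟨σ, w', hσ, ?_, ?_⟩
  · rw [continuousOn_iff_continuous_domRestrict, hres]
    exact F.continuous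
  · rw [tendstoUniformlyOn_iff_tendstoUniformly_comp_coe]
    have : w' ∘ ((↑) : closure U → Euc N) = F := hres
    rw [this]
    exact hlim

theorem eLpNorm_two_le {U : Set (Euc N)} (hb : Bornology.IsBounded U) {q : ℝ} (hq : 2 ≤ q)
    (R : NNReal) : ∃ R' : NNReal, ∀ G : Euc N → Euc N,
      AEStronglyMeasurable G (volume.restrict U) → ∫⁻ y in U, ‖G y‖ₑ ^ q ≤ R →
      eLpNorm G 2 (volume.restrict U) ≤ R' := by
  have hfin : volume.restrict U univ ≠ ⊤ := by
    rw [Measure.restrict_apply_univ]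
    exact hb.measure_lt_top.ne
  have h1 : 1 / q ≤ 1 / 2 := one_div_le_one_div_of_le two_pos hq
  have hne : (R : ℝ≥0∞) ^ (1 / q) * volume.restrict U univ ^ (1 / 2 - 1 / q) ≠ ⊤ :=
    ENNReal.mul_ne_top (ENNReal.rpow_ne_top_of_nonneg (by positivity) ENNReal.coe_ne_top)
      (ENNReal.rpow_ne_top_of_nonneg (by linarith) hfin)
  refine ⟨((R : ℝ≥0∞) ^ (1 / q) * volume.restrict U univ ^ (1 / 2 - 1 / q)).toNNReal,
    fun G hm hG => ?_⟩
  rw [ENNReal.coe_toNNReal hne]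
  have h2 := eLpNorm'_le_eLpNorm'_mul_rpow_measure_univ (two_pos) hq hm
  rw [eLpNorm_eq_eLpNorm' two_ne_zero ENNReal.ofNat_ne_top, ENNReal.toReal_ofNat]
  refine h2.trans ?_
  gcongr
  unfold eLpNorm'
  gcongr

/-- Compactness: functions with equi-Hölder continuous representatives and weak gradients bounded in
`L^q`, `q ≥ 2`, converge uniformly along a subsequence. The limit has a weak gradient, and convex
integral functionals of the gradients are lower semicontinuous along the subsequence. -/
theorem exists_uniform_limit {U : Set (Euc N)} (hU : IsOpen U) (hb : Bornology.IsBounded U)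
    {q : ℝ} (hq : 2 ≤ q) {w : ℕ → Euc N → ℝ} {G : ℕ → Euc N → Euc N} {A α r₀ B : ℝ}
    (hr₀ : 0 < r₀) (hα : 0 < α) (hw : ∀ n, ContinuousOn (w n) (closure U))
    (hG : ∀ n, HasWeakGradient U (w n) (G n))
    (hholder : ∀ n, ∀ x ∈ closure U, ∀ y ∈ closure U, dist x y < r₀ →
      |w n x - w n y| ≤ A * dist x y ^ α)
    (hbdd : ∀ n, ∀ x ∈ closure U, |w n x| ≤ B)
    {R : NNReal} (hR : ∀ n, ∫⁻ y in U, ‖G n y‖ₑ ^ q ≤ R) :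
    ∃ (σ : ℕ → ℕ) (w' : Euc N → ℝ), StrictMono σ ∧ ContinuousOn w' (closure U) ∧
      TendstoUniformlyOn (fun n => w (σ n)) w' atTop (closure U) ∧
      (∃ G', HasWeakGradient U w' G') ∧
      ∀ a r : Euc N → ℝ, AEMeasurable a (volume.restrict U) → AEMeasurable r (volume.restrict U) →
        (∀ x ∈ U, 0 ≤ a x) → (∀ x ∈ U, 1 ≤ r x) → ∀ c : ℝ≥0∞,
        (∀ᶠ n in atTop, modular U a r (G (σ n)) ≤ c) → modular U a r (weakGrad U w') ≤ c := by
  obtain ⟨σ, w', hσ, hw', hlim⟩ := exists_tendstoUniformlyOn_subseq hb hr₀ hα hw hholder hbdd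
  obtain ⟨R', hR'⟩ := eLpNorm_two_le hb hq R
  have hw'i := integrableOn_of_continuousOn_closure hb hw'
  have key : ∀ a r : Euc N → ℝ, AEMeasurable a (volume.restrict U) →
      AEMeasurable r (volume.restrict U) →
        (∀ x ∈ U, 0 ≤ a x) → (∀ x ∈ U, 1 ≤ r x) → ∀ c : ℝ≥0∞,
        (∀ᶠ n in atTop, modular U a r (G (σ n)) ≤ c) →
        ∃ G', HasWeakGradient U w' G' ∧ modular U a r G' ≤ c := by
    intro a r ha hr ha0 hr1 c hc
    obtain ⟨n₀, hn₀⟩ := eventually_atTop.1 hc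
    refine exists_weakGradient_of_tendsto hU hb (un := fun n => w (σ (n + n₀)))
      (Gn := fun n => G (σ (n + n₀))) (fun n => hG _) hw'i
      ⟨R', fun n => hR' _ (hG _).2.1.aestronglyMeasurable (hR _)⟩ ?_ ha hr ha0 hr1
      (fun n => hn₀ _ (Nat.le_add_left _ _))
    intro δ hδ
    have h1 := (tendsto_add_atTop_nat n₀).eventually (Metric.tendstoUniformlyOn_iff.1 hlim δ hδ)
    filter_upwards [h1] with n hn
    filter_upwards [ae_restrict_mem hU.measurableSet] with x hx
    have := hn x (subset_closure hx)
    rw [dist_comm, Real.dist_eq] at this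
    exact this.le
  refine ⟨σ, w', hσ, hw', hlim, ?_, ?_⟩
  · obtain ⟨G', hG', -⟩ := key 0 1 measurable_const.aemeasurable
      measurable_const.aemeasurable (fun _ _ => le_rfl) (fun _ _ => le_rfl) ⊤
      (Eventually.of_forall fun n => le_top)
    exact ⟨G', hG'⟩
  · intro a r ha hr ha0 hr1 c hc
    obtain ⟨G', hG', hle⟩ := key a r ha hr ha0 hr1 c hc
    rwa [modular_congr a r (weakGrad_ae_eq hU hG')]

/-- A continuous function of mean zero is bounded by its oscillation. -/
theorem abs_le_of_osc_of_integral_eq_zero {U : Set (Euc N)} (hU : IsOpen U) (hne : U.Nonempty)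
    (hb : Bornology.IsBounded U) {w : Euc N → ℝ} (hw : ContinuousOn w (closure U))
    (hmean : ∫ x in U, w x = 0) {B : ℝ}
    (hosc : ∀ x ∈ closure U, ∀ y ∈ closure U, |w x - w y| ≤ B) :
    ∀ x ∈ closure U, |w x| ≤ B := by
  intro x hx
  have hmem := (convex_closedBall (w x) B).set_average_mem (μ := volume)
    (t := U) (f := w) Metric.isClosed_closedBall (hU.measure_pos volume hne).ne'
    hb.measure_lt_top.ne ?_ (integrableOn_of_continuousOn_closure hb hw)
  · rw [setAverage_eq, hmean, smul_zero, Metric.mem_closedBall, dist_comm, Real.dist_eq,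
      sub_zero] at hmem
    exact hmem
  · filter_upwards [ae_restrict_mem hU.measurableSet] with y hy
    exact hosc y (subset_closure hy) x hx

/-! ### Elementary inequalities -/

/-- Bernoulli's inequality, applied to `t ^ m` with exponent `k / m`. -/
theorem rpow_div_le_rpow_div_add {t m k : ℝ} (ht : 0 ≤ t) (hm : 0 < m) (hmk : m ≤ k) :
    t ^ m / m ≤ t ^ k / k + 1 / m := by
  have hk : 0 < k := hm.trans_le hmk
  have h1 : 1 ≤ k / m := (one_le_div hm).2 hmk
  have hs : 0 ≤ t ^ m := Real.rpow_nonneg ht m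
  have h2 := one_add_mul_self_le_rpow_one_add (s := t ^ m - 1) (by linarith) h1
  rw [add_sub_cancel, ← Real.rpow_mul ht, mul_div_cancel₀ _ hm.ne'] at h2
  have h3 : (1 + k / m * (t ^ m - 1)) / k ≤ t ^ k / k := by gcongr
  have h4 : (1 + k / m * (t ^ m - 1)) / k = 1 / k + t ^ m / m - 1 / m := by
    field_simp
    ring
  have h5 : 0 < 1 / k := by positivity
  linarith

theorem le_of_sq_le_add_mul {X a b : ℝ} (ha : 0 ≤ a) (hb : 0 ≤ b) (h : X ^ 2 ≤ a + b * X) :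
    X ≤ a + b + 1 := by
  by_contra! hlt
  nlinarith

/-! ### Variable exponent integrals -/

theorem memVarLp_of_modular {F : Type*} [NormedAddCommGroup F] {U : Set (Euc N)} {r : Euc N → ℝ}
    {f : Euc N → F} (hf : AEStronglyMeasurable f (volume.restrict U))
    (h : ∫⁻ x in U, ENNReal.ofReal (‖f x‖ ^ r x) < ⊤) : MemVarLp U r f :=
  ⟨hf, 1, one_pos, by simpa using h⟩

theorem MemVarLp.lintegral_lt_top {F : Type*} [NormedAddCommGroup F] {U : Set (Euc N)}
    (hU : MeasurableSet U) {r : Euc N → ℝ} {f : Euc N → F} (h : MemVarLp U r f) {k : ℝ}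
    (h0 : ∀ x ∈ U, 0 ≤ r x) (hk : ∀ x ∈ U, r x ≤ k) :
    ∫⁻ x in U, ENNReal.ofReal (‖f x‖ ^ r x) < ⊤ := by
  obtain ⟨hm, c, hc, hfin⟩ := h
  set M := max 1 (c⁻¹ ^ k) with hM
  have hle : ∀ x ∈ U, ENNReal.ofReal (‖f x‖ ^ r x) ≤
      ENNReal.ofReal M * ENNReal.ofReal ((c * ‖f x‖) ^ r x) := by
    intro x hx
    rw [← ENNReal.ofReal_mul (by positivity)]
    refine ENNReal.ofReal_le_ofReal ?_
    have e : ‖f x‖ ^ r x = c⁻¹ ^ r x * (c * ‖f x‖) ^ r x := by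
      rw [← Real.mul_rpow (by positivity) (by positivity), inv_mul_cancel_left₀ hc.ne']
    rw [e]
    gcongr
    rcases le_total c⁻¹ 1 with h1 | h1
    · exact (Real.rpow_le_one (by positivity) h1 (h0 x hx)).trans (le_max_left _ _)
    · exact (Real.rpow_le_rpow_of_exponent_le h1 (hk x hx)).trans (le_max_right _ _)
  refine (setLIntegral_mono' hU hle).trans_lt ?_
  rw [lintegral_const_mul' _ _ ENNReal.ofReal_ne_top]
  exact ENNReal.mul_lt_top ENNReal.ofReal_lt_top hfin

theorem memVarLp_of_bounded {U : Set (Euc N)} (hU : MeasurableSet U)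
    (hb : Bornology.IsBounded U) {r : Euc N → ℝ} (h0 : ∀ x ∈ U, 0 ≤ r x) {f : Euc N → ℝ}
    (hm : AEStronglyMeasurable f (volume.restrict U)) {B : ℝ}
    (hB : ∀ᵐ x ∂volume.restrict U, |f x| ≤ B) : MemVarLp U r f := by
  refine ⟨hm, (|B| + 1)⁻¹, by positivity, ?_⟩
  calc ∫⁻ x in U, ENNReal.ofReal (((|B| + 1)⁻¹ * ‖f x‖) ^ r x) ≤ ∫⁻ _ in U, 1 := by
        refine lintegral_mono_ae ?_
        filter_upwards [hB, ae_restrict_mem hU] with x hx hxU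
        rw [← ENNReal.ofReal_one]
        refine ENNReal.ofReal_le_ofReal (Real.rpow_le_one (by positivity) ?_ (h0 x hxU))
        rw [inv_mul_le_iff₀ (by positivity), mul_one, Real.norm_eq_abs]
        linarith [le_abs_self B]
    _ < ⊤ := by simpa using hb.measure_lt_top

theorem memVarSobolev_of_continuousOn {U V : Set (Euc N)} (hU : IsOpen U) (hVU : U ⊆ V)
    (hb : Bornology.IsBounded V) {r : Euc N → ℝ} (h0 : ∀ x ∈ U, 0 ≤ r x) {w : Euc N → ℝ}
    (hw : ContinuousOn w (closure V)) {G : Euc N → Euc N}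
    (hG : HasWeakGradient U w G) (hmod : ∫⁻ x in U, ENNReal.ofReal (‖G x‖ ^ r x) < ⊤) :
    MemVarSobolev U r w := by
  obtain ⟨B, hB⟩ := (Metric.isCompact_of_isClosed_isBounded isClosed_closure
    hb.closure).exists_bound_of_continuousOn hw
  have hae := weakGrad_ae_eq hU hG
  refine ⟨⟨G, hG⟩, ?_, ?_⟩
  · refine memVarLp_of_bounded hU.measurableSet (hb.subset hVU) h0 hG.1.aestronglyMeasurable
      (B := B) ?_
    filter_upwards [ae_restrict_mem hU.measurableSet] with x hx
    exact hB x (subset_closure (hVU hx))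
  · refine memVarLp_of_modular (weakGrad_spec ⟨G, hG⟩).2.1.aestronglyMeasurable ?_
    have e : ∫⁻ x in U, ENNReal.ofReal (‖weakGrad U w x‖ ^ r x) =
        ∫⁻ x in U, ENNReal.ofReal (‖G x‖ ^ r x) :=
      lintegral_congr_ae (hae.mono fun x hx => by simp only [hx])
    rwa [e]

theorem setIntegral_rpow_div_eq_modular {U : Set (Euc N)} (hU : MeasurableSet U) {r : Euc N → ℝ}
    (hr : AEMeasurable r (volume.restrict U)) (h0 : ∀ x ∈ U, 0 ≤ r x) {G : Euc N → Euc N}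
    (hG : AEStronglyMeasurable G (volume.restrict U)) :
    ∫ x in U, ‖G x‖ ^ r x / r x = (modular U (fun x => 1 / r x) r G).toReal := by
  rw [integral_eq_lintegral_of_nonneg_ae]
  · simp only [modular, div_mul_eq_mul_div, one_mul]
  · filter_upwards [ae_restrict_mem hU] with x hx
    have := h0 x hx
    simp only [Pi.zero_apply]
    positivity
  · exact ((hG.norm.aemeasurable.pow hr).div hr).aestronglyMeasurable

/-! ### The variational setting -/

/-- The hypotheses on the domains `Ω` and `D`, the exponent `p` and the boundary datum `g`. -/
structure IsVariationalSetting (Ω D : Set (Euc N)) (p : Euc N → ℝ≥0∞) (g : Euc N → ℝ) : Prop where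
  two_le : 2 ≤ N
  isOpen : IsOpen Ω
  isConnected : IsConnected Ω
  isBounded : Bornology.IsBounded Ω
  boundary : HasLocallyLipschitzBoundary Ω
  isOpen_D : IsOpen D
  boundary_D : HasLocallyLipschitzBoundary D
  closure_D_subset : closure D ⊆ Ω
  continuousOn_g : ContinuousOn g (closure Ω)
  integral_g : ∫ x in frontier Ω, g x ∂μHE[N - 1] = 0
  eq_top : ∀ x ∈ D, p x = ⊤
  continuousOn_p : ContinuousOn (fun x => (p x).toReal) (closure Ω \ D)
  pPlus_lt_top : pPlus Ω D p < ⊤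
  lt_pMinus : (N : ℝ≥0∞) < pMinus Ω p

/-- The modular `∫_Ω ‖G‖^{p_k} / p_k`. -/
def gradEnergy (Ω : Set (Euc N)) (p : Euc N → ℝ≥0∞) (k : ℕ) (G : Euc N → Euc N) : ℝ≥0∞ :=
  modular Ω (fun x => 1 / pTrunc p k x) (pTrunc p k) G

namespace IsVariationalSetting

variable {Ω D : Set (Euc N)} {p : Euc N → ℝ≥0∞} {g : Euc N → ℝ}

theorem nonempty_diff (S : IsVariationalSetting Ω D p g) : (Ω \ closure D).Nonempty := by
  by_contra hne
  rw [not_nonempty_iff_eq_empty, sdiff_eq_empty] at hne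
  have heq : Ω = closure D := hne.antisymm S.closure_D_subset
  have hclopen : IsClopen Ω := ⟨by rw [heq]; exact isClosed_closure, S.isOpen⟩
  have : Nontrivial (Euc N) := by
    have : Nonempty (Fin N) := ⟨⟨0, by have := S.two_le; omega⟩⟩
    infer_instance
  rcases isClopen_iff.1 hclopen with h | h
  · exact S.isConnected.nonempty.ne_empty h
  · have hb := S.isBounded
    rw [h] at hb
    exact NormedSpace.unbounded_univ ℝ (Euc N) hb

theorem isOpen_diff (S : IsVariationalSetting Ω D p g) : IsOpen (Ω \ closure D) :=
  S.isOpen.sdiff isClosed_closure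

theorem D_subset (S : IsVariationalSetting Ω D p g) : D ⊆ Ω :=
  subset_closure.trans S.closure_D_subset

theorem pMinus_le (_S : IsVariationalSetting Ω D p g) {x : Euc N} (hx : x ∈ closure Ω) :
    pMinus Ω p ≤ p x :=
  iInf₂_le x hx

theorem le_pPlus (_S : IsVariationalSetting Ω D p g) {x : Euc N} (hx : x ∈ Ω \ closure D) :
    p x ≤ pPlus Ω D p :=
  le_iSup₂ (f := fun x (_ : x ∈ closure Ω \ closure D) => p x) x ⟨subset_closure hx.1, hx.2⟩

theorem pMinus_le_pPlus (S : IsVariationalSetting Ω D p g) : pMinus Ω p ≤ pPlus Ω D p := by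
  obtain ⟨x, hx⟩ := S.nonempty_diff
  exact (S.pMinus_le (subset_closure hx.1)).trans (S.le_pPlus hx)

theorem pMinus_ne_top (S : IsVariationalSetting Ω D p g) : pMinus Ω p ≠ ⊤ :=
  (S.pMinus_le_pPlus.trans_lt S.pPlus_lt_top).ne

theorem lt_q (S : IsVariationalSetting Ω D p g) : (N : ℝ) < (pMinus Ω p).toReal := by
  have := (ENNReal.toReal_lt_toReal (ENNReal.natCast_ne_top N) S.pMinus_ne_top).2 S.lt_pMinus
  simpa using this

theorem two_le_q (S : IsVariationalSetting Ω D p g) : 2 ≤ (pMinus Ω p).toReal := by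
  have h1 : (2 : ℝ) ≤ N := by exact_mod_cast S.two_le
  linarith [S.lt_q]

theorem ae_mem (S : IsVariationalSetting Ω D p g) :
    ∀ᵐ x ∂volume.restrict Ω, x ∈ D ∨ x ∈ Ω \ closure D := by
  have h0 : ∀ᵐ x ∂(volume : Measure (Euc N)), x ∉ frontier D :=
    measure_eq_zero_iff_ae_notMem.1 (S.boundary_D.volume_frontier S.isOpen_D)
  filter_upwards [ae_restrict_of_ae h0, ae_restrict_mem S.isOpen.measurableSet] with x hx hxΩ
  by_cases hxD : x ∈ D
  · exact Or.inl hxD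
  · refine Or.inr ⟨hxΩ, fun hcl => hx ⟨hcl, ?_⟩⟩
    rwa [S.isOpen_D.interior_eq]

section Exponent

variable {k : ℕ}

theorem q_le_pTrunc (S : IsVariationalSetting Ω D p g) (hk : pPlus Ω D p < k) {x : Euc N}
    (hx : x ∈ Ω) : (pMinus Ω p).toReal ≤ pTrunc p k x := by
  refine ENNReal.toReal_mono (ne_top_of_le_ne_top (ENNReal.natCast_ne_top k) (min_le_right _ _))
    (le_min (S.pMinus_le (subset_closure hx)) ?_)
  exact S.pMinus_le_pPlus.trans hk.le

theorem pTrunc_le (p : Euc N → ℝ≥0∞) (k : ℕ) (x : Euc N) : pTrunc p k x ≤ k := by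
  have := ENNReal.toReal_mono (ENNReal.natCast_ne_top k) (min_le_right (p x) (k : ℝ≥0∞))
  simpa [pTrunc] using this

theorem one_le_pTrunc (S : IsVariationalSetting Ω D p g) (hk : pPlus Ω D p < k) {x : Euc N}
    (hx : x ∈ Ω) : 1 ≤ pTrunc p k x := by
  linarith [S.q_le_pTrunc hk hx, S.two_le_q]

theorem q_le_k (S : IsVariationalSetting Ω D p g) (hk : pPlus Ω D p < k) :
    (pMinus Ω p).toReal ≤ k := by
  obtain ⟨x, hx⟩ := S.nonempty_diff
  exact (S.q_le_pTrunc hk hx.1).trans (pTrunc_le p k x)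

theorem pTrunc_of_mem_D (S : IsVariationalSetting Ω D p g) {x : Euc N} (hx : x ∈ D) :
    pTrunc p k x = k := by
  simp [pTrunc, S.eq_top x hx]

theorem pTrunc_of_mem_diff (S : IsVariationalSetting Ω D p g) (hk : pPlus Ω D p < k) {x : Euc N}
    (hx : x ∈ Ω \ closure D) : pTrunc p k x = (p x).toReal := by
  rw [pTrunc, min_eq_left ((S.le_pPlus hx).trans hk.le)]

theorem q_le_p (S : IsVariationalSetting Ω D p g) {x : Euc N} (hx : x ∈ Ω \ closure D) :
    (pMinus Ω p).toReal ≤ (p x).toReal :=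
  ENNReal.toReal_mono ((S.le_pPlus hx).trans_lt S.pPlus_lt_top).ne
    (S.pMinus_le (subset_closure hx.1))

theorem p_le (S : IsVariationalSetting Ω D p g) {x : Euc N} (hx : x ∈ Ω \ closure D) :
    (p x).toReal ≤ (pPlus Ω D p).toReal :=
  ENNReal.toReal_mono S.pPlus_lt_top.ne (S.le_pPlus hx)

theorem aemeasurable_p (S : IsVariationalSetting Ω D p g) :
    AEMeasurable (fun x => (p x).toReal) (volume.restrict (Ω \ closure D)) :=
  (S.continuousOn_p.mono (sdiff_subset_sdiff subset_closure subset_closure)).aemeasurable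
    S.isOpen_diff.measurableSet

theorem restrict_eq (S : IsVariationalSetting Ω D p g) :
    volume.restrict Ω = volume.restrict (D ∪ Ω \ closure D) := by
  refine Measure.restrict_congr_set ?_
  have h := (ae_restrict_iff' S.isOpen.measurableSet).1 S.ae_mem
  filter_upwards [h] with x hx
  refine propext ⟨fun hxΩ => hx hxΩ, ?_⟩
  rintro (h1 | h1)
  · exact S.D_subset h1
  · exact h1.1

theorem aemeasurable_pTrunc (S : IsVariationalSetting Ω D p g) (hk : pPlus Ω D p < k) :
    AEMeasurable (pTrunc p k) (volume.restrict Ω) := by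
  rw [S.restrict_eq, aemeasurable_union_iff]
  constructor
  · refine AEMeasurable.congr (f := fun _ => (k : ℝ)) aemeasurable_const ?_
    filter_upwards [ae_restrict_mem S.isOpen_D.measurableSet] with x hx
    exact (S.pTrunc_of_mem_D hx).symm
  · refine S.aemeasurable_p.congr ?_
    filter_upwards [ae_restrict_mem S.isOpen_diff.measurableSet] with x hx
    exact (S.pTrunc_of_mem_diff hk hx).symm

theorem setIntegral_eq_gradEnergy (S : IsVariationalSetting Ω D p g) (hk : pPlus Ω D p < k)
    {G : Euc N → Euc N} (hG : AEStronglyMeasurable G (volume.restrict Ω)) :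
    ∫ x in Ω, ‖G x‖ ^ pTrunc p k x / pTrunc p k x = (gradEnergy Ω p k G).toReal :=
  setIntegral_rpow_div_eq_modular S.isOpen.measurableSet (S.aemeasurable_pTrunc hk)
    (fun _ hx => zero_le_one.trans (S.one_le_pTrunc hk hx)) hG

theorem gradEnergy_lt_top_iff (S : IsVariationalSetting Ω D p g) (hk : pPlus Ω D p < k)
    (G : Euc N → Euc N) : gradEnergy Ω p k G < ⊤ ↔
      ∫⁻ x in Ω, ENNReal.ofReal (‖G x‖ ^ pTrunc p k x) < ⊤ := by
  have hk0 : (0 : ℝ) < k := by linarith [S.q_le_k hk, S.two_le_q]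
  constructor
  · intro h
    have hle : ∀ x ∈ Ω, ENNReal.ofReal (‖G x‖ ^ pTrunc p k x) ≤
        ENNReal.ofReal k * ENNReal.ofReal (1 / pTrunc p k x * ‖G x‖ ^ pTrunc p k x) := by
      intro x hx
      have h1 := S.one_le_pTrunc hk hx
      rw [← ENNReal.ofReal_mul hk0.le, ← mul_assoc]
      refine ENNReal.ofReal_le_ofReal (le_mul_of_one_le_left (by positivity) ?_)
      rw [mul_one_div]
      exact (one_le_div (by linarith)).2 (pTrunc_le p k x)
    refine (setLIntegral_mono' S.isOpen.measurableSet hle).trans_lt ?_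
    rw [lintegral_const_mul' _ _ ENNReal.ofReal_ne_top]
    exact ENNReal.mul_lt_top ENNReal.ofReal_lt_top h
  · intro h
    refine (setLIntegral_mono' S.isOpen.measurableSet fun x hx => ?_).trans_lt h
    have h1 := S.one_le_pTrunc hk hx
    refine ENNReal.ofReal_le_ofReal (mul_le_of_le_one_left (by positivity) ?_)
    exact (div_le_one (by linarith)).2 h1

/-- The energy controls the `L^{p_-}` norm of the gradient, uniformly in `k`. -/
theorem lintegral_rpow_le_gradEnergy (S : IsVariationalSetting Ω D p g) (hk : pPlus Ω D p < k)
    (G : Euc N → Euc N) : ∫⁻ x in Ω, ‖G x‖ₑ ^ (pMinus Ω p).toReal ≤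
      ENNReal.ofReal (pMinus Ω p).toReal * gradEnergy Ω p k G + volume Ω := by
  set q := (pMinus Ω p).toReal with hq
  have hq2 : 2 ≤ q := S.two_le_q
  have hle : ∀ x ∈ Ω, ‖G x‖ₑ ^ q ≤
      ENNReal.ofReal q * ENNReal.ofReal (1 / pTrunc p k x * ‖G x‖ ^ pTrunc p k x) + 1 := by
    intro x hx
    have h1 := S.one_le_pTrunc hk hx
    rw [← ofReal_norm, ENNReal.ofReal_rpow_of_nonneg (norm_nonneg _) (by linarith),
      ← ENNReal.ofReal_mul (by linarith), ← ENNReal.ofReal_one,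
      ← ENNReal.ofReal_add (by positivity) zero_le_one]
    refine ENNReal.ofReal_le_ofReal ?_
    have h2 := rpow_div_le_rpow_div_add (norm_nonneg (G x)) (show 0 < q by linarith)
      (S.q_le_pTrunc hk hx)
    rw [div_add' _ _ _ (by linarith), div_le_div_iff₀ (by linarith) (by linarith)] at h2
    have h3 : (0 : ℝ) < pTrunc p k x := by linarith
    have h4 : ‖G x‖ ^ q ≤ (‖G x‖ ^ pTrunc p k x + 1 / q * pTrunc p k x) * q / pTrunc p k x := by
      rw [le_div_iff₀ h3]
      exact h2
    refine h4.trans_eq ?_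
    field_simp
  refine (setLIntegral_mono' S.isOpen.measurableSet hle).trans ?_
  rw [lintegral_add_right _ measurable_const, lintegral_const_mul' _ _ ENNReal.ofReal_ne_top]
  simp [gradEnergy, modular]

theorem lintegral_rpow_lt_top (S : IsVariationalSetting Ω D p g) (hk : pPlus Ω D p < k)
    {G : Euc N → Euc N} (hG : gradEnergy Ω p k G < ⊤) :
    ∫⁻ x in Ω, ‖G x‖ₑ ^ (pMinus Ω p).toReal < ⊤ :=
  (S.lintegral_rpow_le_gradEnergy hk G).trans_lt (ENNReal.add_lt_top.2
    ⟨ENNReal.mul_lt_top ENNReal.ofReal_lt_top hG, S.isBounded.measure_lt_top⟩)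

theorem sq_lqNorm_le (S : IsVariationalSetting Ω D p g) (hk : pPlus Ω D p < k)
    {G : Euc N → Euc N} (hG : gradEnergy Ω p k G < ⊤) :
    lqNorm Ω (pMinus Ω p).toReal G ^ 2 ≤
      (pMinus Ω p).toReal * (gradEnergy Ω p k G).toReal + (volume Ω).toReal + 1 := by
  set q := (pMinus Ω p).toReal with hq
  have hq2 : 2 ≤ q := S.two_le_q
  set X := lqNorm Ω q G with hX
  have hX0 : 0 ≤ X := lqNorm_nonneg _ _ _
  have h1 : X ^ q ≤ q * (gradEnergy Ω p k G).toReal + (volume Ω).toReal := by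
    rw [hX, lqNorm, ENNReal.toReal_rpow, ← ENNReal.rpow_mul, one_div_mul_cancel (by linarith),
      ENNReal.rpow_one]
    have h2 := ENNReal.toReal_mono (ENNReal.add_lt_top.2
      ⟨ENNReal.mul_lt_top ENNReal.ofReal_lt_top hG, S.isBounded.measure_lt_top⟩).ne
      (S.lintegral_rpow_le_gradEnergy hk G)
    rwa [ENNReal.toReal_add (ENNReal.mul_ne_top ENNReal.ofReal_ne_top hG.ne)
      S.isBounded.measure_lt_top.ne, ENNReal.toReal_mul, ENNReal.toReal_ofReal (by linarith)] at h2
  have h3 : X ^ 2 ≤ X ^ q + 1 := by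
    rcases le_total X 1 with h | h
    · have := Real.rpow_nonneg hX0 q
      nlinarith
    · have := Real.rpow_le_rpow_of_exponent_le h hq2
      rw [Real.rpow_two] at this
      linarith
  linarith

theorem hasWeakGradient (_S : IsVariationalSetting Ω D p g) {v : Euc N → ℝ}
    (hv : v ∈ admissible Ω p k) : HasWeakGradient Ω v (weakGrad Ω v) :=
  weakGrad_spec hv.1.1

theorem gradEnergy_lt_top (S : IsVariationalSetting Ω D p g) (hk : pPlus Ω D p < k)
    {v : Euc N → ℝ} (hv : v ∈ admissible Ω p k) : gradEnergy Ω p k (weakGrad Ω v) < ⊤ :=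
  (S.gradEnergy_lt_top_iff hk _).2 (hv.1.2.2.lintegral_lt_top S.isOpen.measurableSet
    (fun _ hx => zero_le_one.trans (S.one_le_pTrunc hk hx)) (fun x _ => pTrunc_le p k x))

theorem integrableOn_of_memVarLp {U : Set (Euc N)} (hU : MeasurableSet U)
    (hb : Bornology.IsBounded U) {r : Euc N → ℝ} {f : Euc N → ℝ} (h : MemVarLp U r f) {k : ℝ}
    (h1 : ∀ x ∈ U, 1 ≤ r x) (hk : ∀ x ∈ U, r x ≤ k) : IntegrableOn f U := by
  refine ⟨h.1, ?_⟩
  have hfin := h.lintegral_lt_top hU (fun x hx => zero_le_one.trans (h1 x hx)) hk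
  calc ∫⁻ x in U, ‖f x‖ₑ ≤ ∫⁻ x in U, (ENNReal.ofReal (‖f x‖ ^ r x) + 1) := by
        refine setLIntegral_mono' hU fun x hx => ?_
        rw [← ofReal_norm, ← ENNReal.ofReal_one, ← ENNReal.ofReal_add (by positivity) zero_le_one]
        refine ENNReal.ofReal_le_ofReal ?_
        rcases le_total ‖f x‖ 1 with h | h
        · have := Real.rpow_nonneg (norm_nonneg (f x)) (r x)
          linarith
        · have := Real.rpow_le_rpow_of_exponent_le h (h1 x hx)
          rw [Real.rpow_one] at this
          linarith
    _ = (∫⁻ x in U, ENNReal.ofReal (‖f x‖ ^ r x)) + volume U := by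
        rw [lintegral_add_right _ measurable_const]
        simp
    _ < ⊤ := ENNReal.add_lt_top.2 ⟨hfin, hb.measure_lt_top⟩

theorem integrableOn (S : IsVariationalSetting Ω D p g) (hk : pPlus Ω D p < k)
    {v : Euc N → ℝ} (hv : v ∈ admissible Ω p k) : IntegrableOn v Ω :=
  integrableOn_of_memVarLp S.isOpen.measurableSet S.isBounded hv.1.2.1
    (fun _ hx => S.one_le_pTrunc hk hx) (fun x _ => pTrunc_le p k x)

theorem mem_admissible (S : IsVariationalSetting Ω D p g) (hk : pPlus Ω D p < k)
    {w : Euc N → ℝ} {G : Euc N → Euc N} (hw : ContinuousOn w (closure Ω))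
    (hG : HasWeakGradient Ω w G) (hE : gradEnergy Ω p k G < ⊤) (hmean : ∫ x in Ω, w x = 0) :
    w ∈ admissible Ω p k :=
  ⟨memVarSobolev_of_continuousOn S.isOpen subset_rfl S.isBounded
    (fun _ hx => zero_le_one.trans (S.one_le_pTrunc hk hx)) hw hG
    ((S.gradEnergy_lt_top_iff hk G).1 hE), hmean⟩

theorem energy_eq (S : IsVariationalSetting Ω D p g) (hk : pPlus Ω D p < k)
    {v w : Euc N → ℝ} {G : Euc N → Euc N} (hw : ContinuousOn w (closure Ω))
    (hwv : w =ᵐ[volume.restrict Ω] v) (hG : HasWeakGradient Ω v G) :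
    energy Ω p g k v = (gradEnergy Ω p k G).toReal - boundaryInt Ω g w := by
  rw [energy, boundaryTerm_eq S.isOpen S.isBounded hw hwv,
    S.setIntegral_eq_gradEnergy hk (weakGrad_spec ⟨G, hG⟩).2.1.aestronglyMeasurable]
  congr 2
  exact modular_congr _ _ (weakGrad_ae_eq S.isOpen hG)

end Exponent

/-- Morrey's embedding and Poincaré's inequality for mean-zero functions on `Ω`. -/
theorem exists_representative (S : IsVariationalSetting Ω D p g) :
    ∃ C r₀ α : ℝ, 0 ≤ C ∧ 0 < r₀ ∧ 0 < α ∧ ∀ (u : Euc N → ℝ) (G : Euc N → Euc N),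
      HasWeakGradient Ω u G → IntegrableOn u Ω →
      ∫⁻ y in Ω, ‖G y‖ₑ ^ (pMinus Ω p).toReal < ⊤ → ∫ x in Ω, u x = 0 →
      ∃ w : Euc N → ℝ, ContinuousOn w (closure Ω) ∧ w =ᵐ[volume.restrict Ω] u ∧
        HasWeakGradient Ω w G ∧ ∫ x in Ω, w x = 0 ∧
        (∀ x ∈ closure Ω, ∀ y ∈ closure Ω, dist x y < r₀ →
          |w x - w y| ≤ C * lqNorm Ω (pMinus Ω p).toReal G * dist x y ^ α) ∧
        ∀ x ∈ closure Ω, |w x| ≤ C * lqNorm Ω (pMinus Ω p).toReal G := by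
  obtain ⟨C, r₀, α, hC, hr₀, hα, h⟩ := exists_morrey_embedding
    (show 1 ≤ N by have := S.two_le; omega) S.lt_q S.isOpen S.isConnected S.isBounded S.boundary
  refine ⟨C, r₀, α, hC, hr₀, hα, fun u G hG hu hE hmean => ?_⟩
  obtain ⟨w, hw, hwu, hholder, hosc⟩ := h u G hG hu hE
  have hmean' : ∫ x in Ω, w x = 0 := by rw [integral_congr_ae hwu, hmean]
  exact ⟨w, hw, hwu, hG.congr hwu.symm (ae_eq_refl _), hmean', hholder,
    abs_le_of_osc_of_integral_eq_zero S.isOpen S.isConnected.nonempty S.isBounded hw hmean' hosc⟩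

theorem surface_lt_top (S : IsVariationalSetting Ω D p g) :
    (μHE[N - 1] : Measure (Euc N)) (frontier Ω) < ⊤ :=
  S.boundary.surface_frontier_lt_top S.isOpen S.isBounded

end IsVariationalSetting

/-! ### Existence and uniqueness of minimizers -/

theorem lintegral_rpow_le_of_lqNorm_le {U : Set (Euc N)} {q : ℝ} (hq : 0 < q) {G : Euc N → Euc N}
    (hG : ∫⁻ y in U, ‖G y‖ₑ ^ q < ⊤) {X : ℝ} (h : lqNorm U q G ≤ X) :
    ∫⁻ y in U, ‖G y‖ₑ ^ q ≤ ((X ^ q).toNNReal : ℝ≥0∞) := by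
  have hX : 0 ≤ X := (lqNorm_nonneg U q G).trans h
  have hfin : (∫⁻ y in U, ‖G y‖ₑ ^ q) ^ (1 / q) ≠ ⊤ :=
    ENNReal.rpow_ne_top_of_nonneg (by positivity) hG.ne
  have h1 : (∫⁻ y in U, ‖G y‖ₑ ^ q) ^ (1 / q) ≤ ENNReal.ofReal X := by
    rw [← ENNReal.ofReal_toReal hfin]
    exact ENNReal.ofReal_le_ofReal h
  have h2 := ENNReal.rpow_le_rpow h1 hq.le
  rw [← ENNReal.rpow_mul, one_div_mul_cancel hq.ne', ENNReal.rpow_one,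
    ENNReal.ofReal_rpow_of_nonneg hX hq.le] at h2
  exact h2

theorem eq_of_norm_midpoint_rpow {F : Type*} [NormedAddCommGroup F] [InnerProductSpace ℝ F] {r : ℝ}
    (hr : 1 < r) {x y : F}
    (h : (‖x‖ ^ r + ‖y‖ ^ r) / 2 ≤ ‖(1 / 2 : ℝ) • x + (1 / 2 : ℝ) • y‖ ^ r) : x = y := by
  have h1 : ‖(1 / 2 : ℝ) • x + (1 / 2 : ℝ) • y‖ ≤ 1 / 2 * ‖x‖ + 1 / 2 * ‖y‖ := by
    refine (norm_add_le _ _).trans_eq ?_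
    rw [norm_smul, norm_smul, Real.norm_of_nonneg (by norm_num)]
  have hnorm : ‖x‖ = ‖y‖ := by
    by_contra hne
    have h2 := (strictConvexOn_rpow hr).2 (mem_Ici.2 (norm_nonneg x)) (mem_Ici.2 (norm_nonneg y)) hne
      (show (0 : ℝ) < 1 / 2 by norm_num) (show (0 : ℝ) < 1 / 2 by norm_num) (by norm_num)
    simp only [smul_eq_mul] at h2
    have h3 : ‖(1 / 2 : ℝ) • x + (1 / 2 : ℝ) • y‖ ^ r ≤ (1 / 2 * ‖x‖ + 1 / 2 * ‖y‖) ^ r := by gcongr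
    linarith
  rw [← hnorm, add_self_div_two] at h
  have h4 : ‖x‖ ≤ ‖(1 / 2 : ℝ) • x + (1 / 2 : ℝ) • y‖ :=
    (Real.rpow_le_rpow_iff (norm_nonneg _) (norm_nonneg _) (by linarith)).1 h
  rw [← smul_add, norm_smul, Real.norm_of_nonneg (by norm_num)] at h4
  have h5 := parallelogram_law_with_norm ℝ x y
  rw [← hnorm] at h5
  have h6 : ‖x - y‖ = 0 := by
    have := norm_nonneg x
    have := norm_nonneg (x - y)
    nlinarith
  exact sub_eq_zero.1 (norm_eq_zero.1 h6)

namespace IsVariationalSetting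

variable {Ω D : Set (Euc N)} {p : Euc N → ℝ≥0∞} {g : Euc N → ℝ}

theorem tendsto_boundaryInt (S : IsVariationalSetting Ω D p g) {w : ℕ → Euc N → ℝ}
    {w' : Euc N → ℝ} (hw : ∀ n, ContinuousOn (w n) (closure Ω)) (hw' : ContinuousOn w' (closure Ω))
    (hlim : TendstoUniformlyOn w w' atTop (closure Ω)) :
    Tendsto (fun n => boundaryInt Ω g (w n)) atTop (𝓝 (boundaryInt Ω g w')) := by
  obtain ⟨C, hC, hlip⟩ :=
    exists_boundaryInt_lipschitz S.isBounded S.surface_lt_top S.continuousOn_g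
  rw [Metric.tendsto_nhds]
  intro ε hε
  filter_upwards [Metric.tendstoUniformlyOn_iff.1 hlim (ε / (C + 1)) (by positivity)] with n hn
  rw [Real.dist_eq]
  refine (hlip _ _ (hw _) hw' (ε / (C + 1)) fun x hx => ?_).trans_lt ?_
  · have := hn x hx
    rw [dist_comm, Real.dist_eq] at this
    exact this.le
  · rw [← mul_div_assoc, div_lt_iff₀ (by positivity)]
    nlinarith

theorem integral_eq_zero_of_tendstoUniformlyOn (S : IsVariationalSetting Ω D p g)
    {w : ℕ → Euc N → ℝ} {w' : Euc N → ℝ} {B : ℝ} (hw : ∀ n, ContinuousOn (w n) (closure Ω))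
    (hmean : ∀ n, ∫ x in Ω, w n x = 0) (hB : ∀ n, ∀ x ∈ closure Ω, |w n x| ≤ B)
    (hlim : TendstoUniformlyOn w w' atTop (closure Ω)) : ∫ x in Ω, w' x = 0 := by
  have hunif : Tendsto (fun n => ∫ x in Ω, w n x) atTop (𝓝 (∫ x in Ω, w' x)) := by
    have hfin : IsFiniteMeasure (volume.restrict Ω) :=
      ⟨by rw [Measure.restrict_apply_univ]; exact S.isBounded.measure_lt_top⟩
    refine tendsto_integral_of_dominated_convergence (fun _ => B)
      (fun n => (integrableOn_of_continuousOn_closure S.isBounded (hw n)).aestronglyMeasurable)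
      (integrable_const _) (fun n => ?_) ?_
    · filter_upwards [ae_restrict_mem S.isOpen.measurableSet] with x hx
      exact hB n x (subset_closure hx)
    · filter_upwards [ae_restrict_mem S.isOpen.measurableSet] with x hx
      exact hlim.tendsto_at (subset_closure hx)
  refine tendsto_nhds_unique hunif ?_
  simp only [hmean]
  exact tendsto_const_nhds

/-- Representatives of admissible functions, with bounds that are uniform in `k`. -/
theorem exists_admissible_representative (S : IsVariationalSetting Ω D p g) :
    ∃ C r₀ α b : ℝ, 0 ≤ C ∧ 0 < r₀ ∧ 0 < α ∧ 0 ≤ b ∧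
      ∀ k : ℕ, pPlus Ω D p < k → ∀ v ∈ admissible Ω p k,
      ∃ w : Euc N → ℝ, ContinuousOn w (closure Ω) ∧ w =ᵐ[volume.restrict Ω] v ∧
        HasWeakGradient Ω w (weakGrad Ω v) ∧ ∫ x in Ω, w x = 0 ∧
        (∀ x ∈ closure Ω, ∀ y ∈ closure Ω, dist x y < r₀ →
          |w x - w y| ≤ C * lqNorm Ω (pMinus Ω p).toReal (weakGrad Ω v) * dist x y ^ α) ∧
        (∀ x ∈ closure Ω, |w x| ≤ C * lqNorm Ω (pMinus Ω p).toReal (weakGrad Ω v)) ∧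
        |boundaryInt Ω g w| ≤ b * lqNorm Ω (pMinus Ω p).toReal (weakGrad Ω v) ∧
        energy Ω p g k v = (gradEnergy Ω p k (weakGrad Ω v)).toReal - boundaryInt Ω g w := by
  obtain ⟨C, r₀, α, hC, hr₀, hα, h⟩ := S.exists_representative
  obtain ⟨b, hb, hbd⟩ := exists_boundaryInt_lipschitz S.isBounded S.surface_lt_top S.continuousOn_g
  refine ⟨C, r₀, α, b * C, hC, hr₀, hα, by positivity, fun k hk v hv => ?_⟩
  obtain ⟨w, hw, hwv, hG, hmean, hholder, hbound⟩ := h v _ (S.hasWeakGradient hv)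
    (S.integrableOn hk hv) (S.lintegral_rpow_lt_top hk (S.gradEnergy_lt_top hk hv)) hv.2
  refine ⟨w, hw, hwv, hG, hmean, hholder, hbound, ?_, S.energy_eq hk hw hwv (S.hasWeakGradient hv)⟩
  have := hbd w (fun _ => 0) hw continuousOn_const
    (C * lqNorm Ω (pMinus Ω p).toReal (weakGrad Ω v)) (by simpa using hbound)
  rw [boundaryInt_const S.integral_g, sub_zero] at this
  linarith

/-- The functionals `I_k` are bounded below, and coercive uniformly in `k`. -/
theorem exists_coercive (S : IsVariationalSetting Ω D p g) (c : ℝ) :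
    ∃ L X : ℝ, ∀ k : ℕ, pPlus Ω D p < k → ∀ v ∈ admissible Ω p k,
      L ≤ energy Ω p g k v ∧ (energy Ω p g k v ≤ c →
        lqNorm Ω (pMinus Ω p).toReal (weakGrad Ω v) ≤ X ∧
          (gradEnergy Ω p k (weakGrad Ω v)).toReal ≤ X) := by
  obtain ⟨C, r₀, α, b, hC, hr₀, hα, hb, h⟩ := S.exists_admissible_representative
  set q := (pMinus Ω p).toReal with hq
  have hq2 : 2 ≤ q := S.two_le_q
  set M := (volume Ω).toReal + 1 with hM
  have hM0 : 0 ≤ M := by positivity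
  set X₁ := (q * |c| + M) + q * b + 1 with hX₁
  refine ⟨-(M / q) - q * b ^ 2 / 4, X₁ + (|c| + b * X₁), fun k hk v hv => ?_⟩
  obtain ⟨w, -, -, -, -, -, -, hbd, hE⟩ := h k hk v hv
  set X := lqNorm Ω q (weakGrad Ω v) with hX
  set E := (gradEnergy Ω p k (weakGrad Ω v)).toReal
  have hE0 : 0 ≤ E := ENNReal.toReal_nonneg
  have hX0 : 0 ≤ X := lqNorm_nonneg _ _ _
  have hsq : X ^ 2 ≤ q * E + M := by
    have := S.sq_lqNorm_le hk (S.gradEnergy_lt_top hk hv)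
    rw [hM]
    linarith
  have hB := abs_le.1 hbd
  constructor
  · have h1 : X ^ 2 / q ≤ E + M / q := by
      rw [div_le_iff₀ (by linarith), add_mul, div_mul_cancel₀ _ (by linarith)]
      linarith
    have h2 : X ^ 2 / q - b * X + q * b ^ 2 / 4 = (X - q * b / 2) ^ 2 / q := by
      field_simp
      ring
    have h3 : 0 ≤ (X - q * b / 2) ^ 2 / q := by positivity
    rw [hE]
    linarith
  · intro hc
    have h4 : E ≤ |c| + b * X := by
      have := le_abs_self c
      linarith
    have h5 : X ≤ X₁ := by
      refine le_of_sq_le_add_mul (by positivity) (by positivity) ?_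
      nlinarith
    have h6 : b * X ≤ b * X₁ := by gcongr
    have h7 : 0 ≤ |c| + b * X₁ := by
      have := abs_nonneg c
      have := mul_nonneg hb (hX0.trans h5)
      linarith
    exact ⟨by linarith, by linarith [hX0.trans h5]⟩

section Fixed

variable {k : ℕ}

theorem zero_mem_admissible (S : IsVariationalSetting Ω D p g) (hk : pPlus Ω D p < k) :
    (fun _ => 0) ∈ admissible Ω p k ∧ energy Ω p g k (fun _ => 0) = 0 := by
  have h0 : gradEnergy Ω p k (fun _ => 0) = 0 := by
    unfold gradEnergy modular
    rw [setLIntegral_congr_fun (g := fun _ => 0) S.isOpen.measurableSet]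
    · simp
    · intro x hx
      have h1 := S.one_le_pTrunc hk hx
      simp [Real.zero_rpow (by linarith : pTrunc p k x ≠ 0)]
  have hG : HasWeakGradient Ω (fun _ => (0 : ℝ)) (fun _ => 0) := HasWeakGradient.of_const 0
  refine ⟨S.mem_admissible hk continuousOn_const hG (by rw [h0]; exact ENNReal.zero_lt_top)
    (by simp), ?_⟩
  rw [S.energy_eq hk continuousOn_const (ae_eq_refl _) hG, h0, boundaryInt_const S.integral_g]
  simp

theorem aemeasurable_one_div_pTrunc (S : IsVariationalSetting Ω D p g) (hk : pPlus Ω D p < k) :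
    AEMeasurable (fun x => 1 / pTrunc p k x) (volume.restrict Ω) :=
  aemeasurable_const.div (S.aemeasurable_pTrunc hk)

theorem one_div_pTrunc_nonneg (S : IsVariationalSetting Ω D p g) (hk : pPlus Ω D p < k)
    (x : Euc N) (hx : x ∈ Ω) : 0 ≤ 1 / pTrunc p k x :=
  one_div_nonneg.2 (zero_le_one.trans (S.one_le_pTrunc hk hx))

theorem exists_isMinimizer (S : IsVariationalSetting Ω D p g) (hk : pPlus Ω D p < k) :
    ∃ v, IsMinimizer (energy Ω p g k) (admissible Ω p k) v := by
  set m := sInf (energy Ω p g k '' admissible Ω p k) with hm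
  obtain ⟨L, X, hLX⟩ := S.exists_coercive (m + 1)
  have hne : (energy Ω p g k '' admissible Ω p k).Nonempty :=
    ⟨_, mem_image_of_mem _ (S.zero_mem_admissible hk).1⟩
  have hbdd : BddBelow (energy Ω p g k '' admissible Ω p k) :=
    ⟨L, by rintro _ ⟨v, hv, rfl⟩; exact (hLX k hk v hv).1⟩
  have hseq : ∀ n : ℕ, ∃ v ∈ admissible Ω p k, energy Ω p g k v < m + 1 / (n + 1) := by
    intro n
    obtain ⟨_, ⟨v, hv, rfl⟩, hlt⟩ := exists_lt_of_csInf_lt hne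
      (show sInf (energy Ω p g k '' admissible Ω p k) < m + 1 / (n + 1) from
        lt_add_of_pos_right _ (by positivity))
    exact ⟨v, hv, hlt⟩
  choose v hv hvm using hseq
  obtain ⟨C, r₀, α, b, hC, hr₀, hα, -, hrep⟩ := S.exists_admissible_representative
  choose w hw hwv hwG hwmean hholder hbound _ hE using fun n => hrep k hk (v n) (hv n)
  have hX : ∀ n, lqNorm Ω (pMinus Ω p).toReal (weakGrad Ω (v n)) ≤ X := fun n => by
    refine ((hLX k hk (v n) (hv n)).2 ?_).1
    have : 1 / ((n : ℝ) + 1) ≤ 1 := (div_le_one (by positivity)).2 (by simp)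
    linarith [hvm n]
  have hq2 := S.two_le_q
  obtain ⟨σ, w', hσ, hw', hlim, ⟨G', hG'⟩, hlsc⟩ := exists_uniform_limit S.isOpen S.isBounded
    hq2 (A := C * X) (B := C * X) hr₀ hα hw hwG
    (fun n x hx y hy hd => (hholder n x hx y hy hd).trans (by gcongr; exact hX n))
    (fun n x hx => (hbound n x hx).trans (by gcongr; exact hX n))
    (fun n => lintegral_rpow_le_of_lqNorm_le (by linarith)
      (S.lintegral_rpow_lt_top hk (S.gradEnergy_lt_top hk (hv n))) (hX n))
  -- the energies of the limit
  have hBlim := S.tendsto_boundaryInt (fun n => hw (σ n)) hw' hlim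
  have hElim : Tendsto (fun n : ℕ => m + 1 / ((σ n : ℝ) + 1) + boundaryInt Ω g (w (σ n))) atTop
      (𝓝 (m + 0 + boundaryInt Ω g w')) :=
    (tendsto_const_nhds.add
      (tendsto_one_div_add_atTop_nhds_zero_nat.comp hσ.tendsto_atTop)).add hBlim
  have hEn : ∀ n, gradEnergy Ω p k (weakGrad Ω (v (σ n))) ≤
      ENNReal.ofReal (m + 1 / ((σ n : ℝ) + 1) + boundaryInt Ω g (w (σ n))) := by
    intro n
    rw [← ENNReal.ofReal_toReal (S.gradEnergy_lt_top hk (hv (σ n))).ne]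
    refine ENNReal.ofReal_le_ofReal ?_
    have h1 := hvm (σ n)
    rw [hE] at h1
    linarith
  have hnonneg : 0 ≤ m + boundaryInt Ω g w' := by
    rw [add_zero] at hElim
    refine ge_of_tendsto' hElim fun n => ?_
    have h1 := hvm (σ n)
    rw [hE] at h1
    have h2 : 0 ≤ (gradEnergy Ω p k (weakGrad Ω (v (σ n)))).toReal := ENNReal.toReal_nonneg
    linarith
  have hlimE : ∀ ε > 0, gradEnergy Ω p k (weakGrad Ω w') ≤
      ENNReal.ofReal (m + boundaryInt Ω g w' + ε) := by
    intro ε hε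
    refine hlsc _ _ (S.aemeasurable_one_div_pTrunc hk) (S.aemeasurable_pTrunc hk)
      (S.one_div_pTrunc_nonneg hk) (fun x hx => S.one_le_pTrunc hk hx) _ ?_
    filter_upwards [hElim.eventually (gt_mem_nhds
      (show m + 0 + boundaryInt Ω g w' < m + boundaryInt Ω g w' + ε by linarith))] with n hn
    exact (hEn n).trans (ENNReal.ofReal_le_ofReal hn.le)
  have hG : HasWeakGradient Ω w' (weakGrad Ω w') := weakGrad_spec ⟨G', hG'⟩
  have hmean : ∫ x in Ω, w' x = 0 :=
    S.integral_eq_zero_of_tendstoUniformlyOn (B := C * X) (fun n => hw (σ n)) (fun n => hwmean (σ n))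
      (fun n x hx => (hbound _ x hx).trans (by gcongr; exact hX _)) hlim
  have hadm : w' ∈ admissible Ω p k :=
    S.mem_admissible hk hw' hG ((hlimE 1 one_pos).trans_lt ENNReal.ofReal_lt_top) hmean
  refine ⟨w', hadm, fun u hu => ?_⟩
  have hmu : m ≤ energy Ω p g k u := csInf_le hbdd (mem_image_of_mem _ hu)
  refine le_trans ?_ hmu
  rw [S.energy_eq hk hw' (ae_eq_refl _) hG]
  refine le_of_forall_pos_le_add fun ε hε => ?_
  have h3 := ENNReal.toReal_mono ENNReal.ofReal_ne_top (hlimE ε hε)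
  rw [ENNReal.toReal_ofReal (by linarith)] at h3
  linarith

/-- Uniqueness: by strict convexity two minimizers have the same gradient, and then their mean-zero
difference vanishes. -/
theorem isMinimizer_unique (S : IsVariationalSetting Ω D p g) (hk : pPlus Ω D p < k)
    {u v : Euc N → ℝ} (hu : IsMinimizer (energy Ω p g k) (admissible Ω p k) u)
    (hv : IsMinimizer (energy Ω p g k) (admissible Ω p k) v) : u =ᵐ[volume.restrict Ω] v := by
  obtain ⟨C, r₀, α, b, -, -, -, -, hrep⟩ := S.exists_admissible_representative
  obtain ⟨u', hu', huu', hGu, hmu, -, -, -, hEu⟩ := hrep k hk u hu.1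
  obtain ⟨v', hv', hvv', hGv, hmv, -, -, -, hEv⟩ := hrep k hk v hv.1
  set Gu := weakGrad Ω u
  set Gv := weakGrad Ω v
  set r := pTrunc p k with hr
  have hfu : gradEnergy Ω p k Gu < ⊤ := S.gradEnergy_lt_top hk hu.1
  have hfv : gradEnergy Ω p k Gv < ⊤ := S.gradEnergy_lt_top hk hv.1
  set Gm : Euc N → Euc N := fun x => (1 / 2 : ℝ) • Gu x + (1 / 2 : ℝ) • Gv x with hGm
  set m' : Euc N → ℝ := fun x => 1 / 2 * u' x + 1 / 2 * v' x with hm'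
  have hm'c : ContinuousOn m' (closure Ω) := (hu'.const_mul _).add (hv'.const_mul _)
  have hGm' : HasWeakGradient Ω m' Gm := (hGu.const_smul (1 / 2)).add (hGv.const_smul (1 / 2))
  have hmod := modular_convex S.isOpen.measurableSet (S.aemeasurable_one_div_pTrunc hk)
    (S.aemeasurable_pTrunc hk) (S.one_div_pTrunc_nonneg hk) (fun x hx => S.one_le_pTrunc hk hx)
    (H := Gv) hGu.2.1.aestronglyMeasurable (show (0 : ℝ) ≤ 1 / 2 by norm_num)
    (show (0 : ℝ) ≤ 1 / 2 by norm_num) (by norm_num)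
  have hfm : gradEnergy Ω p k Gm < ⊤ := hmod.trans_lt (ENNReal.add_lt_top.2
    ⟨ENNReal.mul_lt_top ENNReal.ofReal_lt_top hfu, ENNReal.mul_lt_top ENNReal.ofReal_lt_top hfv⟩)
  have hmean : ∫ x in Ω, m' x = 0 := by
    rw [hm', integral_add, integral_const_mul, integral_const_mul, hmu, hmv]
    · simp
    · exact (integrableOn_of_continuousOn_closure S.isBounded hu').const_mul _
    · exact (integrableOn_of_continuousOn_closure S.isBounded hv').const_mul _
  have hadm : m' ∈ admissible Ω p k := S.mem_admissible hk hm'c hGm' hfm hmean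
  have hEm := S.energy_eq hk hm'c (ae_eq_refl _) hGm'
  have h1 := hu.2 _ hadm
  have h2 := hv.2 _ hadm
  have hB : boundaryInt Ω g m' = 1 / 2 * boundaryInt Ω g u' + 1 / 2 * boundaryInt Ω g v' := by
    rw [hm', boundaryInt_add S.isBounded S.surface_lt_top S.continuousOn_g (hu'.const_mul _)
      (hv'.const_mul _), boundaryInt_const_mul, boundaryInt_const_mul]
  -- the convexity defect has nonpositive integral
  have hreal : ∀ {G : Euc N → Euc N}, AEStronglyMeasurable G (volume.restrict Ω) →
      gradEnergy Ω p k G < ⊤ → IntegrableOn (fun x => ‖G x‖ ^ r x / r x) Ω ∧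
        ∫ x in Ω, ‖G x‖ ^ r x / r x = (gradEnergy Ω p k G).toReal := by
    intro G hGm hfin
    refine ⟨⟨((hGm.norm.aemeasurable.pow (S.aemeasurable_pTrunc hk)).div
      (S.aemeasurable_pTrunc hk)).aestronglyMeasurable, ?_⟩, S.setIntegral_eq_gradEnergy hk hGm⟩
    rw [hasFiniteIntegral_iff_ofReal]
    · simpa only [gradEnergy, modular, div_mul_eq_mul_div, one_mul] using hfin
    · filter_upwards [ae_restrict_mem S.isOpen.measurableSet] with x hx
      have := S.one_le_pTrunc hk hx
      simp only [Pi.zero_apply, hr]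
      positivity
  obtain ⟨iu, eu⟩ := hreal hGu.2.1.aestronglyMeasurable hfu
  obtain ⟨iv, ev⟩ := hreal hGv.2.1.aestronglyMeasurable hfv
  obtain ⟨im, em⟩ := hreal hGm'.2.1.aestronglyMeasurable hfm
  set def' : Euc N → ℝ := fun x =>
    (1 / 2 * (‖Gu x‖ ^ r x / r x) + 1 / 2 * (‖Gv x‖ ^ r x / r x)) - ‖Gm x‖ ^ r x / r x with hdef
  have idef : IntegrableOn def' Ω := ((iu.const_mul _).add (iv.const_mul _)).sub im
  have hdef0 : 0 ≤ᵐ[volume.restrict Ω] def' := by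
    filter_upwards [ae_restrict_mem S.isOpen.measurableSet] with x hx
    have hr1 := S.one_le_pTrunc hk hx
    have h3 := norm_smul_add_smul_rpow_le hr1 (show (0 : ℝ) ≤ 1 / 2 by norm_num)
      (show (0 : ℝ) ≤ 1 / 2 by norm_num) (by norm_num) (Gu x) (Gv x)
    have h4 : ‖Gm x‖ ^ r x / r x ≤ (1 / 2 * ‖Gu x‖ ^ r x + 1 / 2 * ‖Gv x‖ ^ r x) / r x := by
      gcongr
    simp only [hdef, Pi.zero_apply]
    have h5 : (1 / 2 * ‖Gu x‖ ^ r x + 1 / 2 * ‖Gv x‖ ^ r x) / r x =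
      1 / 2 * (‖Gu x‖ ^ r x / r x) + 1 / 2 * (‖Gv x‖ ^ r x / r x) := by ring
    linarith
  have hint : ∫ x in Ω, def' x = 0 := by
    refine le_antisymm ?_ (integral_nonneg_of_ae hdef0)
    have e1 : ∫ x in Ω, def' x = 1 / 2 * (∫ x in Ω, ‖Gu x‖ ^ r x / r x)
        + 1 / 2 * (∫ x in Ω, ‖Gv x‖ ^ r x / r x) - ∫ x in Ω, ‖Gm x‖ ^ r x / r x := by
      have e2 := integral_sub ((iu.const_mul (1 / 2)).add (iv.const_mul (1 / 2))) im
      have e3 := integral_add (iu.const_mul (1 / 2)) (iv.const_mul (1 / 2))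
      simp only [Pi.add_apply] at e2 e3
      rw [hdef, e2, e3, integral_const_mul, integral_const_mul]
    rw [e1, eu, ev, em]
    rw [hEm] at h1 h2
    linarith
  have hzero := (integral_eq_zero_iff_of_nonneg_ae hdef0 idef).1 hint
  have hGeq : Gu =ᵐ[volume.restrict Ω] Gv := by
    filter_upwards [hzero, ae_restrict_mem S.isOpen.measurableSet] with x hx hxΩ
    have hr1 : 2 ≤ r x := S.two_le_q.trans (S.q_le_pTrunc hk hxΩ)
    refine eq_of_norm_midpoint_rpow (r := r x) (by linarith) ?_
    have h6 : 1 / 2 * (‖Gu x‖ ^ r x / r x) + 1 / 2 * (‖Gv x‖ ^ r x / r x) = ‖Gm x‖ ^ r x / r x :=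
      sub_eq_zero.1 hx
    have h7 : (‖Gu x‖ ^ r x + ‖Gv x‖ ^ r x) / 2 / r x = ‖Gm x‖ ^ r x / r x := by
      rw [← h6]; ring
    exact ((div_left_inj' (by linarith)).1 h7).le
  have hdiff : HasWeakGradient Ω (fun x => u' x - v' x) (fun _ => 0) := by
    refine (hGu.sub hGv).congr (ae_eq_refl _) ?_
    filter_upwards [hGeq] with x hx
    rw [hx, sub_self]
  obtain ⟨C, r₀, α, -, -, -, hrep0⟩ := S.exists_representative
  have iu' := integrableOn_of_continuousOn_closure S.isBounded hu'
  have iv' := integrableOn_of_continuousOn_closure S.isBounded hv'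
  have hq2 := S.two_le_q
  have hz : ∫⁻ y in Ω, ‖(0 : Euc N)‖ₑ ^ (pMinus Ω p).toReal = 0 := by
    simp [ENNReal.zero_rpow_of_pos (show 0 < (pMinus Ω p).toReal by linarith)]
  obtain ⟨z, -, hz1, -, -, -, hz2⟩ := hrep0 _ _ hdiff (iu'.sub iv')
    (by rw [hz]; exact ENNReal.zero_lt_top) (by rw [integral_sub iu' iv', hmu, hmv, sub_zero])
  have hnorm0 : lqNorm Ω (pMinus Ω p).toReal (fun _ => (0 : Euc N)) = 0 := by
    rw [lqNorm, hz, ENNReal.zero_rpow_of_pos (by positivity), ENNReal.toReal_zero]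
  filter_upwards [hz1, huu', hvv', ae_restrict_mem S.isOpen.measurableSet] with x h8 h9 h10 hx
  have h11 := hz2 x (subset_closure hx)
  rw [hnorm0, mul_zero, h8, h9, h10] at h11
  exact sub_eq_zero.1 (abs_eq_zero.1 (le_antisymm h11 (abs_nonneg _)))

end Fixed

end IsVariationalSetting

/-! ### The limit `k → ∞` -/

/-- If the moments of order `m` of a function grow at most linearly in `m`, then the function is at
most `1`. -/
theorem ae_le_one_of_lintegral_pow_le {α : Type*} [MeasurableSpace α] {μ : Measure α} {f : α → ℝ}
    (hf : AEMeasurable f μ) {A B : ℝ}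
    (h : ∀ m : ℕ, 1 ≤ m → ∫⁻ x, ENNReal.ofReal (f x ^ m) ∂μ ≤ ENNReal.ofReal (m * A + B)) :
    ∀ᵐ x ∂μ, f x ≤ 1 := by
  have key : ∀ n : ℕ, μ {x | 1 + 1 / ((n : ℝ) + 1) ≤ f x} = 0 := by
    intro n
    set t : ℝ := 1 + 1 / ((n : ℝ) + 1) with ht
    have ht1 : 1 < t := lt_add_of_pos_right _ (by positivity)
    have ht0 : 0 < t := zero_lt_one.trans ht1
    have hlim : Tendsto (fun m : ℕ => ENNReal.ofReal ((m * A + B) / t ^ m)) atTop (𝓝 0) := by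
      rw [← ENNReal.ofReal_zero]
      refine ENNReal.tendsto_ofReal ?_
      have h1 := (tendsto_pow_const_div_const_pow_of_one_lt 1 ht1).mul_const A
      have h2 := (tendsto_pow_const_div_const_pow_of_one_lt 0 ht1).mul_const B
      have h3 := h1.add h2
      simp only [zero_mul, add_zero] at h3
      refine h3.congr fun m => ?_
      simp only [pow_one, pow_zero]
      ring
    refine le_antisymm (ge_of_tendsto hlim ?_) zero_le
    filter_upwards [eventually_ge_atTop 1] with m hm
    have h1 := mul_meas_ge_le_lintegral₀ (hf.pow_const m).ennreal_ofReal (ENNReal.ofReal (t ^ m))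
    have h2 : μ {x | t ≤ f x} ≤ μ {x | ENNReal.ofReal (t ^ m) ≤ ENNReal.ofReal (f x ^ m)} :=
      measure_mono fun x (hx : t ≤ f x) =>
        ENNReal.ofReal_le_ofReal (pow_le_pow_left₀ ht0.le hx m)
    rw [ENNReal.ofReal_div_of_pos (by positivity), ENNReal.le_div_iff_mul_le
      (Or.inl (ENNReal.ofReal_pos.2 (by positivity)).ne') (Or.inl ENNReal.ofReal_ne_top), mul_comm]
    exact (mul_le_mul_right h2 _).trans (h1.trans (h m hm))
  have hall := ae_all_iff.2 fun n => measure_eq_zero_iff_ae_notMem.1 (key n)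
  filter_upwards [hall] with x hx
  refine le_of_forall_pos_le_add fun ε hε => ?_
  obtain ⟨n, hn⟩ := exists_nat_one_div_lt hε
  have := not_le.1 (hx n)
  linarith

/-- The part of the energy that lives outside `D`, `∫_{Ω ∖ D̄} ‖G‖^p / p`. -/
def outerEnergy (Ω D : Set (Euc N)) (p : Euc N → ℝ≥0∞) (G : Euc N → Euc N) : ℝ≥0∞ :=
  modular (Ω \ closure D) (fun x => 1 / (p x).toReal) (fun x => (p x).toReal) G

namespace IsVariationalSetting

variable {Ω D : Set (Euc N)} {p : Euc N → ℝ≥0∞} {g : Euc N → ℝ}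

theorem gradEnergy_eq_add (S : IsVariationalSetting Ω D p g) {k : ℕ} (hk : pPlus Ω D p < k)
    (G : Euc N → Euc N) :
    gradEnergy Ω p k G = modular D (fun _ => 1 / k) (fun _ => k) G + outerEnergy Ω D p G := by
  have hdisj : Disjoint D (Ω \ closure D) :=
    disjoint_left.2 fun x hx hx' => hx'.2 (subset_closure hx)
  rw [gradEnergy, modular, S.restrict_eq, lintegral_union S.isOpen_diff.measurableSet hdisj]
  congr 1
  · exact setLIntegral_congr_fun S.isOpen_D.measurableSet fun x hx => by
      simp only [S.pTrunc_of_mem_D hx]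
  · exact setLIntegral_congr_fun S.isOpen_diff.measurableSet fun x hx => by
      simp only [S.pTrunc_of_mem_diff hk hx]

theorem limitEnergy_eq (S : IsVariationalSetting Ω D p g) {v w : Euc N → ℝ} {G : Euc N → Euc N}
    (hw : ContinuousOn w (closure Ω)) (hwv : w =ᵐ[volume.restrict Ω] v)
    (hG : HasWeakGradient Ω v G) :
    limitEnergy Ω D p g v = (outerEnergy Ω D p G).toReal - boundaryInt Ω g w := by
  have hae := weakGrad_ae_eq S.isOpen hG
  have hae' : weakGrad Ω v =ᵐ[volume.restrict (Ω \ closure D)] G :=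
    ae_restrict_of_ae_restrict_of_subset sdiff_subset hae
  rw [limitEnergy, boundaryTerm_eq S.isOpen S.isBounded hw hwv,
    setIntegral_rpow_div_eq_modular S.isOpen_diff.measurableSet S.aemeasurable_p
      (fun x _ => ENNReal.toReal_nonneg)
      ((weakGrad_spec ⟨G, hG⟩).mono sdiff_subset).2.1.aestronglyMeasurable]
  congr 2
  exact modular_congr _ _ hae'

theorem outerEnergy_lt_top_iff (S : IsVariationalSetting Ω D p g) (G : Euc N → Euc N) :
    outerEnergy Ω D p G < ⊤ ↔
      ∫⁻ x in Ω \ closure D, ENNReal.ofReal (‖G x‖ ^ (p x).toReal) < ⊤ := by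
  have hq := S.two_le_q
  constructor
  · intro h
    have hle : ∀ x ∈ Ω \ closure D, ENNReal.ofReal (‖G x‖ ^ (p x).toReal) ≤
        ENNReal.ofReal (pPlus Ω D p).toReal *
          ENNReal.ofReal (1 / (p x).toReal * ‖G x‖ ^ (p x).toReal) := by
      intro x hx
      have h1 := S.q_le_p hx
      rw [← ENNReal.ofReal_mul ENNReal.toReal_nonneg, ← mul_assoc]
      refine ENNReal.ofReal_le_ofReal (le_mul_of_one_le_left (by positivity) ?_)
      rw [mul_one_div]
      exact (one_le_div (by linarith)).2 (S.p_le hx)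
    refine (setLIntegral_mono' S.isOpen_diff.measurableSet hle).trans_lt ?_
    rw [lintegral_const_mul' _ _ ENNReal.ofReal_ne_top]
    exact ENNReal.mul_lt_top ENNReal.ofReal_lt_top h
  · intro h
    refine (setLIntegral_mono' S.isOpen_diff.measurableSet fun x hx => ?_).trans_lt h
    have h1 := S.q_le_p hx
    refine ENNReal.ofReal_le_ofReal (mul_le_of_le_one_left (by positivity) ?_)
    exact (div_le_one (by linarith)).2 (by linarith)

end IsVariationalSetting

/-- `u` is the uniform limit of continuous minimizers `w j` of the functionals `I_{k j}`, along a
sequence `k j → ∞` with bounded energies, for which convex functionals of the gradient are lower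
semicontinuous. -/
structure IsLimitOfMinimizers (Ω D : Set (Euc N)) (p : Euc N → ℝ≥0∞) (g : Euc N → ℝ) (k : ℕ → ℕ)
    (w : ℕ → Euc N → ℝ) (u : Euc N → ℝ) : Prop where
  pPlus_lt : ∀ j, pPlus Ω D p < k j
  strictMono : StrictMono k
  isMinimizer : ∀ j, IsMinimizer (energy Ω p g (k j)) (admissible Ω p (k j)) (w j)
  continuousOn : ∀ j, ContinuousOn (w j) (closure Ω)
  continuousOn_lim : ContinuousOn u (closure Ω)
  tendsto : TendstoUniformlyOn w u atTop (closure Ω)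
  hasWeakGradient : HasWeakGradient Ω u (weakGrad Ω u)
  integral_eq_zero : ∫ x in Ω, u x = 0
  energy_le : ∃ X : ℝ, 0 ≤ X ∧ ∀ j, gradEnergy Ω p (k j) (weakGrad Ω (w j)) ≤ ENNReal.ofReal X
  lsc : ∀ a r : Euc N → ℝ, AEMeasurable a (volume.restrict Ω) →
    AEMeasurable r (volume.restrict Ω) → (∀ x ∈ Ω, 0 ≤ a x) → (∀ x ∈ Ω, 1 ≤ r x) → ∀ c : ℝ≥0∞,
    (∀ᶠ j in atTop, modular Ω a r (weakGrad Ω (w j)) ≤ c) → modular Ω a r (weakGrad Ω u) ≤ c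

namespace IsVariationalSetting

variable {Ω D : Set (Euc N)} {p : Euc N → ℝ≥0∞} {g : Euc N → ℝ}

theorem exists_isLimitOfMinimizers (S : IsVariationalSetting Ω D p g) {u : ℕ → Euc N → ℝ}
    (hu : ∀ k : ℕ, pPlus Ω D p < k → IsMinimizer (energy Ω p g k) (admissible Ω p k) (u k)) :
    ∃ w : ℕ → Euc N → ℝ,
      (∀ k : ℕ, pPlus Ω D p < k →
        ContinuousOn (w k) (closure Ω) ∧ w k =ᵐ[volume.restrict Ω] u k) ∧
      ∃ (σ : ℕ → ℕ) (u_inf : Euc N → ℝ),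
        IsLimitOfMinimizers Ω D p g σ (fun j => w (σ j)) u_inf := by
  classical
  obtain ⟨C, r₀, α, b, hC, hr₀, hα, -, hrep⟩ := S.exists_admissible_representative
  obtain ⟨L, X, hLX⟩ := S.exists_coercive 0
  choose! w hw hwu hwG hwmean hholder hbound _ hE using fun k hk => hrep k hk (u k) (hu k hk).1
  refine ⟨w, fun k hk => ⟨hw k hk, hwu k hk⟩, ?_⟩
  obtain ⟨K, hK⟩ := exists_nat_gt (pPlus Ω D p).toReal
  have hKlt : ∀ n : ℕ, pPlus Ω D p < ((K + n : ℕ) : ℝ≥0∞) := by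
    intro n
    have h1 : (pPlus Ω D p).toReal < ((K + n : ℕ) : ℝ) := by push_cast; linarith [n.cast_nonneg (α := ℝ)]
    rwa [← ENNReal.toReal_natCast, ENNReal.toReal_lt_toReal S.pPlus_lt_top.ne
      (ENNReal.natCast_ne_top _)] at h1
  have hle0 : ∀ k : ℕ, pPlus Ω D p < k → energy Ω p g k (u k) ≤ 0 := fun k hk =>
    ((hu k hk).2 _ (S.zero_mem_admissible hk).1).trans_eq (S.zero_mem_admissible hk).2
  have hX : ∀ k : ℕ, pPlus Ω D p < k → lqNorm Ω (pMinus Ω p).toReal (weakGrad Ω (u k)) ≤ X ∧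
      (gradEnergy Ω p k (weakGrad Ω (u k))).toReal ≤ X :=
    fun k hk => (hLX k hk (u k) (hu k hk).1).2 (hle0 k hk)
  have hae : ∀ k : ℕ, pPlus Ω D p < k →
      weakGrad Ω (w k) =ᵐ[volume.restrict Ω] weakGrad Ω (u k) :=
    fun k hk => weakGrad_ae_eq S.isOpen (hwG k hk)
  have hq2 := S.two_le_q
  obtain ⟨σ, w', hσ, hw', hlim, ⟨G', hG'⟩, hlsc⟩ := exists_uniform_limit S.isOpen S.isBounded
    hq2 (A := C * X) (B := C * X) hr₀ hα (fun n => hw _ (hKlt n)) (fun n => hwG _ (hKlt n))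
    (fun n x hx y hy hd => (hholder _ (hKlt n) x hx y hy hd).trans
      (by gcongr; exact (hX _ (hKlt n)).1))
    (fun n x hx => (hbound _ (hKlt n) x hx).trans (by gcongr; exact (hX _ (hKlt n)).1))
    (fun n => lintegral_rpow_le_of_lqNorm_le (by linarith)
      (S.lintegral_rpow_lt_top (hKlt n) (S.gradEnergy_lt_top (hKlt n) (hu _ (hKlt n)).1))
      (hX _ (hKlt n)).1)
  refine ⟨fun j => K + σ j, w', ⟨fun j => hKlt _, fun i j hij => Nat.add_lt_add_left (hσ hij) K,
    fun j => ?_, fun j => hw _ (hKlt _), hw', hlim, weakGrad_spec ⟨G', hG'⟩, ?_, ⟨X, ?_, ?_⟩, ?_⟩⟩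
  · have hk := hKlt (σ j)
    have hfin := S.gradEnergy_lt_top hk (hu _ hk).1
    refine ⟨S.mem_admissible hk (hw _ hk) (hwG _ hk) hfin (hwmean _ hk), fun v hv => ?_⟩
    rw [S.energy_eq hk (hw _ hk) (ae_eq_refl _) (hwG _ hk), ← hE _ hk]
    exact (hu _ hk).2 v hv
  · exact S.integral_eq_zero_of_tendstoUniformlyOn (B := C * X) (fun n => hw _ (hKlt (σ n)))
      (fun n => hwmean _ (hKlt (σ n)))
      (fun n x hx => (hbound _ (hKlt _) x hx).trans (by gcongr; exact (hX _ (hKlt _)).1)) hlim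
  · exact ENNReal.toReal_nonneg.trans (hX _ (hKlt 0)).2
  · intro j
    have hk := hKlt (σ j)
    rw [gradEnergy, modular_congr _ _ (hae _ hk)]
    exact (ENNReal.le_ofReal_iff_toReal_le (S.gradEnergy_lt_top hk (hu _ hk).1).ne
      (ENNReal.toReal_nonneg.trans (hX _ hk).2)).2 (hX _ hk).2
  · intro a r ha hr ha0 hr1 c hc
    refine hlsc a r ha hr ha0 hr1 c (hc.mono fun n hn => ?_)
    rwa [modular_congr _ _ (hae _ (hKlt (σ n)))] at hn

end IsVariationalSetting

namespace IsLimitOfMinimizers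

variable {Ω D : Set (Euc N)} {p : Euc N → ℝ≥0∞} {g : Euc N → ℝ} {k : ℕ → ℕ}
  {w : ℕ → Euc N → ℝ} {u : Euc N → ℝ}

/-- Lower semicontinuity on an open subset. -/
theorem lsc_on (L : IsLimitOfMinimizers Ω D p g k w u) {V : Set (Euc N)} (hV : IsOpen V)
    (hVΩ : V ⊆ Ω) {a r : Euc N → ℝ} (ha : AEMeasurable a (volume.restrict V))
    (hr : AEMeasurable r (volume.restrict V)) (ha0 : ∀ x ∈ V, 0 ≤ a x) (hr1 : ∀ x ∈ V, 1 ≤ r x)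
    {c : ℝ≥0∞} (hc : ∀ᶠ j in atTop, modular V a r (weakGrad Ω (w j)) ≤ c) :
    modular V a r (weakGrad Ω u) ≤ c := by
  have hres : (volume.restrict Ω).restrict V = volume.restrict V := by
    rw [Measure.restrict_restrict hV.measurableSet, inter_eq_left.2 hVΩ]
  set a' : Euc N → ℝ := V.indicator a with ha'
  set r' : Euc N → ℝ := fun x => V.indicator (fun y => r y - 1) x + 1 with hr'
  have hmod : ∀ G : Euc N → Euc N, modular Ω a' r' G = modular V a r G := by
    intro G
    have e : ∀ x, ENNReal.ofReal (a' x * ‖G x‖ ^ r' x) =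
        V.indicator (fun y => ENNReal.ofReal (a y * ‖G y‖ ^ r y)) x := by
      intro x
      by_cases hx : x ∈ V <;> simp [ha', hr', hx]
    simp only [modular, e]
    rw [lintegral_indicator hV.measurableSet, hres]
  rw [← hmod]
  refine L.lsc a' r' ?_ ?_ ?_ ?_ c (hc.mono fun j hj => by rwa [hmod])
  · exact (aemeasurable_indicator_iff hV.measurableSet).2 (by rwa [hres])
  · exact ((aemeasurable_indicator_iff hV.measurableSet).2
      (by rw [hres]; exact hr.sub_const 1)).add_const 1
  · intro x _
    exact indicator_nonneg ha0 x
  · intro x _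
    have : 0 ≤ V.indicator (fun y => r y - 1) x :=
      indicator_nonneg (fun y hy => sub_nonneg.2 (hr1 y hy)) x
    simp only [hr']
    linarith

theorem outerEnergy_le (S : IsVariationalSetting Ω D p g) (L : IsLimitOfMinimizers Ω D p g k w u)
    {c : ℝ≥0∞} (hc : ∀ᶠ j in atTop, outerEnergy Ω D p (weakGrad Ω (w j)) ≤ c) :
    outerEnergy Ω D p (weakGrad Ω u) ≤ c :=
  L.lsc_on S.isOpen_diff sdiff_subset (aemeasurable_const.div S.aemeasurable_p) S.aemeasurable_p
    (fun _ _ => one_div_nonneg.2 ENNReal.toReal_nonneg) (fun _ hx => by linarith [S.q_le_p hx, S.two_le_q]) hc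

/-- The energy bound forces `|∇u| ≤ 1` on `D`, where the exponents tend to infinity. -/
theorem norm_weakGrad_le_one (S : IsVariationalSetting Ω D p g)
    (L : IsLimitOfMinimizers Ω D p g k w u) :
    ∀ᵐ x ∂volume.restrict D, ‖weakGrad Ω u x‖ ≤ 1 := by
  obtain ⟨X, hX0, hX⟩ := L.energy_le
  have hDfin : volume D < ⊤ := (S.isBounded.subset S.D_subset).measure_lt_top
  refine ae_le_one_of_lintegral_pow_le (A := X) (B := (volume D).toReal)
    (L.hasWeakGradient.mono S.D_subset).2.1.aestronglyMeasurable.norm.aemeasurable ?_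
  intro m hm
  have hm0 : (0 : ℝ) < m := by exact_mod_cast hm
  have h1 : modular D (fun _ => 1) (fun _ => m) (weakGrad Ω u) ≤
      ENNReal.ofReal (m * X + (volume D).toReal) := by
    refine L.lsc_on S.isOpen_D S.D_subset aemeasurable_const aemeasurable_const
      (fun _ _ => zero_le_one) (fun _ _ => by exact_mod_cast hm) ?_
    filter_upwards [eventually_ge_atTop m] with j hj
    have hmk : (m : ℝ) ≤ k j := by exact_mod_cast hj.trans L.strictMono.le_apply
    set G := weakGrad Ω (w j)
    calc modular D (fun _ => 1) (fun _ => (m : ℝ)) G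
        ≤ ∫⁻ x in D, (ENNReal.ofReal m *
            ENNReal.ofReal (1 / (k j : ℝ) * ‖G x‖ ^ (k j : ℝ)) + 1) := by
          refine lintegral_mono fun x => ?_
          rw [← ENNReal.ofReal_mul hm0.le, ← ENNReal.ofReal_one,
            ← ENNReal.ofReal_add (by positivity) zero_le_one]
          refine ENNReal.ofReal_le_ofReal ?_
          have h2 := rpow_div_le_rpow_div_add (norm_nonneg (G x)) hm0 hmk
          rw [div_add_div _ _ (by linarith) hm0.ne', div_le_div_iff₀ hm0 (by nlinarith)] at h2
          rw [one_mul]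
          have h3 : (0 : ℝ) < k j := by linarith
          have h4 : (m : ℝ) * (1 / (k j : ℝ) * ‖G x‖ ^ (k j : ℝ)) + 1 =
            (‖G x‖ ^ (k j : ℝ) * m + k j * 1) * m / (k j * m) := by
            field_simp
          rw [h4, le_div_iff₀ (by positivity)]
          exact h2
      _ = ENNReal.ofReal m * modular D (fun _ => 1 / k j) (fun _ => k j) G + volume D := by
          rw [lintegral_add_right _ measurable_const, lintegral_const_mul' _ _ ENNReal.ofReal_ne_top]
          simp [modular]
      _ ≤ ENNReal.ofReal m * ENNReal.ofReal X + ENNReal.ofReal (volume D).toReal := by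
          rw [ENNReal.ofReal_toReal hDfin.ne]
          gcongr
          refine le_trans ?_ (hX j)
          rw [S.gradEnergy_eq_add (L.pPlus_lt j)]
          exact le_self_add
      _ = _ := by
          rw [← ENNReal.ofReal_mul hm0.le, ENNReal.ofReal_add (by positivity) (by positivity)]
  simpa only [modular, one_mul, Real.rpow_natCast] using h1

theorem mem_limitAdmissible (S : IsVariationalSetting Ω D p g)
    (L : IsLimitOfMinimizers Ω D p g k w u) : u ∈ limitAdmissible Ω D p := by
  obtain ⟨X, hX0, hX⟩ := L.energy_le
  have hq2 := S.two_le_q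
  refine ⟨?_, ?_, ?_, L.integral_eq_zero⟩
  · refine memVarSobolev_of_continuousOn S.isOpen subset_rfl S.isBounded (fun _ _ => by linarith)
      L.continuousOn_lim L.hasWeakGradient ?_
    have h1 := L.lsc (fun _ => 1) (fun _ => (pMinus Ω p).toReal) aemeasurable_const
      aemeasurable_const (fun _ _ => zero_le_one) (fun _ _ => by linarith)
      (ENNReal.ofReal (pMinus Ω p).toReal * ENNReal.ofReal X + volume Ω)
      (Eventually.of_forall fun j => by
        refine le_trans (le_of_eq ?_) ((S.lintegral_rpow_le_gradEnergy (L.pPlus_lt j)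
          (weakGrad Ω (w j))).trans (by gcongr; exact hX j))
        refine lintegral_congr fun x => ?_
        rw [one_mul, ← ofReal_norm, ENNReal.ofReal_rpow_of_nonneg (norm_nonneg _) (by linarith)])
    simp only [modular, one_mul] at h1
    exact h1.trans_lt (ENNReal.add_lt_top.2 ⟨ENNReal.mul_lt_top ENNReal.ofReal_lt_top
      ENNReal.ofReal_lt_top, S.isBounded.measure_lt_top⟩)
  · refine memVarSobolev_of_continuousOn S.isOpen_diff sdiff_subset S.isBounded
      (fun _ _ => ENNReal.toReal_nonneg) L.continuousOn_lim
      (L.hasWeakGradient.mono sdiff_subset) ?_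
    rw [← S.outerEnergy_lt_top_iff]
    refine (outerEnergy_le S L (c := ENNReal.ofReal X)
      (Eventually.of_forall fun j => ?_)).trans_lt ENNReal.ofReal_lt_top
    refine le_trans ?_ (hX j)
    rw [S.gradEnergy_eq_add (L.pPlus_lt j)]
    exact le_add_self
  · refine eLpNormEssSup_le_of_ae_enorm_bound ?_
    filter_upwards [norm_weakGrad_le_one S L] with x hx
    rw [← ofReal_norm, ← ENNReal.ofReal_one]
    exact ENNReal.ofReal_le_ofReal hx

theorem isMinimizer_lim (S : IsVariationalSetting Ω D p g)
    (L : IsLimitOfMinimizers Ω D p g k w u) :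
    IsMinimizer (limitEnergy Ω D p g) (limitAdmissible Ω D p) u := by
  refine ⟨mem_limitAdmissible S L, fun v hv => ?_⟩
  have hq2 := S.two_le_q
  obtain ⟨hv1, hv2, hv3, hvmean⟩ := hv
  have hG := weakGrad_spec hv1.1
  set G := weakGrad Ω v
  obtain ⟨C, r₀, α, -, -, -, hrep⟩ := S.exists_representative
  have hfin : ∫⁻ y in Ω, ‖G y‖ₑ ^ (pMinus Ω p).toReal < ⊤ := by
    refine lt_of_eq_of_lt (lintegral_congr fun x => ?_) (hv1.2.2.lintegral_lt_top
      S.isOpen.measurableSet (fun _ _ => by linarith) (fun _ _ => le_rfl))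
    rw [← ofReal_norm, ENNReal.ofReal_rpow_of_nonneg (norm_nonneg _) (by linarith)]
  obtain ⟨v', hv', hvv', hG', hmean', -, -⟩ := hrep v G hG
    (IsVariationalSetting.integrableOn_of_memVarLp S.isOpen.measurableSet S.isBounded hv1.2.1
      (k := (pMinus Ω p).toReal) (fun _ _ => by linarith) (fun _ _ => le_rfl)) hfin hvmean
  have hout : outerEnergy Ω D p G < ⊤ := by
    rw [S.outerEnergy_lt_top_iff]
    have hae := weakGrad_ae_eq S.isOpen_diff (hG.mono sdiff_subset)
    refine lt_of_eq_of_lt (lintegral_congr_ae ?_) (hv2.2.2.lintegral_lt_top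
      S.isOpen_diff.measurableSet (fun _ _ => ENNReal.toReal_nonneg) (fun _ hx => S.p_le hx))
    filter_upwards [hae] with x hx
    rw [hx]
  have hD1 : ∀ᵐ x ∂volume.restrict D, ‖G x‖ ≤ 1 := by
    rw [eLpNorm_exponent_top] at hv3
    filter_upwards [enorm_ae_le_eLpNormEssSup G (volume.restrict D)] with x hx
    have h1 := hx.trans hv3
    rwa [← ofReal_norm, ENNReal.ofReal_le_one] at h1
  have hDfin : volume D < ⊤ := (S.isBounded.subset S.D_subset).measure_lt_top
  set d := (volume D).toReal with hd
  have hin : ∀ j, modular D (fun _ => 1 / k j) (fun _ => k j) G ≤ ENNReal.ofReal (1 / k j * d) := by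
    intro j
    calc modular D (fun _ => 1 / k j) (fun _ => k j) G
        ≤ ∫⁻ _ in D, ENNReal.ofReal (1 / k j) := by
          refine lintegral_mono_ae (hD1.mono fun x hx => ENNReal.ofReal_le_ofReal ?_)
          exact mul_le_of_le_one_right (by positivity)
            (Real.rpow_le_one (norm_nonneg _) hx (by positivity))
      _ = _ := by
          rw [setLIntegral_const, ENNReal.ofReal_mul (by positivity),
            ENNReal.ofReal_toReal hDfin.ne]
  have hlimv := S.limitEnergy_eq hv' hvv' hG
  -- `v` competes in each of the approximate problems
  have hcomp : ∀ j, (outerEnergy Ω D p (weakGrad Ω (w j))).toReal ≤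
      limitEnergy Ω D p g v + 1 / k j * d + boundaryInt Ω g (w j) := by
    intro j
    have hk := L.pPlus_lt j
    have hfinG : gradEnergy Ω p (k j) G < ⊤ := by
      rw [S.gradEnergy_eq_add hk]
      exact ENNReal.add_lt_top.2 ⟨(hin j).trans_lt ENNReal.ofReal_lt_top, hout⟩
    have hmin := (L.isMinimizer j).2 v' (S.mem_admissible hk hv' hG' hfinG hmean')
    have hgw := S.gradEnergy_lt_top hk (L.isMinimizer j).1
    rw [S.energy_eq hk hv' (ae_eq_refl _) hG', S.energy_eq hk (L.continuousOn j) (ae_eq_refl _)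
      (S.hasWeakGradient (L.isMinimizer j).1)] at hmin
    have h1 : (outerEnergy Ω D p (weakGrad Ω (w j))).toReal ≤
        (gradEnergy Ω p (k j) (weakGrad Ω (w j))).toReal := by
      refine ENNReal.toReal_mono hgw.ne ?_
      rw [S.gradEnergy_eq_add hk]
      exact le_add_self
    have h2 : (gradEnergy Ω p (k j) G).toReal ≤ 1 / k j * d + (outerEnergy Ω D p G).toReal := by
      rw [S.gradEnergy_eq_add hk, ENNReal.toReal_add
        ((hin j).trans_lt ENNReal.ofReal_lt_top).ne hout.ne]
      gcongr
      exact ENNReal.toReal_le_of_le_ofReal (by positivity) (hin j)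
    rw [hlimv]
    linarith
  have hlim : Tendsto (fun j => limitEnergy Ω D p g v + 1 / k j * d + boundaryInt Ω g (w j)) atTop
      (𝓝 (limitEnergy Ω D p g v + 0 * d + boundaryInt Ω g u)) :=
    ((((tendsto_one_div_atTop_nhds_zero_nat (𝕜 := ℝ)).comp
      L.strictMono.tendsto_atTop).mul_const d).const_add _).add
      (S.tendsto_boundaryInt L.continuousOn L.continuousOn_lim L.tendsto)
  rw [zero_mul, add_zero] at hlim
  have hnonneg : 0 ≤ limitEnergy Ω D p g v + boundaryInt Ω g u :=
    ge_of_tendsto' hlim fun j => ENNReal.toReal_nonneg.trans (hcomp j)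
  rw [S.limitEnergy_eq L.continuousOn_lim (ae_eq_refl _) L.hasWeakGradient]
  refine le_of_forall_pos_le_add fun ε hε => ?_
  have h3 : outerEnergy Ω D p (weakGrad Ω u) ≤
      ENNReal.ofReal (limitEnergy Ω D p g v + boundaryInt Ω g u + ε) := by
    refine outerEnergy_le S L ?_
    filter_upwards [hlim.eventually (gt_mem_nhds (show limitEnergy Ω D p g v + boundaryInt Ω g u <
      limitEnergy Ω D p g v + boundaryInt Ω g u + ε by linarith))] with j hj
    have hgw := S.gradEnergy_lt_top (L.pPlus_lt j) (L.isMinimizer j).1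
    rw [S.gradEnergy_eq_add (L.pPlus_lt j)] at hgw
    rw [ENNReal.le_ofReal_iff_toReal_le (ENNReal.add_lt_top.1 hgw).2.ne (by linarith)]
    exact (hcomp j).trans hj.le
  have h4 := ENNReal.toReal_le_of_le_ofReal (by linarith) h3
  linarith

end IsLimitOfMinimizers

/-! ### The chain rule and truncations -/

/-- A `C¹` version of the positive part with slope between `0` and `1`. -/
theorem exists_smooth_posPart : ∃ f : ℝ → ℝ, ContDiff ℝ 1 f ∧
    (∀ s, 0 ≤ deriv f s ∧ deriv f s ≤ 1) ∧ (∀ s ≤ 0, f s = 0 ∧ deriv f s = 0) ∧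
    ∀ s, 0 < s → 0 < f s := by
  have hC : ContDiff ℝ 1 Real.smoothTransition := Real.smoothTransition.contDiff (n := 1)
  have hcont : Continuous (deriv Real.smoothTransition) := hC.continuous_deriv le_rfl
  have hneg : ∀ s ≤ 0, deriv Real.smoothTransition s = 0 := fun s hs =>
    IsLocalMin.deriv_eq_zero (Eventually.of_forall fun t => by
      rw [Real.smoothTransition.zero_of_nonpos hs]
      exact Real.smoothTransition.nonneg t)
  have hbig : ∀ s, 1 ≤ s → deriv Real.smoothTransition s = 0 := fun s hs =>
    IsLocalMax.deriv_eq_zero (Eventually.of_forall fun t => by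
      rw [Real.smoothTransition.one_of_one_le hs]
      exact Real.smoothTransition.le_one t)
  obtain ⟨C, hCb⟩ := (isCompact_Icc (a := (0 : ℝ)) (b := 1)).exists_bound_of_continuousOn
    hcont.continuousOn
  have hC0 : 0 ≤ C := (norm_nonneg _).trans (hCb 0 (by simp))
  have hbound : ∀ s, deriv Real.smoothTransition s ≤ C := by
    intro s
    rcases le_total s 0 with h | h
    · rw [hneg s h]; exact hC0
    rcases le_total 1 s with h' | h'
    · rw [hbig s h']; exact hC0
    exact (le_abs_self _).trans (hCb s ⟨h, h'⟩)
  have hd : ∀ s, deriv (fun t => (C + 1)⁻¹ * Real.smoothTransition t) s =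
      (C + 1)⁻¹ * deriv Real.smoothTransition s := fun s =>
    deriv_const_mul _ (hC.differentiable one_ne_zero s)
  refine ⟨fun t => (C + 1)⁻¹ * Real.smoothTransition t, contDiff_const.mul hC, fun s => ?_,
    fun s hs => ?_, fun s hs => ?_⟩
  · rw [hd]
    have h0 := Real.smoothTransition.monotone.deriv_nonneg (x := s)
    refine ⟨by positivity, ?_⟩
    rw [inv_mul_le_one₀ (by positivity)]
    linarith [hbound s]
  · rw [hd, hneg s hs]
    simp [Real.smoothTransition.zero_of_nonpos hs]
  · have := Real.smoothTransition.pos_of_pos hs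
    positivity

namespace HasWeakGradient

/-- The chain rule. -/
theorem comp {U : Set (Euc N)} (hU : IsOpen U) {u : Euc N → ℝ} {G : Euc N → Euc N}
    (h : HasWeakGradient U u G) (hb : Bornology.IsBounded U) (hu : IntegrableOn u U)
    (hG : IntegrableOn G U) {f : ℝ → ℝ} (hf : ContDiff ℝ 1 f) {C : ℝ}
    (hC : ∀ s, ‖deriv f s‖ ≤ C) :
    HasWeakGradient U (fun x => f (u x)) (fun x => deriv f (u x) • G x) := by
  have hlip : ∀ s t, ‖f s - f t‖ ≤ C * ‖s - t‖ := fun s t =>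
    convex_univ.norm_image_sub_le_of_norm_deriv_le (fun x _ => hf.differentiable one_ne_zero x)
      (fun x _ => hC x) (mem_univ t) (mem_univ s)
  have hC0 : 0 ≤ C := (norm_nonneg _).trans (hC 0)
  have hf'c : Continuous (deriv f) := hf.continuous_deriv le_rfl
  have hu' : Integrable (U.indicator u) := (integrable_indicator_iff hU.measurableSet).2 hu
  have hG' : Integrable (U.indicator G) := (integrable_indicator_iff hU.measurableSet).2 hG
  have hfu : IntegrableOn (fun x => f (u x)) U := by
    have hfin : IsFiniteMeasure (volume.restrict U) :=
      ⟨by rw [Measure.restrict_apply_univ]; exact hb.measure_lt_top⟩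
    refine ((hu.norm.const_mul C).add (integrable_const |f 0|)).mono'
      (hf.continuous.comp_aestronglyMeasurable hu.aestronglyMeasurable)
      (Eventually.of_forall fun x => ?_)
    have h1 := hlip (u x) 0
    rw [sub_zero] at h1
    have h2 := norm_sub_norm_le (f (u x)) (f 0)
    rw [Real.norm_eq_abs (f 0)] at h2
    simp only [Pi.add_apply]
    linarith
  have hfG : IntegrableOn (fun x => deriv f (u x) • G x) U :=
    hG.bdd_smul C (hf'c.comp_aestronglyMeasurable hu.aestronglyMeasurable)
      (Eventually.of_forall fun x => hC _)
  refine of_forall_isCompact hU fun K hKU hK => ?_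
  obtain ⟨δ, hδ, hsub⟩ := hK.exists_cthickening_subset_open hU hKU
  have hVU : Metric.thickening (δ / 2) K ⊆ U :=
    (Metric.thickening_subset_cthickening_of_le (by linarith) K).trans hsub
  refine ⟨Metric.thickening (δ / 2) K, Metric.isOpen_thickening,
    Metric.self_subset_thickening (by positivity) K, hVU, ?_⟩
  set V := Metric.thickening (δ / 2) K with hV
  have hVo : IsOpen V := Metric.isOpen_thickening
  obtain ⟨n₀, hn₀⟩ := exists_nat_one_div_lt (show 0 < δ / 2 by positivity)
  have hball : ∀ n : ℕ, ∀ x ∈ V, Metric.closedBall x (1 / (((n + n₀ : ℕ) : ℝ) + 1)) ⊆ U := by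
    intro n x hx y hy
    obtain ⟨z, hz, hxz⟩ := Metric.mem_thickening_iff.1 hx
    refine hsub (Metric.mem_cthickening_of_dist_le y z δ K hz ?_)
    have h1 : 1 / (((n + n₀ : ℕ) : ℝ) + 1) ≤ 1 / ((n₀ : ℝ) + 1) := by
      refine one_div_le_one_div_of_le (by positivity) ?_
      push_cast
      linarith [n.cast_nonneg (α := ℝ)]
    have h2 := Metric.mem_closedBall.1 hy
    have h3 := dist_triangle y x z
    linarith
  set un : ℕ → Euc N → ℝ := fun n => mollify (n + n₀) (U.indicator u) with hun
  set Gn : ℕ → Euc N → Euc N := fun n => mollify (n + n₀) (U.indicator G) with hGn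
  have hunC : ∀ n, ContDiff ℝ 1 (un n) := fun n =>
    (contDiff_mollify (n + n₀) hu'.locallyIntegrable).of_le (by exact_mod_cast le_top)
  have hGnC : ∀ n, Continuous (Gn n) := fun n =>
    (contDiff_mollify (n + n₀) hG'.locallyIntegrable).continuous
  have hgrad : ∀ n, HasWeakGradient V (fun x => f (un n x)) (fun x => deriv f (un n x) • Gn n x) := by
    intro n
    refine (of_contDiff (U := V) (hf.comp (hunC n))).congr (ae_eq_refl _) ?_
    filter_upwards [ae_restrict_mem hVo.measurableSet] with x hx
    refine ext_inner_right ℝ fun v => ?_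
    have h1 : HasFDerivAt (f ∘ un n) (deriv f (un n x) • fderiv ℝ (un n) x) x :=
      (hf.differentiable one_ne_zero _).hasDerivAt.comp_hasFDerivAt x
        ((hunC n).differentiable one_ne_zero x).hasFDerivAt
    have h2 : inner ℝ (gradient (f ∘ un n) x) v = fderiv ℝ (f ∘ un n) x v := by simp [gradient]
    rw [h2, h1.fderiv, inner_smul_left]
    simp only [smul_apply, smul_eq_mul]
    rw [h.fderiv_mollify hU.measurableSet hu hG (hball n x hx) v]
    rfl
  have hVmono : ∀ {F : Euc N → ℝ}, Integrable F → (∀ x, 0 ≤ F x) → ∫ x in V, F x ≤ ∫ x, F x :=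
    fun hF h0 => setIntegral_le_integral hF (Eventually.of_forall h0)
  have hunI : ∀ n, Integrable (un n) := fun n => integrable_mollify _ hu'
  have hGnI : ∀ n, Integrable (Gn n) := fun n => integrable_mollify _ hG'
  have htu : Tendsto (fun n => ∫ x, ‖un n x - U.indicator u x‖) atTop (𝓝 0) :=
    (tendsto_integral_norm_mollify_sub hu').comp (tendsto_add_atTop_nat n₀)
  have htG : Tendsto (fun n => ∫ x, ‖Gn n x - U.indicator G x‖) atTop (𝓝 0) :=
    (tendsto_integral_norm_mollify_sub hG').comp (tendsto_add_atTop_nat n₀)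
  have hVmem : ∀ᵐ x ∂volume.restrict V, x ∈ V := ae_restrict_mem hVo.measurableSet
  have hfun : ∀ n, IntegrableOn (fun x => f (un n x) - f (u x)) V := by
    intro n
    refine (((hunI n).sub hu').norm.const_mul C).integrableOn.mono'
      ((hf.continuous.comp (hunC n).continuous).aestronglyMeasurable.sub
        (hfu.mono_set hVU).aestronglyMeasurable) ?_
    filter_upwards [hVmem] with x hx
    refine (hlip _ _).trans_eq ?_
    simp [indicator_of_mem (hVU hx)]
  refine of_tendsto hgrad (fun n => ?_) (fun n => ?_) (hfu.mono_set hVU) (hfG.mono_set hVU) ?_ ?_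
  · exact ((hfun n).add (hfu.mono_set hVU)).congr (Eventually.of_forall fun x => by simp)
  · exact ((hGnI n).integrableOn).bdd_smul C
      (hf'c.comp (hunC n).continuous).aestronglyMeasurable (Eventually.of_forall fun x => hC _)
  · have hb1 := htu.const_mul C
    rw [mul_zero] at hb1
    refine squeeze_zero (fun n => integral_nonneg fun x => norm_nonneg _) (fun n => ?_) hb1
    calc ∫ x in V, ‖f (un n x) - f (u x)‖
        ≤ ∫ x in V, C * ‖un n x - U.indicator u x‖ := by
          refine integral_mono_ae (hfun n).norm
            (((hunI n).sub hu').norm.const_mul C).integrableOn ?_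
          filter_upwards [hVmem] with x hx
          rw [indicator_of_mem (hVU hx)]
          exact hlip _ _
      _ ≤ ∫ x, C * ‖un n x - U.indicator u x‖ :=
          hVmono (((hunI n).sub hu').norm.const_mul C) fun x => by positivity
      _ = _ := integral_const_mul _ _
  · -- split off the difference of the gradients, and use dominated convergence for the rest
    have hae : ∀ᵐ x, Tendsto (fun n => un n x) atTop (𝓝 (U.indicator u x)) := by
      filter_upwards [ae_tendsto_mollify hu'.locallyIntegrable] with x hx
      exact hx.comp (tendsto_add_atTop_nat n₀)
    have hR : Tendsto (fun n => ∫ x in V, ‖(deriv f (un n x) - deriv f (u x)) • G x‖) atTop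
        (𝓝 (∫ x in V, (0 : ℝ))) := by
      refine tendsto_integral_of_dominated_convergence (fun x => (C + C) * ‖G x‖) (fun n => ?_)
        ((hG.mono_set hVU).norm.const_mul _) (fun n => ?_) ?_
      · exact (((hf'c.comp (hunC n).continuous).aestronglyMeasurable.sub
          (hf'c.comp_aestronglyMeasurable (hu.mono_set hVU).aestronglyMeasurable)).smul
          (hG.mono_set hVU).aestronglyMeasurable).norm
      · refine Eventually.of_forall fun x => ?_
        rw [norm_norm, norm_smul]
        gcongr
        exact (norm_sub_le _ _).trans (add_le_add (hC _) (hC _))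
      · filter_upwards [ae_restrict_of_ae hae, hVmem] with x hx hxV
        rw [indicator_of_mem (hVU hxV)] at hx
        have h1 : Tendsto (fun n => ‖(deriv f (un n x) - deriv f (u x)) • G x‖) atTop
            (𝓝 ‖(deriv f (u x) - deriv f (u x)) • G x‖) :=
          ((((hf'c.tendsto _).comp hx).sub_const _).smul_const _).norm
        simpa using h1
    have hb1 := (htG.const_mul C).add hR
    rw [mul_zero, integral_zero, add_zero] at hb1
    refine squeeze_zero (fun n => integral_nonneg fun x => norm_nonneg _) (fun n => ?_) hb1
    have i1 : Integrable (fun x => C * ‖Gn n x - U.indicator G x‖) :=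
      ((hGnI n).sub hG').norm.const_mul C
    have i2 : IntegrableOn (fun x => ‖(deriv f (un n x) - deriv f (u x)) • G x‖) V := by
      refine ((hG.mono_set hVU).bdd_smul (C + C)
        ((hf'c.comp (hunC n).continuous).aestronglyMeasurable.sub
          (hf'c.comp_aestronglyMeasurable (hu.mono_set hVU).aestronglyMeasurable))
        (Eventually.of_forall fun x => ?_)).norm
      exact (norm_sub_le _ _).trans (add_le_add (hC _) (hC _))
    have i3 : IntegrableOn (fun x => deriv f (un n x) • Gn n x) V :=
      ((hGnI n).integrableOn).bdd_smul C
        (hf'c.comp (hunC n).continuous).aestronglyMeasurable (Eventually.of_forall fun x => hC _)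
    calc ∫ x in V, ‖deriv f (un n x) • Gn n x - deriv f (u x) • G x‖
        ≤ ∫ x in V, (C * ‖Gn n x - U.indicator G x‖ +
            ‖(deriv f (un n x) - deriv f (u x)) • G x‖) := by
          refine integral_mono_ae (i3.sub (hfG.mono_set hVU)).norm (i1.integrableOn.add i2) ?_
          filter_upwards [hVmem] with x hx
          rw [indicator_of_mem (hVU hx)]
          have e : deriv f (un n x) • Gn n x - deriv f (u x) • G x =
              deriv f (un n x) • (Gn n x - G x) + (deriv f (un n x) - deriv f (u x)) • G x := by
            rw [smul_sub, sub_smul]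
            abel
          rw [e]
          refine (norm_add_le _ _).trans ?_
          gcongr
          rw [norm_smul]
          gcongr
          exact hC _
      _ = (∫ x in V, C * ‖Gn n x - U.indicator G x‖) +
            ∫ x in V, ‖(deriv f (un n x) - deriv f (u x)) • G x‖ :=
          integral_add i1.integrableOn i2
      _ ≤ _ := by
          gcongr
          refine (hVmono i1 fun x => by positivity).trans_eq (integral_const_mul _ _)

end HasWeakGradient

/-- The function `‖·‖ ^ r` lies above its tangent at `z`. -/
theorem norm_rpow_tangent_le {F : Type*} [NormedAddCommGroup F] [InnerProductSpace ℝ F] {r : ℝ}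
    (hr : 2 ≤ r) (a : F) {z : F} (hz : z ≠ 0) :
    ‖z‖ ^ r + r * (‖z‖ ^ (r - 2) * inner ℝ z (a - z)) ≤ ‖a‖ ^ r := by
  have hz0 : 0 < ‖z‖ := norm_pos_iff.2 hz
  have h1 := one_add_mul_self_le_rpow_one_add (s := ‖a‖ / ‖z‖ - 1)
    (by linarith [div_nonneg (norm_nonneg a) hz0.le]) (show 1 ≤ r by linarith)
  rw [add_sub_cancel, Real.div_rpow (norm_nonneg _) hz0.le, le_div_iff₀ (by positivity)] at h1
  refine le_trans ?_ h1
  have h2 : inner ℝ z (a - z) ≤ ‖z‖ * (‖a‖ - ‖z‖) := by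
    rw [inner_sub_right, real_inner_self_eq_norm_sq]
    linarith [real_inner_le_norm z a]
  have h3 : ‖z‖ ^ r = ‖z‖ ^ (r - 2) * ‖z‖ ^ 2 := by
    rw [← Real.rpow_natCast, ← Real.rpow_add hz0]
    norm_num
  calc ‖z‖ ^ r + r * (‖z‖ ^ (r - 2) * inner ℝ z (a - z))
      ≤ ‖z‖ ^ r + r * (‖z‖ ^ (r - 2) * (‖z‖ * (‖a‖ - ‖z‖))) := by gcongr
    _ = _ := by
      rw [h3]
      field_simp

theorem norm_add_smul_rpow_le {F : Type*} [NormedAddCommGroup F] [InnerProductSpace ℝ F] {r t : ℝ}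
    (hr : 2 ≤ r) (ht0 : 0 ≤ t) (ht1 : t ≤ 1) (a : F) {z : F} (hz : z ≠ 0) :
    ‖a + t • (z - a)‖ ^ r ≤ ‖a‖ ^ r + r * (‖z‖ ^ (r - 2) * inner ℝ z (t • (z - a))) := by
  have h1 := norm_smul_add_smul_rpow_le (show 1 ≤ r by linarith) (sub_nonneg.2 ht1) ht0
    (by ring) a z
  have h2 := norm_rpow_tangent_le hr a hz
  have e : a + t • (z - a) = (1 - t) • a + t • z := by
    rw [sub_smul, one_smul, smul_sub]
    abel
  rw [e]
  refine h1.trans ?_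
  rw [inner_smul_right, ← neg_sub a z, inner_neg_right]
  nlinarith

/-! ### The infinity Laplacian and the divergence of `|∇Q|^(k-2) ∇Q` -/

theorem pderiv_eq_inner_gradient (i : Fin N) (Q : Euc N → ℝ) (x : Euc N) :
    pderiv i Q x = inner ℝ (gradient Q x) (EuclideanSpace.single i 1) := by
  simp [pderiv, gradient]

theorem pderiv_neg (i : Fin N) (φ : Euc N → ℝ) (x : Euc N) :
    pderiv i (fun y => -φ y) x = -pderiv i φ x := by
  simp [pderiv, fderiv_fun_neg]

theorem infLaplacian_neg (φ : Euc N → ℝ) (x : Euc N) :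
    infLaplacian (fun y => -φ y) x = -infLaplacian φ x := by
  have h : ∀ j, pderiv j (fun y => -φ y) = fun y => -pderiv j φ y := fun j =>
    funext fun y => pderiv_neg j φ y
  simp only [infLaplacian, h, pderiv_neg]
  rw [← Finset.sum_neg_distrib]
  refine Finset.sum_congr rfl fun i _ => ?_
  rw [← Finset.sum_neg_distrib]
  exact Finset.sum_congr rfl fun j _ => by ring

theorem contDiff_gradient {Q : Euc N → ℝ} (hQ : ContDiff ℝ ∞ Q) : ContDiff ℝ ∞ (gradient Q) :=
  (InnerProductSpace.toDual ℝ (Euc N)).symm.contDiff.comp (hQ.fderiv_right (m := ∞) (by simp))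

theorem contDiff_pderiv {Q : Euc N → ℝ} (hQ : ContDiff ℝ ∞ Q) (i : Fin N) :
    ContDiff ℝ ∞ (pderiv i Q) :=
  (hQ.fderiv_right (m := ∞) (by simp)).clm_apply contDiff_const

theorem inner_eq_sum_single (a b : Euc N) : inner ℝ a b =
    ∑ j, inner ℝ a (EuclideanSpace.single j 1) * inner ℝ b (EuclideanSpace.single j 1) := by
  rw [← (EuclideanSpace.basisFun (Fin N) ℝ).sum_inner_mul_inner a b]
  refine Finset.sum_congr rfl fun j _ => ?_
  rw [EuclideanSpace.basisFun_apply, real_inner_comm b]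

theorem inner_fderiv_gradient {Q : Euc N → ℝ} (hQ : ContDiff ℝ ∞ Q) (x v : Euc N) (j : Fin N) :
    inner ℝ (fderiv ℝ (gradient Q) x v) (EuclideanSpace.single j 1) =
      fderiv ℝ (pderiv j Q) x v := by
  have h1 : pderiv j Q = fun y => inner ℝ (gradient Q y) (EuclideanSpace.single j 1) :=
    funext fun y => pderiv_eq_inner_gradient j Q y
  have h2 := ((contDiff_gradient hQ).differentiable (by simp) x).hasFDerivAt.inner ℝ
    (hasFDerivAt_const (EuclideanSpace.single j (1 : ℝ)) x)
  rw [h1, h2.fderiv]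
  simp

/-- The components of the vector field `|∇Q|^r ∇Q`. -/
def gradFlux (Q : Euc N → ℝ) (r : ℝ) (i : Fin N) (x : Euc N) : ℝ :=
  ‖gradient Q x‖ ^ r * pderiv i Q x

theorem contDiffAt_gradFlux {Q : Euc N → ℝ} (hQ : ContDiff ℝ ∞ Q) (r : ℝ) (i : Fin N) {x : Euc N}
    (hx : gradient Q x ≠ 0) : ContDiffAt ℝ ∞ (gradFlux Q r i) x :=
  (((contDiff_gradient hQ).contDiffAt.norm ℝ hx).rpow_const_of_ne (norm_ne_zero_iff.2 hx)).mul
    (contDiff_pderiv hQ i).contDiffAt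

/-- The divergence of `|∇Q|^r ∇Q`: for large `r` the infinity Laplacian dominates. -/
theorem sum_fderiv_gradFlux {Q : Euc N → ℝ} (hQ : ContDiff ℝ ∞ Q) {r : ℝ} (hr : 1 < r)
    {x : Euc N} (hx : gradient Q x ≠ 0) :
    ∑ i, fderiv ℝ (gradFlux Q r i) x (EuclideanSpace.single i 1) = ‖gradient Q x‖ ^ (r - 2) *
      (r * infLaplacian Q x + ‖gradient Q x‖ ^ 2 * ∑ i, pderiv i (pderiv i Q) x) := by
  have hpow : ‖gradient Q x‖ ^ r = ‖gradient Q x‖ ^ (r - 2) * ‖gradient Q x‖ ^ 2 := by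
    rw [← Real.rpow_natCast, ← Real.rpow_add (norm_pos_iff.2 hx)]
    norm_num
  have hi : ∀ i, fderiv ℝ (gradFlux Q r i) x (EuclideanSpace.single i 1) =
      ‖gradient Q x‖ ^ (r - 2) * (r * (∑ j, pderiv i Q x * pderiv j Q x * pderiv i (pderiv j Q) x)
        + ‖gradient Q x‖ ^ 2 * pderiv i (pderiv i Q) x) := by
    intro i
    have h1 : HasFDerivAt (fun y => ‖gradient Q y‖ ^ r)
        (((r * ‖gradient Q x‖ ^ (r - 2)) • innerSL ℝ (gradient Q x)) ∘L
          fderiv ℝ (gradient Q) x) x :=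
      (hasFDerivAt_norm_rpow (gradient Q x) hr).comp x
        ((contDiff_gradient hQ).differentiable (by simp) x).hasFDerivAt
    have h2 : HasFDerivAt (pderiv i Q) (fderiv ℝ (pderiv i Q) x) x :=
      ((contDiff_pderiv hQ i).differentiable (by simp) x).hasFDerivAt
    have h3 : HasFDerivAt (gradFlux Q r i) _ x := h1.mul h2
    have h4 : inner ℝ (gradient Q x) (fderiv ℝ (gradient Q) x (EuclideanSpace.single i 1)) =
        ∑ j, pderiv j Q x * pderiv i (pderiv j Q) x := by
      rw [inner_eq_sum_single]
      refine Finset.sum_congr rfl fun j _ => ?_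
      rw [inner_fderiv_gradient hQ, ← pderiv_eq_inner_gradient]
      rfl
    rw [h3.fderiv]
    simp only [add_apply, smul_apply, ContinuousLinearMap.comp_apply, innerSL_apply_apply,
      smul_eq_mul, h4]
    simp only [mul_assoc (pderiv i Q x)]
    rw [← Finset.mul_sum, hpow]
    simp only [pderiv]
    ring
  simp only [hi]
  rw [← Finset.mul_sum, Finset.sum_add_distrib, ← Finset.mul_sum, ← Finset.mul_sum]
  rfl

/-! ### Reduction to smooth test functions -/

theorem pderiv_pderiv {φ : Euc N → ℝ} {x : Euc N} (h : DifferentiableAt ℝ (fderiv ℝ φ) x)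
    (i j : Fin N) : pderiv i (pderiv j φ) x =
      fderiv ℝ (fderiv ℝ φ) x (EuclideanSpace.single i 1) (EuclideanSpace.single j 1) := by
  have h1 := h.hasFDerivAt.clm_apply (hasFDerivAt_const (EuclideanSpace.single j (1 : ℝ)) x)
  have h2 : HasFDerivAt (pderiv j φ) _ x := h1
  rw [pderiv, h2.fderiv]
  simp

theorem gradient_eq_sum (φ : Euc N → ℝ) (x : Euc N) :
    gradient φ x = ∑ i, pderiv i φ x • EuclideanSpace.single i (1 : ℝ) := by
  refine ext_inner_right ℝ fun v => ?_
  rw [inner_eq_sum_single, sum_inner]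
  refine Finset.sum_congr rfl fun i _ => ?_
  rw [inner_smul_left, pderiv_eq_inner_gradient, real_inner_comm v]
  simp

/-- `Δ_∞ φ` is the second derivative in the direction of the gradient. -/
theorem infLaplacian_eq {φ : Euc N → ℝ} {x : Euc N} (h : DifferentiableAt ℝ (fderiv ℝ φ) x) :
    infLaplacian φ x = fderiv ℝ (fderiv ℝ φ) x (gradient φ x) (gradient φ x) := by
  rw [gradient_eq_sum]
  simp only [map_sum, sum_apply, map_smul, smul_apply, smul_eq_mul, Finset.mul_sum]
  rw [infLaplacian, Finset.sum_comm]
  refine Finset.sum_congr rfl fun j _ => Finset.sum_congr rfl fun i _ => ?_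
  rw [pderiv_pderiv h]
  ring

/-- Second order Taylor expansion. -/
theorem eventually_abs_sub_taylor_le {φ : Euc N → ℝ} {x₀ : Euc N} (hφ : ContDiffAt ℝ 2 φ x₀)
    {ε : ℝ} (hε : 0 < ε) : ∀ᶠ x in 𝓝 x₀, |φ x - (φ x₀ + fderiv ℝ φ x₀ (x - x₀) +
      1 / 2 * fderiv ℝ (fderiv ℝ φ) x₀ (x - x₀) (x - x₀))| ≤ ε * ‖x - x₀‖ ^ 2 := by
  set B := fderiv ℝ (fderiv ℝ φ) x₀ with hB
  have hsymm : ∀ v w, B v w = B w v :=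
    fun v w => (hφ.isSymmSndFDerivAt (by simp)).eq v w
  have hd : HasFDerivAt (fderiv ℝ φ) B x₀ :=
    ((hφ.fderiv_right (m := 1) le_rfl).differentiableAt one_ne_zero).hasFDerivAt
  have h1 : ∀ᶠ x in 𝓝 x₀, ‖fderiv ℝ φ x - fderiv ℝ φ x₀ - B (x - x₀)‖ ≤ ε * ‖x - x₀‖ :=
    hd.isLittleO.def hε
  have h2 : ∀ᶠ x in 𝓝 x₀, ContDiffAt ℝ 2 φ x := hφ.eventually (by simp)
  obtain ⟨δ, hδ, hball⟩ := Metric.eventually_nhds_iff_ball.1 (h1.and h2)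
  filter_upwards [Metric.ball_mem_nhds x₀ hδ] with x hx
  set R : Euc N → ℝ := fun y => φ y - (φ x₀ + fderiv ℝ φ x₀ (y - x₀) +
      1 / 2 * B (y - x₀) (y - x₀)) with hR
  have hRd : ∀ y ∈ Metric.ball x₀ δ,
      HasFDerivAt R (fderiv ℝ φ y - fderiv ℝ φ x₀ - B (y - x₀)) y := by
    intro y hy
    have e1 := ((hball y hy).2.differentiableAt two_ne_zero).hasFDerivAt
    have e0 : HasFDerivAt (fun z => z - x₀) (ContinuousLinearMap.id ℝ (Euc N)) y :=
      (hasFDerivAt_id y).sub_const x₀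
    have e2 := (fderiv ℝ φ x₀).hasFDerivAt.comp y e0
    have e3 := ((B.hasFDerivAt.comp y e0).clm_apply e0).const_mul (1 / 2 : ℝ)
    refine (e1.sub ((e2.const_add (φ x₀)).add e3)).congr_fderiv ?_
    ext v
    simp [hsymm v y, hsymm v x₀]
    ring
  have hsub : Metric.closedBall x₀ ‖x - x₀‖ ⊆ Metric.ball x₀ δ :=
    Metric.closedBall_subset_ball (by rwa [← dist_eq_norm])
  have h3 := (convex_closedBall x₀ ‖x - x₀‖).norm_image_sub_le_of_norm_hasFDerivWithin_le
    (f := R) (C := ε * ‖x - x₀‖) (x := x₀) (y := x)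
    (fun y hy => (hRd y (hsub hy)).hasFDerivWithinAt)
    (fun y hy => ((hball y (hsub hy)).1).trans (by
      gcongr
      rw [← dist_eq_norm]
      exact hy))
    (Metric.mem_closedBall_self (norm_nonneg _)) (by simp [dist_eq_norm])
  have hR0 : R x₀ = 0 := by simp [hR]
  rw [hR0, sub_zero, Real.norm_eq_abs] at h3
  refine h3.trans_eq ?_
  ring

/-- A test function that touches `u` locally from below at a point where its infinity Laplacian is
positive can be replaced by a polynomial touching strictly and globally. -/
theorem exists_smooth_touching {U : Set (Euc N)} (hb : Bornology.IsBounded U) {u φ : Euc N → ℝ}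
    (hu : ContinuousOn u (closure U)) {x₀ : Euc N} (hφ : ContDiffAt ℝ 2 φ x₀)
    (hmin : IsLocalMin (fun x => u x - φ x) x₀) (hpos : 0 < infLaplacian φ x₀) :
    ∃ Q : Euc N → ℝ, ContDiff ℝ ∞ Q ∧ 0 < infLaplacian Q x₀ ∧
      ∀ x ∈ closure U, x ≠ x₀ → u x₀ - Q x₀ < u x - Q x := by
  set B := fderiv ℝ (fderiv ℝ φ) x₀ with hB
  set l := fderiv ℝ φ x₀ with hl
  have hsymm : ∀ v w, B v w = B w v :=
    fun v w => (hφ.isSymmSndFDerivAt (by simp)).eq v w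
  have hd : DifferentiableAt ℝ (fderiv ℝ φ) x₀ :=
    (hφ.fderiv_right (m := 1) le_rfl).differentiableAt one_ne_zero
  set z := gradient φ x₀ with hz
  have hI : infLaplacian φ x₀ = B z z := infLaplacian_eq hd
  rw [hI] at hpos
  set ε : ℝ := B z z / (2 * (‖z‖ ^ 2 + 1)) with hε
  have hε0 : 0 < ε := by positivity
  set T : Euc N → ℝ := fun x => φ x₀ + l (x - x₀) + 1 / 2 * B (x - x₀) (x - x₀) with hT
  have hTc : ContDiff ℝ ∞ T := by
    have e0 : ContDiff ℝ ∞ fun x : Euc N => x - x₀ := contDiff_id.sub contDiff_const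
    exact (contDiff_const.add (l.contDiff.comp e0)).add
      (contDiff_const.mul ((B.contDiff.comp e0).clm_apply e0))
  obtain ⟨δ, hδ, hball⟩ := Metric.eventually_nhds_iff_ball.1
    ((eventually_abs_sub_taylor_le hφ (half_pos hε0)).and hmin)
  -- the quartic term makes the touching global
  obtain ⟨K, hK⟩ := (Metric.isCompact_of_isClosed_isBounded isClosed_closure
    hb.closure).exists_bound_of_continuousOn (hu.sub hTc.continuous.continuousOn)
  set M : ℝ := (|u x₀ - φ x₀| + |K| + 1) / δ ^ 4 with hM
  have hM0 : 0 < M := by positivity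
  set Q : Euc N → ℝ := fun x => T x - (ε * ‖x - x₀‖ ^ 2 + M * (‖x - x₀‖ ^ 2) ^ 2) with hQ
  have hsq : ContDiff ℝ ∞ fun x : Euc N => ‖x - x₀‖ ^ 2 :=
    (contDiff_id.sub contDiff_const).norm_sq ℝ
  have hQc : ContDiff ℝ ∞ Q :=
    hTc.sub ((contDiff_const.mul hsq).add (contDiff_const.mul (hsq.pow 2)))
  set J : Euc N →L[ℝ] Euc N →L[ℝ] ℝ := isBoundedBilinearMap_inner.toContinuousLinearMap with hJ
  have hJa : ∀ v w, J v w = inner ℝ v w := fun v w => rfl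
  have hQ1 : ∀ x, HasFDerivAt Q (l + B (x - x₀) -
      (2 * ε + 4 * M * ‖x - x₀‖ ^ 2) • J (x - x₀)) x := by
    intro x
    have e0 : HasFDerivAt (fun z => z - x₀) (ContinuousLinearMap.id ℝ (Euc N)) x :=
      (hasFDerivAt_id x).sub_const x₀
    have e2 := l.hasFDerivAt.comp x e0
    have e3 := ((B.hasFDerivAt.comp x e0).clm_apply e0).const_mul (1 / 2 : ℝ)
    have e4 := e0.norm_sq
    have e5 := (e4.const_mul ε).add ((e4.pow 2).const_mul M)
    refine (((e2.const_add (φ x₀)).add e3).sub e5).congr_fderiv ?_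
    ext v
    simp [hsymm v x, hsymm v x₀, hJa]
    ring
  have hQ1' : fderiv ℝ Q = fun x => l + B (x - x₀) -
      (2 * ε + 4 * M * ‖x - x₀‖ ^ 2) • J (x - x₀) := funext fun x => (hQ1 x).fderiv
  have hQ2 : HasFDerivAt (fderiv ℝ Q) (B - (2 * ε) • J) x₀ := by
    rw [hQ1']
    have e0 : HasFDerivAt (fun z => z - x₀) (ContinuousLinearMap.id ℝ (Euc N)) x₀ :=
      (hasFDerivAt_id x₀).sub_const x₀
    have e3 := (B.hasFDerivAt.comp x₀ e0).const_add l
    have e4 := (e0.norm_sq.const_mul (4 * M)).const_add (2 * ε)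
    have e5 := e4.smul (J.hasFDerivAt.comp x₀ e0)
    refine (e3.sub e5).congr_fderiv ?_
    ext v w
    simp [hJa]
  have hgr : gradient Q x₀ = z := by
    rw [gradient, hQ1', hz, gradient]
    simp [hl]
  refine ⟨Q, hQc, ?_, ?_⟩
  · rw [infLaplacian_eq hQ2.differentiableAt, hQ2.fderiv, hgr]
    simp only [sub_apply, smul_apply, hJa, smul_eq_mul, real_inner_self_eq_norm_sq]
    have : 2 * ε * ‖z‖ ^ 2 = B z z * (‖z‖ ^ 2 / (‖z‖ ^ 2 + 1)) := by
      rw [hε]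
      field_simp
    rw [this]
    have h1 : ‖z‖ ^ 2 / (‖z‖ ^ 2 + 1) < 1 := by
      rw [div_lt_one (by positivity)]
      linarith
    nlinarith
  · intro x hx hne
    have hQ0 : Q x₀ = φ x₀ := by simp [hQ, hT]
    have hn : 0 < ‖x - x₀‖ := norm_pos_iff.2 (sub_ne_zero.2 hne)
    rw [hQ0]
    by_cases hxδ : x ∈ Metric.ball x₀ δ
    · obtain ⟨h1, h2⟩ := hball x hxδ
      have h3 := (abs_le.1 h1).1
      have h4 : 0 < M * (‖x - x₀‖ ^ 2) ^ 2 := by positivity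
      have h5 : 0 < ε / 2 * ‖x - x₀‖ ^ 2 := by positivity
      simp only [hQ, hT]
      have h2' : u x₀ - φ x₀ ≤ u x - φ x := h2
      linarith
    · have h1 : δ ≤ ‖x - x₀‖ := by
        rw [← dist_eq_norm]
        exact not_lt.1 hxδ
      have h2 : |u x₀ - φ x₀| + |K| + 1 ≤ M * (‖x - x₀‖ ^ 2) ^ 2 := by
        rw [← pow_mul]
        calc |u x₀ - φ x₀| + |K| + 1 = M * δ ^ 4 := by
              rw [hM]
              field_simp
          _ ≤ M * ‖x - x₀‖ ^ (2 * 2) := by gcongr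
      have h3 : -|K| ≤ u x - T x :=
        (neg_le_neg ((hK x hx).trans (le_abs_self K))).trans (neg_abs_le _)
      have h4 := le_abs_self (u x₀ - φ x₀)
      have h5 : 0 < ε * ‖x - x₀‖ ^ 2 := by positivity
      simp only [hQ]
      linarith

/-! ### Infinity harmonicity of the limit -/

namespace IsVariationalSetting

variable {Ω D : Set (Euc N)} {p : Euc N → ℝ≥0∞} {g : Euc N → ℝ}

/-- Comparing a minimizer `w` with `w + η`, where `η` varies only inside `D`. -/
theorem setIntegral_nonneg_of_isMinimizer (S : IsVariationalSetting Ω D p g) {k : ℕ}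
    (hk : pPlus Ω D p < k) {w η F : Euc N → ℝ} {H : Euc N → Euc N}
    (hw : IsMinimizer (energy Ω p g k) (admissible Ω p k) w) (hwc : ContinuousOn w (closure Ω))
    (hη : ContinuousOn η (closure Ω)) (hη0 : ∀ x ∈ frontier Ω, η x = 0)
    (hH : HasWeakGradient Ω η H) (hH0 : ∀ x ∈ Ω \ closure D, H x = 0) (hF : IntegrableOn F D)
    (hle : ∀ x ∈ D, ‖weakGrad Ω w x + H x‖ ^ (k : ℝ) ≤ ‖weakGrad Ω w x‖ ^ (k : ℝ) + F x) :
    0 ≤ ∫ x in D, F x := by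
  set G := weakGrad Ω w with hG
  have hGw : HasWeakGradient Ω w G := S.hasWeakGradient hw.1
  have hk0 : (0 : ℝ) < k := by linarith [S.q_le_k hk, S.two_le_q]
  have hfin : gradEnergy Ω p k G < ⊤ := S.gradEnergy_lt_top hk hw.1
  have hfin' := hfin
  rw [S.gradEnergy_eq_add hk, ENNReal.add_lt_top] at hfin'
  have hGD : AEStronglyMeasurable G (volume.restrict D) :=
    (hGw.mono S.D_subset).2.1.aestronglyMeasurable
  have hHD : AEStronglyMeasurable H (volume.restrict D) :=
    (hH.mono S.D_subset).2.1.aestronglyMeasurable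
  have hmeas : ∀ {K : Euc N → Euc N}, AEStronglyMeasurable K (volume.restrict D) →
      AEStronglyMeasurable (fun x => 1 / (k : ℝ) * ‖K x‖ ^ (k : ℝ)) (volume.restrict D) :=
    fun hK => ((hK.norm.aemeasurable.pow_const _).const_mul _).aestronglyMeasurable
  have hnn : ∀ (K : Euc N → Euc N) x, 0 ≤ 1 / (k : ℝ) * ‖K x‖ ^ (k : ℝ) := fun K x => by positivity
  have iG : IntegrableOn (fun x => 1 / (k : ℝ) * ‖G x‖ ^ (k : ℝ)) D := by
    refine ⟨hmeas hGD, ?_⟩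
    rw [hasFiniteIntegral_iff_ofReal (Eventually.of_forall (hnn G))]
    exact hfin'.1
  have iF : IntegrableOn (fun x => 1 / (k : ℝ) * F x) D := hF.const_mul _
  have hDmem := ae_restrict_mem (μ := volume) S.isOpen_D.measurableSet
  have hle' : ∀ x ∈ D, 1 / (k : ℝ) * ‖G x + H x‖ ^ (k : ℝ) ≤
      1 / (k : ℝ) * ‖G x‖ ^ (k : ℝ) + 1 / (k : ℝ) * F x := by
    intro x hx
    rw [← mul_add]
    gcongr
    exact hle x hx
  have iGH : IntegrableOn (fun x => 1 / (k : ℝ) * ‖G x + H x‖ ^ (k : ℝ)) D := by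
    refine (iG.add iF).mono' (hmeas (hGD.add hHD)) ?_
    filter_upwards [hDmem] with x hx
    rw [Real.norm_of_nonneg (by positivity)]
    exact hle' x hx
  have eG : (modular D (fun _ => 1 / k) (fun _ => k) G).toReal =
      ∫ x in D, 1 / (k : ℝ) * ‖G x‖ ^ (k : ℝ) := by
    rw [integral_eq_lintegral_of_nonneg_ae (Eventually.of_forall (hnn G)) (hmeas hGD)]
    rfl
  have eGH : (modular D (fun _ => 1 / k) (fun _ => k) fun x => G x + H x).toReal =
      ∫ x in D, 1 / (k : ℝ) * ‖G x + H x‖ ^ (k : ℝ) := by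
    rw [integral_eq_lintegral_of_nonneg_ae (Eventually.of_forall fun x => hnn (fun y => G y + H y) x)
      (hmeas (hGD.add hHD))]
    rfl
  have hinn : modular D (fun _ => 1 / k) (fun _ => k) (fun x => G x + H x) < ⊤ := by
    have h1 := iGH.2
    rwa [hasFiniteIntegral_iff_ofReal
      (Eventually.of_forall fun x => hnn (fun y => G y + H y) x)] at h1
  have hout : outerEnergy Ω D p (fun x => G x + H x) = outerEnergy Ω D p G :=
    setLIntegral_congr_fun S.isOpen_diff.measurableSet fun x hx => by simp only [hH0 x hx, add_zero]
  have hfinGH : gradEnergy Ω p k (fun x => G x + H x) < ⊤ := by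
    rw [S.gradEnergy_eq_add hk, hout]
    exact ENNReal.add_lt_top.2 ⟨hinn, hfin'.2⟩
  -- the competitor, corrected by a constant to have mean zero
  set c : ℝ := (∫ x in Ω, η x) / (volume Ω).toReal with hc
  have hvol : 0 < (volume Ω).toReal :=
    ENNReal.toReal_pos (S.isOpen.measure_pos volume S.isConnected.nonempty).ne'
      S.isBounded.measure_lt_top.ne
  set v : Euc N → ℝ := fun x => w x + η x + -c with hv
  have hvc : ContinuousOn v (closure Ω) := (hwc.add hη).add continuousOn_const
  have hvG : HasWeakGradient Ω v (fun x => G x + H x) := (hGw.add hH).add_const (-c)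
  have iw := integrableOn_of_continuousOn_closure S.isBounded hwc
  have iη := integrableOn_of_continuousOn_closure S.isBounded hη
  have hmean : ∫ x in Ω, v x = 0 := by
    have e1 := integral_add (iw.add iη)
      (integrableOn_const (C := -c) S.isBounded.measure_lt_top.ne)
    have e2 := integral_add iw iη
    simp only [Pi.add_apply] at e1 e2
    rw [hv, e1, e2, hw.1.2, setIntegral_const, smul_eq_mul, hc, Measure.real]
    field_simp
    ring
  have hmin := hw.2 v (S.mem_admissible hk hvc hvG hfinGH hmean)
  have hB : boundaryInt Ω g v = boundaryInt Ω g w := by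
    rw [boundaryInt_congr (w := fun x => w x + -c) fun x hx => by simp [hv, hη0 x hx],
      boundaryInt_add S.isBounded S.surface_lt_top S.continuousOn_g hwc continuousOn_const,
      boundaryInt_const S.integral_g, add_zero]
  rw [S.energy_eq hk hvc (ae_eq_refl _) hvG, S.energy_eq hk hwc (ae_eq_refl _) hGw, hB,
    S.gradEnergy_eq_add hk, S.gradEnergy_eq_add hk, hout, ENNReal.toReal_add hfin'.1.ne hfin'.2.ne,
    ENNReal.toReal_add hinn.ne hfin'.2.ne, eG, eGH] at hmin
  have hmono : ∫ x in D, 1 / (k : ℝ) * ‖G x + H x‖ ^ (k : ℝ) ≤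
      ∫ x in D, (1 / (k : ℝ) * ‖G x‖ ^ (k : ℝ) + 1 / (k : ℝ) * F x) := by
    refine integral_mono_ae iGH (iG.add iF) ?_
    filter_upwards [hDmem] with x hx
    exact hle' x hx
  rw [integral_add iG iF, integral_const_mul (1 / (k : ℝ)) F] at hmono
  have h1 : 0 ≤ 1 / (k : ℝ) * ∫ x in D, F x := by linarith
  exact (mul_nonneg_iff_of_pos_left (by positivity)).1 h1

end IsVariationalSetting

namespace IsLimitOfMinimizers

variable {Ω D : Set (Euc N)} {p : Euc N → ℝ≥0∞} {g : Euc N → ℝ} {k : ℕ → ℕ}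
  {w : ℕ → Euc N → ℝ} {u : Euc N → ℝ}

/-- The sign `s = 1` is the supersolution property, and `s = -1` the subsolution property. -/
theorem not_touching (S : IsVariationalSetting Ω D p g) (L : IsLimitOfMinimizers Ω D p g k w u)
    {Q : Euc N → ℝ} (hQ : ContDiff ℝ ∞ Q) {s : ℝ} (hs : s * s = 1) {x₀ : Euc N} (hx₀ : x₀ ∈ D)
    (hpos : 0 < s * infLaplacian Q x₀)
    (htouch : ∀ x ∈ closure Ω, x ≠ x₀ → s * (u x₀ - Q x₀) < s * (u x - Q x)) : False := by
  have habs : |s| = 1 := by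
    rcases mul_self_eq_one_iff.1 hs with h | h <;> simp [h]
  have hΩcl : D ⊆ closure Ω := S.D_subset.trans subset_closure
  have hcomp : IsCompact (closure Ω) :=
    Metric.isCompact_of_isClosed_isBounded isClosed_closure S.isBounded.closure
  -- a ball on which the infinity Laplacian is bounded away from zero
  have hIc : Continuous (infLaplacian Q) := continuous_finsetSum _ fun i _ =>
    continuous_finsetSum _ fun j _ => ((contDiff_pderiv hQ i).continuous.mul
      (contDiff_pderiv hQ j).continuous).mul
      (contDiff_pderiv (contDiff_pderiv hQ j) i).continuous
  set a := s * infLaplacian Q x₀ with ha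
  have h1 : ∀ᶠ x in 𝓝 x₀, a / 2 < s * infLaplacian Q x :=
    (hIc.const_mul s).continuousAt.eventually (lt_mem_nhds (by linarith))
  obtain ⟨ρ, hρ, hball⟩ := Metric.eventually_nhds_iff_ball.1 (h1.and (S.isOpen_D.mem_nhds hx₀))
  set b : ContDiffBump x₀ := ⟨ρ / 4, ρ / 2, by positivity, by linarith⟩ with hb
  have hsupp : tsupport b ⊆ Metric.ball x₀ ρ := by
    rw [b.tsupport_eq]
    exact Metric.closedBall_subset_ball (by simp only [hb]; linarith)
  have hbD : tsupport b ⊆ D := fun x hx => (hball x (hsupp hx)).2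
  have hgr : ∀ x ∈ Metric.ball x₀ ρ, gradient Q x ≠ 0 := by
    intro x hx h0
    have h2 := (hball x hx).1
    have h3 : infLaplacian Q x = 0 := by
      simp [infLaplacian, pderiv_eq_inner_gradient _ Q x, h0]
    rw [h3, mul_zero] at h2
    linarith
  set R : Euc N → ℝ := fun x => ‖gradient Q x‖ ^ 2 * ∑ i, pderiv i (pderiv i Q) x with hR
  have hRc : Continuous R := ((contDiff_gradient hQ).continuous.norm.pow 2).mul
    (continuous_finsetSum _ fun i _ => (contDiff_pderiv (contDiff_pderiv hQ i) i).continuous)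
  obtain ⟨M, hM⟩ := (isCompact_closedBall x₀ ρ).exists_bound_of_continuousOn hRc.continuousOn
  -- separation away from the touching point
  obtain ⟨m, hm, hmle⟩ := (hcomp.diff (Metric.isOpen_ball (x := x₀) (ε := ρ / 4))).exists_forall_le'
    (f := fun x => s * (u x - Q x)) (a := s * (u x₀ - Q x₀))
    ((continuousOn_const.mul (L.continuousOn_lim.sub hQ.continuous.continuousOn)).mono sdiff_subset)
    (fun x hx => htouch x hx.1 fun h => hx.2 (by rw [h]; exact Metric.mem_ball_self (by positivity)))
  set m₀ := s * (u x₀ - Q x₀) with hm₀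
  set δ := (m - m₀) / 2 with hδ
  have hδ0 : 0 < δ := by rw [hδ]; linarith
  -- fix a large index
  obtain ⟨j, hj, hkj⟩ := ((Metric.tendstoUniformlyOn_iff.1 L.tendsto δ hδ0).and
    ((tendsto_natCast_atTop_atTop.comp L.strictMono.tendsto_atTop).eventually
      (eventually_gt_atTop (2 * M / a + 4)))).exists
  have hkj' : 2 * M / a + 4 < (k j : ℝ) := hkj
  have hk := L.pPlus_lt j
  have hwc := L.continuousOn j
  have hmin := L.isMinimizer j
  set G := weakGrad Ω (w j) with hG
  have hGw : HasWeakGradient Ω (w j) G := S.hasWeakGradient hmin.1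
  have hM0 : 0 ≤ M := (norm_nonneg _).trans (hM x₀ (Metric.mem_closedBall_self hρ.le))
  have ha0 : 0 < a := hpos
  have hMa : 0 ≤ 2 * M / a := by positivity
  set r : ℝ := (k j : ℝ) - 2 with hr
  have hr1 : 1 < r := by rw [hr]; linarith
  have hrM : M < r * (a / 2) := by
    have h2 : 2 * M / a < r := by rw [hr]; linarith
    rw [div_lt_iff₀ ha0] at h2
    linarith
  set t : Euc N → ℝ := fun x => s * (Q x - w j x) + (m₀ + δ) with ht
  have htc : ContinuousOn t (closure Ω) :=
    (continuousOn_const.mul (hQ.continuous.continuousOn.sub hwc)).add continuousOn_const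
  have hclose : ∀ x ∈ closure Ω, |s * (u x - w j x)| < δ := by
    intro x hx
    rw [abs_mul, habs, one_mul, ← Real.dist_eq]
    exact hj x hx
  have ht0 : ∀ x ∈ closure Ω, x ∉ Metric.ball x₀ (ρ / 4) → t x ≤ 0 := by
    intro x hx hxb
    have h2 := hmle x ⟨hx, hxb⟩
    have h3 := (abs_lt.1 (hclose x hx)).2
    simp only [ht]
    nlinarith
  have htx₀ : 0 < t x₀ := by
    have h3 := (abs_lt.1 (hclose x₀ (hΩcl hx₀))).1
    simp only [ht, hm₀]
    nlinarith
  have htG : HasWeakGradient Ω t (fun x => s • (gradient Q x - G x)) := by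
    have h2 := ((HasWeakGradient.of_contDiff (U := Ω)
      (hQ.of_le (by exact_mod_cast le_top))).sub hGw).const_smul s
    exact h2.add_const (m₀ + δ)
  obtain ⟨f, hf, hf01, hf0, hfpos⟩ := exists_smooth_posPart
  set η : Euc N → ℝ := fun x => s * f (t x) with hη
  set H : Euc N → Euc N := fun x => deriv f (t x) • (gradient Q x - G x) with hH
  have hηG : HasWeakGradient Ω η H := by
    have h2 := (htG.comp S.isOpen S.isBounded
      (integrableOn_of_continuousOn_closure S.isBounded htc) ?_ hf
      (C := 1) fun y => by
        rw [Real.norm_of_nonneg (hf01 y).1]; exact (hf01 y).2).const_smul s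
    · refine h2.congr (ae_eq_refl _) (Eventually.of_forall fun x => ?_)
      simp only [hH]
      rw [smul_comm s, smul_smul s s, hs, one_smul]
    · refine Integrable.smul s (Integrable.sub ?_ ?_)
      · exact ((contDiff_gradient hQ).continuous.continuousOn.integrableOn_compact hcomp).mono_set
          subset_closure
      · exact integrableOn_of_lintegral_rpow_lt_top S.isBounded (by linarith [S.two_le_q])
          hGw.2.1.aestronglyMeasurable
          (S.lintegral_rpow_lt_top hk (S.gradEnergy_lt_top hk hmin.1))
  have hbball : ∀ x ∈ Metric.ball x₀ (ρ / 4), b =ᶠ[𝓝 x] 1 := fun x hx =>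
    b.eventuallyEq_one_of_mem_ball hx
  have hballρ : Metric.ball x₀ (ρ / 4) ⊆ Metric.ball x₀ ρ :=
    Metric.ball_subset_ball (by linarith)
  have hηc : ContinuousOn η (closure Ω) :=
    continuousOn_const.mul (hf.continuous.comp_continuousOn htc)
  have hη0 : ∀ x ∈ closure Ω, x ∉ Metric.ball x₀ (ρ / 4) → η x = 0 := fun x hx hxb => by
    simp only [hη]
    rw [(hf0 _ (ht0 x hx hxb)).1, mul_zero]
  have hH0 : ∀ x ∈ closure Ω, x ∉ Metric.ball x₀ (ρ / 4) → H x = 0 := fun x hx hxb => by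
    simp only [hH]
    rw [(hf0 _ (ht0 x hx hxb)).2, zero_smul]
  -- the localized vector field `|∇Q|^(k-2) ∇Q`
  set Φ : Fin N → Euc N → ℝ := fun i x => b x * gradFlux Q r i x with hΦ
  have hΦs : ∀ i, tsupport (Φ i) ⊆ tsupport b := fun i => closure_mono fun x hx => by
    rw [Function.mem_support] at hx ⊢
    exact left_ne_zero_of_mul hx
  have hΦc : ∀ i, HasCompactSupport (Φ i) := fun i =>
    b.hasCompactSupport.of_isClosed_subset (isClosed_tsupport _) (hΦs i)
  have hΦd : ∀ i, ContDiff ℝ ∞ (Φ i) := by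
    intro i
    rw [contDiff_iff_contDiffAt]
    intro x
    by_cases hx : x ∈ tsupport b
    · exact b.contDiff.contDiffAt.mul (contDiffAt_gradFlux hQ r i (hgr x (hsupp hx)))
    · refine contDiffAt_const (c := (0 : ℝ)) |>.congr_of_eventuallyEq ?_
      filter_upwards [(isClosed_tsupport b).isOpen_compl.mem_nhds hx] with y hy
      simp only [hΦ]
      rw [image_eq_zero_of_notMem_tsupport hy, zero_mul]
  have hηD : HasWeakGradient D η H := hηG.mono S.D_subset
  have hparts : ∀ i, ∫ x in D, η x * fderiv ℝ (Φ i) x (EuclideanSpace.single i 1) =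
      -∫ x in D, inner ℝ (H x) (EuclideanSpace.single i 1) * Φ i x := fun i =>
    hηD.2.2 (Φ i) (hΦd i) (hΦc i) ((hΦs i).trans hbD) _
  have hi1 : ∀ i ∈ Finset.univ, IntegrableOn
      (fun x => η x * fderiv ℝ (Φ i) x (EuclideanSpace.single i 1)) D := fun i _ =>
    hηD.integrable_left (hΦd i) (hΦc i) ((hΦs i).trans hbD) _
  have hi2 : ∀ i ∈ Finset.univ, IntegrableOn
      (fun x => inner ℝ (H x) (EuclideanSpace.single i 1) * Φ i x) D := fun i _ =>
    hηD.integrable_right (hΦd i) (hΦc i) ((hΦs i).trans hbD) _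
  set E : Euc N → ℝ := fun x => ∑ i, inner ℝ (H x) (EuclideanSpace.single i 1) * Φ i x with hE
  set V : Euc N → ℝ := fun x => ∑ i, η x * fderiv ℝ (Φ i) x (EuclideanSpace.single i 1) with hV
  have hVE : ∫ x in D, V x = -∫ x in D, E x := by
    rw [hV, hE, integral_finsetSum _ hi1, integral_finsetSum _ hi2, ← Finset.sum_neg_distrib]
    exact Finset.sum_congr rfl fun i _ => hparts i
  have hEi : IntegrableOn E D := integrable_finsetSum _ hi2
  have hVi : IntegrableOn V D := integrable_finsetSum _ hi1
  -- minimality gives one sign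
  have hEsign : 0 ≤ ∫ x in D, (k j : ℝ) * E x := by
    refine S.setIntegral_nonneg_of_isMinimizer hk hmin hwc hηc ?_ hηG ?_ (hEi.const_mul _) ?_
    · intro x hx
      refine hη0 x (frontier_subset_closure hx) fun hxb => ?_
      have h2 : x ∈ Ω := S.D_subset (hball x (hballρ hxb)).2
      rw [S.isOpen.frontier_eq] at hx
      exact hx.2 h2
    · intro x hx
      refine hH0 x (subset_closure hx.1) fun hxb => ?_
      exact hx.2 (subset_closure (hball x (hballρ hxb)).2)
    · intro x hx
      by_cases hxb : x ∈ Metric.ball x₀ (ρ / 4)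
      · have h2 := norm_add_smul_rpow_le (r := (k j : ℝ)) (by linarith) (hf01 (t x)).1
          (hf01 (t x)).2 (G x) (hgr x (hballρ hxb))
        have h3 : E x = ‖gradient Q x‖ ^ ((k j : ℝ) - 2) * inner ℝ (gradient Q x) (H x) := by
          simp only [hE]
          rw [inner_eq_sum_single (gradient Q x), Finset.mul_sum]
          refine Finset.sum_congr rfl fun i _ => ?_
          have h4 : b x = 1 := (hbball x hxb).self_of_nhds
          simp only [hΦ, gradFlux, h4, one_mul, pderiv_eq_inner_gradient]
          ring
        rw [h3]
        exact h2
      · have h2 := hH0 x (hΩcl hx) hxb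
        have h3 : E x = 0 := by
          simp only [hE, h2, inner_zero_left, zero_mul, Finset.sum_const_zero]
        rw [h2, h3, add_zero, mul_zero, add_zero]
  -- and positivity of the divergence gives the other one
  have hVpos : ∀ x ∈ D, 0 ≤ V x ∧ (x ∈ Metric.ball x₀ (ρ / 4) → 0 < t x → 0 < V x) := by
    intro x hx
    by_cases hxb : x ∈ Metric.ball x₀ (ρ / 4)
    · have hxρ := hballρ hxb
      have h2 : V x = f (t x) * (‖gradient Q x‖ ^ (r - 2) *
          (r * (s * infLaplacian Q x) + s * R x)) := by
        simp only [hV]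
        rw [← Finset.mul_sum]
        have h3 : ∀ i, fderiv ℝ (Φ i) x (EuclideanSpace.single i 1) =
            fderiv ℝ (gradFlux Q r i) x (EuclideanSpace.single i 1) := by
          intro i
          have h4 : Φ i =ᶠ[𝓝 x] gradFlux Q r i := by
            filter_upwards [hbball x hxb] with y hy
            simp only [hΦ]
            rw [hy, Pi.one_apply, one_mul]
          rw [h4.fderiv_eq]
        simp only [h3]
        rw [sum_fderiv_gradFlux hQ hr1 (hgr x hxρ)]
        simp only [hη, hR]
        ring
      have h3 : 0 < r * (s * infLaplacian Q x) + s * R x := by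
        have h4 := (hball x hxρ).1
        have h5 : |s * R x| ≤ M := by
          rw [abs_mul, habs, one_mul]
          exact hM x (Metric.ball_subset_closedBall hxρ)
        have h6 := (abs_le.1 h5).1
        have h7 : r * (a / 2) < r * (s * infLaplacian Q x) := by gcongr
        linarith
      have h4 : 0 < ‖gradient Q x‖ ^ (r - 2) :=
        Real.rpow_pos_of_pos (norm_pos_iff.2 (hgr x hxρ)) _
      rw [h2]
      refine ⟨mul_nonneg ?_ (by positivity), fun _ h5 => mul_pos (hfpos _ h5) (by positivity)⟩
      rcases le_or_gt (t x) 0 with h5 | h5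
      · exact (hf0 _ h5).1.ge
      · exact (hfpos _ h5).le
    · have h2 : V x = 0 := by
        simp only [hV, hη0 x (hΩcl hx) hxb, zero_mul, Finset.sum_const_zero]
      exact ⟨h2.ge, fun h => absurd h hxb⟩
  have hV0 : 0 ≤ᵐ[volume.restrict D] V := by
    filter_upwards [ae_restrict_mem S.isOpen_D.measurableSet] with x hx
    exact (hVpos x hx).1
  have hVint : ∫ x in D, V x = 0 := by
    refine le_antisymm ?_ (integral_nonneg_of_ae hV0)
    rw [integral_const_mul] at hEsign
    have h2 : 0 ≤ ∫ x in D, E x :=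
      (mul_nonneg_iff_of_pos_left (by linarith)).1 hEsign
    linarith
  have hVae := (ae_restrict_iff' S.isOpen_D.measurableSet).1
    ((integral_eq_zero_iff_of_nonneg_ae hV0 hVi).1 hVint)
  have hopen : IsOpen (Metric.ball x₀ (ρ / 4) ∩ t ⁻¹' Ioi 0) :=
    (htc.mono ((fun x hx => hΩcl (hball x (hballρ hx)).2))).isOpen_inter_preimage
      Metric.isOpen_ball isOpen_Ioi
  have hzero : volume (Metric.ball x₀ (ρ / 4) ∩ t ⁻¹' Ioi 0) = 0 := by
    refine measure_mono_null ?_ (ae_iff.1 hVae)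
    rintro x ⟨hxb, hxt⟩ hx
    have hxD := (hball x (hballρ hxb)).2
    exact ((hVpos x hxD).2 hxb hxt).ne' (hx hxD)
  exact (hopen.measure_pos volume ⟨x₀, Metric.mem_ball_self (by positivity), htx₀⟩).ne' hzero

theorem isInfinityHarmonic (S : IsVariationalSetting Ω D p g)
    (L : IsLimitOfMinimizers Ω D p g k w u) : IsInfinityHarmonic D u := by
  refine ⟨L.continuousOn_lim.mono (S.D_subset.trans subset_closure), fun φ hφ x₀ hx₀ => ?_⟩
  have hφ' : ContDiffAt ℝ 2 φ x₀ := hφ.contDiffAt (S.isOpen_D.mem_nhds hx₀)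
  constructor
  · intro hmin
    by_contra! hlt
    obtain ⟨Q, hQ, hpos, htouch⟩ := exists_smooth_touching S.isBounded L.continuousOn_lim hφ' hmin
      (by linarith)
    exact not_touching S L hQ (one_mul 1) hx₀ (by linarith) (by simpa using htouch)
  · intro hmax
    by_contra! hlt
    obtain ⟨Q, hQ, hpos, htouch⟩ := exists_smooth_touching S.isBounded L.continuousOn_lim.neg
      hφ'.neg (hmax.neg.congr (Eventually.of_forall fun x => by simp; ring))
      (by rw [infLaplacian_neg]; exact hlt)
    refine not_touching S L hQ.neg (s := -1) (by norm_num) hx₀ ?_ fun x hx hne => ?_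
    · rw [infLaplacian_neg]
      linarith
    · have := htouch x hx hne
      simp only [Pi.neg_apply] at this ⊢
      linarith

end IsLimitOfMinimizers

end

theorem theorem4p1 (N : ℕ) (hN : 2 ≤ N) (Ω D : Set (Euc N)) (p : Euc N → ℝ≥0∞) (g : Euc N → ℝ)
    (hΩ_open : IsOpen Ω) (hΩ_conn : IsConnected Ω) (hΩ_bdd : Bornology.IsBounded Ω)
    (hΩ_smooth : HasSmoothBoundary Ω)
    (hD_open : IsOpen D) (hD_conn : IsConnected D) (hD_lip : HasLipschitzBoundary D)
    (hDΩ : closure D ⊆ Ω)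
    (hg : ContinuousOn g (closure Ω)) (hg_mean : ∫ x in frontier Ω, g x ∂μHE[N - 1] = 0)
    (hp_top : ∀ x ∈ D, p x = ⊤)
    (hp_fin : ∀ x ∈ closure Ω \ D, p x ≠ ⊤)
    (hp_C1 : ContDiffOn ℝ 1 (fun x => (p x).toReal) (closure Ω \ D))
    (hp_plus : pPlus Ω D p < ⊤)
    (hp_minus : (N : ℝ≥0∞) < pMinus Ω p) :
    -- for `k > p⁺` the functional `I_k` has exactly one minimizer in `S_k`
    (∀ k : ℕ, pPlus Ω D p < k →
      (∃ v, IsMinimizer (energy Ω p g k) (admissible Ω p k) v) ∧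
      ∀ v w, IsMinimizer (energy Ω p g k) (admissible Ω p k) v →
        IsMinimizer (energy Ω p g k) (admissible Ω p k) w → v =ᵐ[volume.restrict Ω] w) ∧
    -- behaviour of these minimizers `u k` (with continuous representatives `w k`)
    ∀ u : ℕ → Euc N → ℝ,
      (∀ k : ℕ, pPlus Ω D p < k → IsMinimizer (energy Ω p g k) (admissible Ω p k) (u k)) →
      ∃ w : ℕ → Euc N → ℝ,
        (∀ k : ℕ, pPlus Ω D p < k →
          ContinuousOn (w k) (closure Ω) ∧ w k =ᵐ[volume.restrict Ω] u k) ∧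
        ∃ (σ : ℕ → ℕ) (u_inf : Euc N → ℝ), StrictMono σ ∧ (∀ j, pPlus Ω D p < σ j) ∧
          ContinuousOn u_inf (closure Ω) ∧
          TendstoUniformlyOn (fun j => w (σ j)) u_inf atTop (closure Ω) ∧
          u_inf ∈ limitAdmissible Ω D p ∧
          IsMinimizer (limitEnergy Ω D p g) (limitAdmissible Ω D p) u_inf ∧
          IsInfinityHarmonic D u_inf := by
  have S : IsVariationalSetting Ω D p g :=
    { two_le := hN
      isOpen := hΩ_open
      isConnected := hΩ_conn
      isBounded := hΩ_bdd
      boundary := hΩ_smooth.hasLocallyLipschitzBoundary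
      isOpen_D := hD_open
      boundary_D := hD_lip.hasLocallyLipschitzBoundary
      closure_D_subset := hDΩ
      continuousOn_g := hg
      integral_g := hg_mean
      eq_top := hp_top
      continuousOn_p := hp_C1.continuousOn
      pPlus_lt_top := hp_plus
      lt_pMinus := hp_minus }
  refine ⟨fun k hk => ⟨S.exists_isMinimizer hk, fun v w hv hw => S.isMinimizer_unique hk hv hw⟩,
    fun u hu => ?_⟩
  obtain ⟨w, hw, σ, u_inf, L⟩ := S.exists_isLimitOfMinimizers hu
  exact ⟨w, hw, σ, u_inf, L.strictMono, L.pPlus_lt, L.continuousOn_lim, L.tendsto,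
    L.mem_limitAdmissible S, L.isMinimizer_lim S, L.isInfinityHarmonic S⟩
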